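/- Let $n\ge 3$, let $M$ be a smooth $n$-manifold without boundary, and let $\Omega\subset M$ be a relatively compact open set whose boundary $\Sigma=\partial\Omega$ is a smooth embedded hypersurface. Let $\mathcal G=(g_-,g_+)$ be a metric admitting corners along $\Sigma$: $g_-$ and $g_+$ are Riemannian metrics on $\overline\Omega$ and $M\setminus\Omega$ that are $C^2$ up to the boundary and induce the same metric on $\Sigma$. Let $\epsilon>0$ and let $$\Phi_-:\Sigma\times(-2\epsilon,0]\to U_-\subset\overline\Omega,\qquad \Phi_+:\Sigma\times[0,2\epsilon)\to U_+\subset M\setminus\Omega$$ be $C^3$ diffeomorphisms with $\Phi_\pm(x,0)=x$ onto relatively open neighbourhoods of $\Sigma$ (Gaussian coordinates), such that $\Phi_\pm^*g_\pm=\gamma_\pm(x,t)+dt^2$, where $\gamma_\pm(x,t)$ is a bilinear form on $T_x\Sigma$. Let $\tilde M$ be the topological space $M$ with the differentiable structure determined by the open cover consisting of $\Omega$, $M\setminus\overline\Omega$ (with the structure of $M$) and $U=U_-\cup U_+$ (identified with $\Sigma\times(-2\epsilon,2\epsilon)$ by $\Phi_\pm$), and let $g$ be the metric on $\tilde M$ given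 by $g_-$ on $\overline\Omega$ and $g_+$ on $M\setminus\Omega$. Let $H(\Sigma,g_\pm)$ be the mean curvature of $\Sigma$ with respect to $g_\pm$ and the unit normal pointing out of $\Omega$ (so that the unit sphere in Euclidean $\mathbb R^n$ has mean curvature $n-1$). Then there are $\delta_0\in(0,\epsilon)$ and a constant $B$, depending only on these data, such that for every $\phi\in C_c^\infty([-1,1])$ with $0\le\phi\le1$ and $\int\phi=1$ there is a family $\{g_\delta\}_{0<\delta\le\delta_0}$ of $C^2$ Riemannian metrics on $\tilde M$ with the following properties. (i) $g_\delta$ is uniformly close to $g$: for every $\eta>0$ there is $\delta_1>0$ such that $|g_\delta(v,v)-g(v,v)|\le\eta\,g(v,v)$ for all $0<\delta\le\min(\delta_0,\delta_1)$ and all tangent vectors $v$ of $\tilde M$. (ii) $g_\delta=g$ outside $\Sigma\times(-\frac\delta2,\frac\delta2)$, for every $0<\delta\le\delta_0$. (iii) For every $0<\delta\le\delta_0$ the scalar curvature $R_\delta$ of $g_\delta$ satisfies, in the coordinates $(x,t)$ of $U$, $$|R_\delta(x,t)|\le B\quad\text{for } \tfrac{\delta^2}{100}<|t|\le\tfrac\delta2,$$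 $$\Big|R_\delta(x,t)-2\big\{H(\Sigma,g_-)(x)-H(\Sigma,g_+)(x)\big\}\,\tfrac{100}{\delta^2}\,\phi\big(\tfrac{100t}{\delta^2}\big)\Big|\le B\quad\text{for } |t|\le\tfrac{\delta^2}{100}.$$ -/

import Mathlib

open Set Filter Topology
open scoped Manifold ContDiff Bundle

noncomputable section

namespace Corner

/-- The model space `ℝⁿ`. -/
abbrev E (n : ℕ) : Type := EuclideanSpace ℝ (Fin n)

/-! ### Local Riemannian geometry of a matrix of metric components -/

section Local

variable {n : ℕ}

/-- The `i`-th partial derivative of `f` at `y`, within the set `s`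
(one-sided at boundary points of `s`; `s = univ` gives the usual partial derivative). -/
def pderiv (s : Set (E n)) (i : Fin n) (f : E n → ℝ) (y : E n) : ℝ :=
  fderivWithin ℝ f s y (EuclideanSpace.single i 1)

/-- Christoffel symbols `Γᵏᵢⱼ = ½ ∑ₗ Gᵏˡ (∂ᵢ Gⱼₗ + ∂ⱼ Gᵢₗ - ∂ₗ Gᵢⱼ)`. -/
def christoffel (s : Set (E n)) (G : E n → Matrix (Fin n) (Fin n) ℝ) (k i j : Fin n)
    (y : E n) : ℝ :=
  (1 / 2) * ∑ l, (G y)⁻¹ k l *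
    (pderiv s i (fun z => G z j l) y + pderiv s j (fun z => G z i l) y
      - pderiv s l (fun z => G z i j) y)

/-- Ricci curvature
`Ricⱼₖ = ∑ᵢ (∂ᵢ Γⁱⱼₖ - ∂ⱼ Γⁱᵢₖ) + ∑ᵢ ∑ₚ (Γⁱᵢₚ Γᵖⱼₖ - Γⁱⱼₚ Γᵖᵢₖ)`. -/
def ricci (G : E n → Matrix (Fin n) (Fin n) ℝ) (j k : Fin n) (y : E n) : ℝ :=
  ∑ i, (pderiv univ i (christoffel univ G i j k) y - pderiv univ j (christoffel univ G i i k) y)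
    + ∑ i, ∑ p, (christoffel univ G i i p y * christoffel univ G p j k y
        - christoffel univ G i j p y * christoffel univ G p i k y)

/-- Scalar curvature `∑ⱼₖ Gʲᵏ Ricⱼₖ`. -/
def scalarLocal (G : E n → Matrix (Fin n) (Fin n) ℝ) (y : E n) : ℝ :=
  ∑ j, ∑ k, (G y)⁻¹ j k * ricci G j k y

end Local

/-! ### Symmetric two-tensors on manifolds -/

section Tensor

variable {n : ℕ} {N : Type*} [TopologicalSpace N] [ChartedSpace (E n) N]

/-- A field of bilinear forms on the tangent spaces of `N`. -/
abbrev BilinField (n : ℕ) (N : Type*) [TopologicalSpace N] [ChartedSpace (E n) N] : Type _ :=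
  ∀ p : N, TangentSpace 𝓘(ℝ, E n) p →L[ℝ] TangentSpace 𝓘(ℝ, E n) p →L[ℝ] ℝ

/-- The pull-back `(v, w) ↦ β (L v) (L w)` of a bilinear form under a linear map. -/
def pullback {V W : Type*} [AddCommGroup V] [Module ℝ V] [TopologicalSpace V]
    [IsTopologicalAddGroup V] [ContinuousSMul ℝ V] [AddCommGroup W] [Module ℝ W]
    [TopologicalSpace W] [IsTopologicalAddGroup W] [ContinuousSMul ℝ W]
    (β : W →L[ℝ] W →L[ℝ] ℝ) (L : V →L[ℝ] W) : V →L[ℝ] V →L[ℝ] ℝ :=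
  (L.precomp ℝ) ∘L β ∘L L

/-- The matrix of components of `g` in the coordinates given by a chart `e`. -/
def components (e : OpenPartialHomeomorph N (E n)) (g : BilinField n N) (y : E n) :
    Matrix (Fin n) (Fin n) ℝ :=
  fun i j => g (e.symm y)
    (mfderiv 𝓘(ℝ, E n) 𝓘(ℝ, E n) e.symm y (EuclideanSpace.single i (1 : ℝ)))
    (mfderiv 𝓘(ℝ, E n) 𝓘(ℝ, E n) e.symm y (EuclideanSpace.single j (1 : ℝ)))

/-- Scalar curvature at `p`, computed in the preferred chart at `p`. -/
def scalarCurvature (g : BilinField n N) (p : N) : ℝ :=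
  scalarLocal (components (chartAt (E n) p) g) (chartAt (E n) p p)

/-- `g` is a `C²` Riemannian metric on the set `s` (up to the boundary if `s` is a closed domain);
the values of `g` outside `s` are irrelevant. -/
structure IsMetricOn [IsManifold 𝓘(ℝ, E n) 1 N] (g : BilinField n N) (s : Set N) : Prop where
  symm : ∀ p ∈ s, ∀ v w : TangentSpace 𝓘(ℝ, E n) p, g p v w = g p w v
  pos : ∀ p ∈ s, ∀ v : TangentSpace 𝓘(ℝ, E n) p, v ≠ 0 → 0 < g p v v
  contMDiffOn : ContMDiffOn 𝓘(ℝ, E n) (𝓘(ℝ, E n).prod 𝓘(ℝ, E n →L[ℝ] E n →L[ℝ] ℝ)) 2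
    (fun p => Bundle.TotalSpace.mk' (E n →L[ℝ] E n →L[ℝ] ℝ)
      (E := fun p : N => TangentSpace 𝓘(ℝ, E n) p →L[ℝ] TangentSpace 𝓘(ℝ, E n) p →L[ℝ] ℝ)
      p (g p)) s

end Tensor

/-! ### Domains bounded by a hypersurface, and metrics with corners -/

section Domain

variable (m : ℕ) (M S : Type*) [TopologicalSpace M] [ChartedSpace (E (m + 1)) M]
  [TopologicalSpace S] [ChartedSpace (E m) S]

/-- A relatively compact open set `Ω` of the `(m+1)`-manifold `M` whose boundary is a smooth
hypersurface, given as the image of a smooth embedding `ι` of the `m`-manifold `S`. -/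
structure Domain where
  Ω : Set M
  isOpen : IsOpen Ω
  isCompact_closure : IsCompact (closure Ω)
  ι : S → M
  isSmoothEmbedding : Manifold.IsSmoothEmbedding 𝓘(ℝ, E m) 𝓘(ℝ, E (m + 1)) ∞ ι
  range_ι : range ι = frontier Ω

variable {m M S}

/-- The pair `(g₋, g₊)` is a metric admitting corners along `Σ = ∂Ω`: `g₋` is a `C²` metric on
`closure Ω`, `g₊` is a `C²` metric on `M \ Ω`, and they induce the same metric on `Σ`. -/
structure IsCornerMetric [IsManifold 𝓘(ℝ, E (m + 1)) 1 M] (D : Domain m M S)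
    (gm gp : BilinField (m + 1) M) : Prop where
  minus : IsMetricOn gm (closure D.Ω)
  plus : IsMetricOn gp D.Ωᶜ
  agree : ∀ (x : S) (v w : TangentSpace 𝓘(ℝ, E m) x),
    gm (D.ι x) (mfderiv 𝓘(ℝ, E m) 𝓘(ℝ, E (m + 1)) D.ι x v)
        (mfderiv 𝓘(ℝ, E m) 𝓘(ℝ, E (m + 1)) D.ι x w)
      = gp (D.ι x) (mfderiv 𝓘(ℝ, E m) 𝓘(ℝ, E (m + 1)) D.ι x v)
        (mfderiv 𝓘(ℝ, E m) 𝓘(ℝ, E (m + 1)) D.ι x w)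

/-! ### Second fundamental form and mean curvature of the boundary -/

/-- The hypersurface `Σ` near `x`, read in the preferred charts of `S` at `x` and of `M` at `ι x`. -/
def Domain.param (D : Domain m M S) (x : S) (z : E m) : E (m + 1) :=
  chartAt (E (m + 1)) (D.ι x) (D.ι ((chartAt (E m) x).symm z))

/-- First derivatives `(∂ᵢ f)ᵏ` of the local parametrization `f`. -/
def Domain.param₁ (D : Domain m M S) (x : S) (i : Fin m) (k : Fin (m + 1)) (z : E m) : ℝ :=
  pderiv univ i (fun z' => D.param x z' k) z

/-- The components, in the chart of `M` at `ι x`, of the metric `g`. -/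
def Domain.comp (D : Domain m M S) (g : BilinField (m + 1) M) (x : S) :
    E (m + 1) → Matrix (Fin (m + 1)) (Fin (m + 1)) ℝ :=
  components (chartAt (E (m + 1)) (D.ι x)) g

/-- The metric `hᵢⱼ = g(∂ᵢ f, ∂ⱼ f)` induced by `g` on `Σ`, at `x`. -/
def Domain.inducedMetric (D : Domain m M S) (g : BilinField (m + 1) M) (x : S) :
    Matrix (Fin m) (Fin m) ℝ :=
  fun i j => ∑ k, ∑ l, D.comp g x (chartAt (E (m + 1)) (D.ι x) (D.ι x)) k l
    * D.param₁ x i k (chartAt (E m) x x) * D.param₁ x j l (chartAt (E m) x x)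

/-- The second fundamental form `Aᵢⱼ = g(∇ᵢ ν, ∂ⱼ f) = - g(ν, ∇ᵢ ∂ⱼ f)` of `Σ` at `x` with respect
to the unit normal `ν`. The Christoffel symbols are computed from one side of `Σ`, inside the
closed domain `s` (`closure Ω` or `M \ Ω`) on which the metric lives. -/
def Domain.secondFundamentalForm (D : Domain m M S) (s : Set M) (g : BilinField (m + 1) M) (x : S)
    (ν : TangentSpace 𝓘(ℝ, E (m + 1)) (D.ι x)) : Matrix (Fin m) (Fin m) ℝ :=
  let e := chartAt (E (m + 1)) (D.ι x)
  let y := e (D.ι x)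
  let z := chartAt (E m) x x
  let ν' : E (m + 1) := mfderiv 𝓘(ℝ, E (m + 1)) 𝓘(ℝ, E (m + 1)) e (D.ι x) ν
  fun i j => - ∑ k, ∑ l, D.comp g x y k l * ν' k *
    (pderiv univ i (D.param₁ x j l) z
      + ∑ a, ∑ b, christoffel (e.target ∩ e.symm ⁻¹' s) (D.comp g x) l a b y
          * D.param₁ x i a z * D.param₁ x j b z)

/-- Mean curvature: the trace of the second fundamental form with respect to the induced metric.
With the normal pointing to infinity the unit sphere of `ℝⁿ` has mean curvature `n - 1`. -/
def Domain.meanCurvature (D : Domain m M S) (s : Set M) (g : BilinField (m + 1) M) (x : S)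
    (ν : TangentSpace 𝓘(ℝ, E (m + 1)) (D.ι x)) : ℝ :=
  ∑ i, ∑ j, (D.inducedMetric g x)⁻¹ i j * D.secondFundamentalForm s g x ν i j

/-! ### Collars -/

/-- A two-sided collar `Φ : Σ × (-2ε, 2ε) → U ⊆ M` of `Σ`: a homeomorphism onto an open set that
maps `Σ × (-2ε, 0)` into `Ω` and `Σ × (0, 2ε)` into `M \ closure Ω`, is the identity on `Σ`, and
whose two halves `Φ₋ : Σ × (-2ε, 0] → U ∩ closure Ω` and `Φ₊ : Σ × [0, 2ε) → U \ Ω` are `C³`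
diffeomorphisms. (`Φ` itself need not be differentiable across `Σ`.) -/
structure Collar (D : Domain m M S) where
  ε : ℝ
  ε_pos : 0 < ε
  Φ : OpenPartialHomeomorph (S × ℝ) M
  source_eq : Φ.source = univ ×ˢ Ioo (-(2 * ε)) (2 * ε)
  zero : ∀ x, Φ (x, 0) = D.ι x
  neg : ∀ x, ∀ t ∈ Ioo (-(2 * ε)) 0, Φ (x, t) ∈ D.Ω
  pos : ∀ x, ∀ t ∈ Ioo 0 (2 * ε), Φ (x, t) ∉ closure D.Ω
  contMDiffOn_minus : ContMDiffOn (𝓘(ℝ, E m).prod 𝓘(ℝ, ℝ)) 𝓘(ℝ, E (m + 1)) 3 Φ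
    (univ ×ˢ Ioc (-(2 * ε)) 0)
  contMDiffOn_plus : ContMDiffOn (𝓘(ℝ, E m).prod 𝓘(ℝ, ℝ)) 𝓘(ℝ, E (m + 1)) 3 Φ
    (univ ×ˢ Ico 0 (2 * ε))
  contMDiffOn_symm_minus : ContMDiffOn 𝓘(ℝ, E (m + 1)) (𝓘(ℝ, E m).prod 𝓘(ℝ, ℝ)) 3 Φ.symm
    (Φ.target ∩ closure D.Ω)
  contMDiffOn_symm_plus : ContMDiffOn 𝓘(ℝ, E (m + 1)) (𝓘(ℝ, E m).prod 𝓘(ℝ, ℝ)) 3 Φ.symm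
    (Φ.target ∩ D.Ωᶜ)

namespace Collar

variable {D : Domain m M S} (C : Collar D)

/-- The differential of `Φ₋ : Σ × (-2ε, 0] → closure Ω` at `(x, t)`, applied to `v + a ∂ₜ`. -/
def dMinus (x : S) (t : ℝ) (v : TangentSpace 𝓘(ℝ, E m) x) (a : ℝ) :
    TangentSpace 𝓘(ℝ, E (m + 1)) (C.Φ (x, t)) :=
  mfderivWithin (𝓘(ℝ, E m).prod 𝓘(ℝ, ℝ)) 𝓘(ℝ, E (m + 1)) C.Φ
    (univ ×ˢ Ioc (-(2 * C.ε)) 0) (x, t) ((v, a) : E m × ℝ)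

/-- The differential of `Φ₊ : Σ × [0, 2ε) → M \ Ω` at `(x, t)`, applied to `v + a ∂ₜ`. -/
def dPlus (x : S) (t : ℝ) (v : TangentSpace 𝓘(ℝ, E m) x) (a : ℝ) :
    TangentSpace 𝓘(ℝ, E (m + 1)) (C.Φ (x, t)) :=
  mfderivWithin (𝓘(ℝ, E m).prod 𝓘(ℝ, ℝ)) 𝓘(ℝ, E (m + 1)) C.Φ
    (univ ×ˢ Ico 0 (2 * C.ε)) (x, t) ((v, a) : E m × ℝ)

/-- The two halves of the collar are Gaussian coordinates for `g₋` and `g₊`: the pulled back metrics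
have the form `γ(x,t) + dt²` with `γ(x,t)` a bilinear form on `T_x Σ`. -/
structure IsGaussian (gm gp : BilinField (m + 1) M) : Prop where
  minus : ∀ x, ∀ t ∈ Ioc (-(2 * C.ε)) 0, ∀ (v w : TangentSpace 𝓘(ℝ, E m) x) (a b : ℝ),
    gm (C.Φ (x, t)) (C.dMinus x t v a) (C.dMinus x t w b)
      = gm (C.Φ (x, t)) (C.dMinus x t v 0) (C.dMinus x t w 0) + a * b
  plus : ∀ x, ∀ t ∈ Ico 0 (2 * C.ε), ∀ (v w : TangentSpace 𝓘(ℝ, E m) x) (a b : ℝ),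
    gp (C.Φ (x, t)) (C.dPlus x t v a) (C.dPlus x t w b)
      = gp (C.Φ (x, t)) (C.dPlus x t v 0) (C.dPlus x t w 0) + a * b

/-- `H(Σ, g₋)`: mean curvature of `Σ` in `(closure Ω, g₋)` with respect to the normal `∂ₜ`, which
for a Gaussian collar is the unit normal pointing out of `Ω`. -/
def Hminus (gm : BilinField (m + 1) M) (x : S) : ℝ :=
  D.meanCurvature (closure D.Ω) gm x (show E (m + 1) from C.dMinus x 0 0 1)

/-- `H(Σ, g₊)`: mean curvature of `Σ` in `(M \ Ω, g₊)` with respect to the normal `∂ₜ`, which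
for a Gaussian collar is the unit normal pointing out of `Ω`. -/
def Hplus (gp : BilinField (m + 1) M) (x : S) : ℝ :=
  D.meanCurvature D.Ωᶜ gp x (show E (m + 1) from C.dPlus x 0 0 1)

/-! ### The modified manifold -/

/-- The modified manifold `M̃`: the topological space `M`, with the differentiable structure
determined by the open cover `Ω`, `M \ closure Ω` (with the structure of `M`) and
`U = Φ (Σ × (-2ε, 2ε))` (with the product structure). -/
def Glued (_C : Collar D) : Type _ := M

instance : TopologicalSpace C.Glued := inferInstanceAs (TopologicalSpace M)

/-- The identity map from `M̃` to `M`. -/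
def toM (p : C.Glued) : M := p

/-- The linear identification `ℝᵐ × ℝ ≃ ℝᵐ⁺¹`, `(x, t) ↦ (t, x)`. -/
def coord (m : ℕ) : (E m × ℝ) ≃L[ℝ] E (m + 1) :=
  (ContinuousLinearEquiv.prodComm ℝ (E m) ℝ).trans
    (((ContinuousLinearEquiv.refl ℝ ℝ).prodCongr (EuclideanSpace.equiv (Fin m) ℝ)).trans
      ((Fin.consEquivL ℝ (fun _ : Fin (m + 1) => ℝ)).trans
        (EuclideanSpace.equiv (Fin (m + 1)) ℝ).symm))

/-- The chart of `U` induced by a chart `c` of `Σ`. -/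
def collarChart (c : OpenPartialHomeomorph S (E m)) : OpenPartialHomeomorph M (E (m + 1)) :=
  C.Φ.symm ≫ₕ (c.prod (OpenPartialHomeomorph.refl ℝ)) ≫ₕ
    (coord m).toHomeomorph.toOpenPartialHomeomorph

theorem mem_target_of_mem_frontier {p : M} (hp : p ∈ frontier D.Ω) : p ∈ C.Φ.target := by
  rw [← D.range_ι] at hp
  obtain ⟨x, rfl⟩ := hp
  rw [← C.zero]
  refine C.Φ.map_source ?_
  rw [C.source_eq]
  exact ⟨mem_univ _, by constructor <;> linarith [C.ε_pos]⟩

/-- The atlas of `M̃`: charts of `Ω`, of `M \ closure Ω` and of `U`. -/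
def gluedAtlas : Set (OpenPartialHomeomorph M (E (m + 1))) :=
  {k | (∃ e ∈ atlas (E (m + 1)) M, k = e.restr D.Ω) ∨
    (∃ e ∈ atlas (E (m + 1)) M, k = e.restr (closure D.Ω)ᶜ) ∨
    (∃ c ∈ atlas (E m) S, k = C.collarChart c)}

open Classical in
/-- The preferred chart of `M̃` at `p`: a chart of `U` whenever `p ∈ U`. -/
def gluedChartAt (p : M) : OpenPartialHomeomorph M (E (m + 1)) :=
  if p ∈ C.Φ.target then C.collarChart (chartAt (E m) (C.Φ.symm p).1)
  else if p ∈ D.Ω then (chartAt (E (m + 1)) p).restr D.Ω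
  else (chartAt (E (m + 1)) p).restr (closure D.Ω)ᶜ

theorem mem_gluedChartAt_source (p : M) : p ∈ (C.gluedChartAt p).source := by
  unfold gluedChartAt
  split_ifs with h₁ h₂
  · simp [collarChart, h₁]
  · rw [OpenPartialHomeomorph.restr_source' _ _ D.isOpen]
    exact ⟨mem_chart_source _ p, h₂⟩
  · rw [OpenPartialHomeomorph.restr_source' _ _ isClosed_closure.isOpen_compl]
    refine ⟨mem_chart_source _ p, fun h => h₁ (C.mem_target_of_mem_frontier ?_)⟩
    rw [D.isOpen.frontier_eq]
    exact ⟨h, h₂⟩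

theorem gluedChartAt_mem_gluedAtlas (p : M) : C.gluedChartAt p ∈ C.gluedAtlas := by
  unfold gluedChartAt
  split_ifs with h₁ h₂
  · exact Or.inr (Or.inr ⟨_, chart_mem_atlas _ _, rfl⟩)
  · exact Or.inl ⟨_, chart_mem_atlas _ _, rfl⟩
  · exact Or.inr (Or.inl ⟨_, chart_mem_atlas _ _, rfl⟩)

instance : ChartedSpace (E (m + 1)) C.Glued where
  atlas := C.gluedAtlas
  chartAt := C.gluedChartAt
  mem_chart_source := C.mem_gluedChartAt_source
  chart_mem_atlas := C.gluedChartAt_mem_gluedAtlas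

theorem nonpos_of_mem {x : S} {t : ℝ} (h : (x, t) ∈ C.Φ.source) (hΩ : C.Φ (x, t) ∈ D.Ω) :
    t ∈ Ioc (-(2 * C.ε)) 0 := by
  rw [C.source_eq] at h
  refine ⟨h.2.1, le_of_not_gt fun ht => C.pos x t ⟨ht, h.2.2⟩ (subset_closure hΩ)⟩

theorem nonneg_of_mem {x : S} {t : ℝ} (h : (x, t) ∈ C.Φ.source)
    (hΩ : C.Φ (x, t) ∈ (closure D.Ω)ᶜ) : t ∈ Ico 0 (2 * C.ε) := by
  rw [C.source_eq] at h
  refine ⟨le_of_not_gt fun ht => hΩ (subset_closure (C.neg x t ⟨h.2.1, ht⟩)), h.2.2⟩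

theorem mem_collarChart_target {c : OpenPartialHomeomorph S (E m)} {y : E (m + 1)}
    (hy : y ∈ (C.collarChart c).target) :
    ((coord m).symm y).1 ∈ c.target ∧
      (c.symm ((coord m).symm y).1, ((coord m).symm y).2) ∈ C.Φ.source := by
  simpa [collarChart] using hy

theorem mem_collarChart_source {c : OpenPartialHomeomorph S (E m)} {p : M}
    (hp : p ∈ (C.collarChart c).source) : p ∈ C.Φ.target ∧ (C.Φ.symm p).1 ∈ c.source := by
  simpa [collarChart] using hp

section Manifold

variable [IsManifold 𝓘(ℝ, E m) ∞ S] [IsManifold 𝓘(ℝ, E (m + 1)) ∞ M]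

theorem contMDiffOn_prodParam {c : OpenPartialHomeomorph S (E m)} (hc : c ∈ atlas (E m) S) :
    ContMDiffOn 𝓘(ℝ, E (m + 1)) (𝓘(ℝ, E m).prod 𝓘(ℝ, ℝ)) 3
      (fun y => (c.symm ((coord m).symm y).1, ((coord m).symm y).2))
      {y | ((coord m).symm y).1 ∈ c.target} := by
  have h3 : IsManifold 𝓘(ℝ, E m) 3 S := inferInstance
  have hs := contMDiffOn_symm_of_mem_maximalAtlas (I := 𝓘(ℝ, E m)) (n := 3)
    (IsManifold.subset_maximalAtlas hc)
  have h₁ : ContMDiff 𝓘(ℝ, E (m + 1)) 𝓘(ℝ, E m) 3 (fun y => ((coord m).symm y).1) :=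
    (contDiff_fst.comp (coord m).symm.contDiff).contMDiff
  have h₂ : ContMDiff 𝓘(ℝ, E (m + 1)) 𝓘(ℝ, ℝ) 3 (fun y => ((coord m).symm y).2) :=
    (contDiff_snd.comp (coord m).symm.contDiff).contMDiff
  exact (hs.comp h₁.contMDiffOn (fun y hy => hy)).prodMk h₂.contMDiffOn

theorem contDiffOn_prodChart {c : OpenPartialHomeomorph S (E m)} (hc : c ∈ atlas (E m) S)
    {h : E (m + 1) → S × ℝ} {s : Set (E (m + 1))}
    (hh : ContMDiffOn 𝓘(ℝ, E (m + 1)) (𝓘(ℝ, E m).prod 𝓘(ℝ, ℝ)) 3 h s)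
    (hs : ∀ y ∈ s, (h y).1 ∈ c.source) :
    ContDiffOn ℝ 3 (fun y => coord m (c (h y).1, (h y).2)) s := by
  have h3 : IsManifold 𝓘(ℝ, E m) 3 S := inferInstance
  have hcs := contMDiffOn_of_mem_maximalAtlas (I := 𝓘(ℝ, E m)) (n := 3)
    (IsManifold.subset_maximalAtlas hc)
  have h₁ : ContDiffOn ℝ 3 (fun y => c (h y).1) s :=
    contMDiffOn_iff_contDiffOn.1
      (hcs.comp (contMDiff_fst.comp_contMDiffOn hh) (fun y hy => hs y hy))
  have h₂ : ContDiffOn ℝ 3 (fun y => (h y).2) s :=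
    contMDiffOn_iff_contDiffOn.1 (contMDiff_snd.comp_contMDiffOn hh)
  exact (coord m).contDiff.comp_contDiffOn (h₁.prodMk h₂)

theorem collar_collar {c c' : OpenPartialHomeomorph S (E m)}
    (hc : c ∈ atlas (E m) S) (hc' : c' ∈ atlas (E m) S) :
    ContDiffOn ℝ 3 ((C.collarChart c).symm ≫ₕ C.collarChart c')
      ((C.collarChart c).symm ≫ₕ C.collarChart c').source := by
  have hy₁ : ∀ y ∈ ((C.collarChart c).symm ≫ₕ C.collarChart c').source,
      C.Φ.symm (C.Φ (c.symm ((coord m).symm y).1, ((coord m).symm y).2))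
        = (c.symm ((coord m).symm y).1, ((coord m).symm y).2) := fun y hy =>
    C.Φ.left_inv (C.mem_collarChart_target hy.1).2
  refine ContDiffOn.congr (contDiffOn_prodChart hc' ((contMDiffOn_prodParam hc).mono
    (fun y hy => (C.mem_collarChart_target hy.1).1)) (fun y hy => ?_)) (fun y hy => ?_)
  · have := (C.mem_collarChart_source hy.2).2
    change (C.Φ.symm (C.Φ (c.symm ((coord m).symm y).1, ((coord m).symm y).2))).1 ∈ _ at this
    rwa [hy₁ y hy] at this
  · change coord m (c' (C.Φ.symm (C.Φ (c.symm ((coord m).symm y).1, ((coord m).symm y).2))).1,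
      (C.Φ.symm (C.Φ (c.symm ((coord m).symm y).1, ((coord m).symm y).2))).2) = _
    rw [hy₁ y hy]

theorem collar_restr {c : OpenPartialHomeomorph S (E m)} (hc : c ∈ atlas (E m) S)
    {e : OpenPartialHomeomorph M (E (m + 1))} (he : e ∈ atlas (E (m + 1)) M)
    {s : Set M} (hs : IsOpen s) {a : Set ℝ}
    (hΦ : ContMDiffOn (𝓘(ℝ, E m).prod 𝓘(ℝ, ℝ)) 𝓘(ℝ, E (m + 1)) 3 C.Φ (univ ×ˢ a))
    (ha : ∀ x t, (x, t) ∈ C.Φ.source → C.Φ (x, t) ∈ s → t ∈ a) :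
    ContDiffOn ℝ 3 ((C.collarChart c).symm ≫ₕ e.restr s)
      ((C.collarChart c).symm ≫ₕ e.restr s).source := by
  have h3 : IsManifold 𝓘(ℝ, E (m + 1)) 3 M := inferInstance
  have hes := contMDiffOn_of_mem_maximalAtlas (I := 𝓘(ℝ, E (m + 1))) (n := 3)
    (IsManifold.subset_maximalAtlas he)
  have hy₂ : ∀ y ∈ ((C.collarChart c).symm ≫ₕ e.restr s).source,
      C.Φ (c.symm ((coord m).symm y).1, ((coord m).symm y).2) ∈ e.source ∩ s := fun y hy => by
    rw [← OpenPartialHomeomorph.restr_source' _ _ hs]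
    exact hy.2
  refine contMDiffOn_iff_contDiffOn.1 ((hes.comp (hΦ.comp ((contMDiffOn_prodParam hc).mono
    (fun y hy => (C.mem_collarChart_target hy.1).1)) (fun y hy => ?_)) (fun y hy => ?_)))
  · exact ⟨mem_univ _, ha _ _ (C.mem_collarChart_target hy.1).2 (hy₂ y hy).2⟩
  · exact (hy₂ y hy).1

theorem restr_collar {c : OpenPartialHomeomorph S (E m)} (hc : c ∈ atlas (E m) S)
    {e : OpenPartialHomeomorph M (E (m + 1))} (he : e ∈ atlas (E (m + 1)) M)
    {s : Set M} (hs : IsOpen s) {s' : Set M} (hss : s ⊆ s')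
    (hΦ : ContMDiffOn 𝓘(ℝ, E (m + 1)) (𝓘(ℝ, E m).prod 𝓘(ℝ, ℝ)) 3 C.Φ.symm (C.Φ.target ∩ s')) :
    ContDiffOn ℝ 3 ((e.restr s).symm ≫ₕ C.collarChart c)
      ((e.restr s).symm ≫ₕ C.collarChart c).source := by
  have h3 : IsManifold 𝓘(ℝ, E (m + 1)) 3 M := inferInstance
  have hes := contMDiffOn_symm_of_mem_maximalAtlas (I := 𝓘(ℝ, E (m + 1))) (n := 3)
    (IsManifold.subset_maximalAtlas he)
  have hy₁ : ∀ y ∈ ((e.restr s).symm ≫ₕ C.collarChart c).source,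
      y ∈ e.target ∧ e.symm y ∈ s := fun y hy => by
    have := (e.restr s).map_target hy.1
    rw [OpenPartialHomeomorph.restr_source' _ _ hs] at this
    exact ⟨hy.1.1, this.2⟩
  refine contDiffOn_prodChart hc (hΦ.comp (hes.mono fun y hy => (hy₁ y hy).1) fun y hy => ?_)
    fun y hy => ?_
  · exact ⟨(C.mem_collarChart_source hy.2).1, hss (hy₁ y hy).2⟩
  · exact (C.mem_collarChart_source hy.2).2

theorem restr_restr {e e' : OpenPartialHomeomorph M (E (m + 1))} (he : e ∈ atlas (E (m + 1)) M)
    (he' : e' ∈ atlas (E (m + 1)) M) (s s' : Set M) :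
    ContDiffOn ℝ 3 ((e.restr s).symm ≫ₕ e'.restr s') ((e.restr s).symm ≫ₕ e'.restr s').source := by
  have h3 : IsManifold 𝓘(ℝ, E (m + 1)) 3 M := inferInstance
  have h := contMDiffOn_symm_of_mem_maximalAtlas (I := 𝓘(ℝ, E (m + 1))) (n := 3)
    (IsManifold.subset_maximalAtlas he)
  have h' := contMDiffOn_of_mem_maximalAtlas (I := 𝓘(ℝ, E (m + 1))) (n := 3)
    (IsManifold.subset_maximalAtlas he')
  exact contMDiffOn_iff_contDiffOn.1 (h'.comp (h.mono fun y hy => hy.1.1) fun y hy => hy.2.1)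

theorem contDiffOn_trans {k k' : OpenPartialHomeomorph M (E (m + 1))} (hk : k ∈ C.gluedAtlas)
    (hk' : k' ∈ C.gluedAtlas) : ContDiffOn ℝ 3 (k.symm ≫ₕ k') (k.symm ≫ₕ k').source := by
  have ho : IsOpen (closure D.Ω)ᶜ := isClosed_closure.isOpen_compl
  rcases hk with ⟨e, he, rfl⟩ | ⟨e, he, rfl⟩ | ⟨c, hc, rfl⟩ <;>
  rcases hk' with ⟨e', he', rfl⟩ | ⟨e', he', rfl⟩ | ⟨c', hc', rfl⟩
  · exact restr_restr he he' _ _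
  · exact restr_restr he he' _ _
  · exact C.restr_collar hc' he D.isOpen subset_closure C.contMDiffOn_symm_minus
  · exact restr_restr he he' _ _
  · exact restr_restr he he' _ _
  · exact C.restr_collar hc' he ho (compl_subset_compl.2 subset_closure) C.contMDiffOn_symm_plus
  · exact C.collar_restr hc he' D.isOpen C.contMDiffOn_minus fun _ _ => C.nonpos_of_mem
  · exact C.collar_restr hc he' ho C.contMDiffOn_plus fun _ _ => C.nonneg_of_mem
  · exact C.collar_collar hc hc'

/-- `M̃` is a `C³` manifold. -/
instance : IsManifold 𝓘(ℝ, E (m + 1)) 3 C.Glued := by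
  refine isManifold_of_contDiffOn _ _ _ fun k k' hk hk' => ?_
  have h := C.contDiffOn_trans hk hk'
  simp only [modelWithCornersSelf_coe, modelWithCornersSelf_coe_symm, range_id, inter_univ,
    preimage_id, Function.id_comp, Function.comp_id]
  exact h

instance : IsManifold 𝓘(ℝ, E (m + 1)) 1 C.Glued :=
  IsManifold.of_le (n := 3) (by norm_num)

end Manifold

/-- The metric `g` on `M̃` defined by the pair `(g₋, g₊)`: the pull-back of `g₋` under the identity
`M̃ → M` on `closure Ω`, and of `g₊` elsewhere. At points of `Σ` the identity is differentiated from
inside `closure Ω`. -/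
def gluedMetric (gm gp : BilinField (m + 1) M) : BilinField (m + 1) C.Glued := by
  classical
  exact fun p =>
    if C.toM p ∈ closure D.Ω then
      pullback (gm (C.toM p))
        (mfderivWithin 𝓘(ℝ, E (m + 1)) 𝓘(ℝ, E (m + 1)) C.toM (C.toM ⁻¹' closure D.Ω) p)
    else
      pullback (gp (C.toM p))
        (mfderivWithin 𝓘(ℝ, E (m + 1)) 𝓘(ℝ, E (m + 1)) C.toM (C.toM ⁻¹' D.Ωᶜ) p)

/-- The point of `M̃` with collar coordinates `(x, t)`. -/
def pt (x : S) (t : ℝ) : C.Glued := C.Φ (x, t)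

/-- The part of `M̃` with collar coordinates in `Σ × (-r, r)`. -/
def strip (r : ℝ) : Set C.Glued := {p | ∃ (x : S) (t : ℝ), |t| < r ∧ p = C.pt x t}

end Collar

end Domain

/-- `φ ∈ C_c^∞([-1,1])` with `0 ≤ φ ≤ 1` and integral one. -/
structure IsMollifier (φ : ℝ → ℝ) : Prop where
  contDiff : ContDiff ℝ ∞ φ
  tsupport_subset : tsupport φ ⊆ Icc (-1) 1
  nonneg : ∀ t, 0 ≤ φ t
  le_one : ∀ t, φ t ≤ 1
  integral_eq : ∫ t, φ t = 1

end Corner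

end

noncomputable section

set_option maxSynthPendingDepth 3
set_option linter.unusedSectionVars false

namespace Corner

/-! ### Bilinear forms and their Gram matrices -/

section Algebra

/-! In the Gaussian collar the two metrics are `γ₋(x,t) + dt²` for `t ≤ 0` and `γ₊(x,t) + dt²` for
`t ≥ 0`, with `γ₋ = γ₊` at `t = 0`. Let `a ≤ 0 ≤ h` be smoothings of `min t 0` and `max t 0` which
equal these functions for `|t| ≥ δ/2`. The new metric is `γ₋(x,a(t)) + γ₊(x,h(t)) - γ₋(x,0) + dt²`.
Each `γ` is evaluated only on its own closed side, where it is C² up to the boundary, so the sum is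
C² across Σ, and for `|t| ≥ δ/2` it is the original metric.

Put `ψ(t) = (100/δ²) φ(100t/δ²)`. The smoothings are built so that `h'' = ψ + O(1)` and `a'' = -ψ +
O(1)` (`exists_isProfile`). Where `ψ` is nonzero, `a` and `h` are `O(δ²)`, which balances the height
`100/δ²` of `ψ`. Hence the second normal derivative of the new metric is `ψ (∂ₜγ₊ - ∂ₜγ₋)(x,0) +
O(1)`, and its other derivatives of order at most two are bounded (`LineBound.derivs_comp_sub`). In
Gaussian coordinates a large second normal derivative enters the scalar curvature only through `-tr
∂ₜ²γ` (`exists_abs_scalarLocal_add_contr_le`), and `tr ∂ₜγ` at `t = 0` is twice the mean curvature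
(`IsHalf.two_mul_meanCurvature_eq`). Together these give `R = 2 (H₋ - H₊) ψ + O(1)`
(`exists_abs_scalarLocal_smoothed_le`).

The bounds must be uniform over Σ, which is compact. They hold in charts chosen by a compactness
argument (`exists_chartBound`), not in the preferred chart at each point through which scalar and
mean curvature are defined. The passage between the two needs invariance of the scalar curvature
under C³ changes of coordinates (`scalarLocal_pullback`), proved from the transformation law of the
Koszul expression. The same law in a one-sided form shows that the second fundamental form is `½
∂ₜγ`.

Finally `a` and `h` differ from `min t 0` and `max t 0` by `O(δ²)`, so the new metric differs from
`g` by a relative error `O(δ²)`, uniformly in `φ`. This gives both positive definiteness for small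
`δ` and uniform closeness. -/

/-- Continuous bilinear forms on `ℝⁿ`. -/
abbrev BL (n : ℕ) : Type := E n →L[ℝ] E n →L[ℝ] ℝ

variable {n : ℕ}

/-- The standard basis vectors. -/
abbrev bv (i : Fin n) : E n := EuclideanSpace.single i (1 : ℝ)

/-- The Gram matrix of a bilinear form in the standard basis. -/
def gram (B : BL n) : Matrix (Fin n) (Fin n) ℝ := fun i j => B (bv i) (bv j)

theorem gram_apply (B : BL n) (i j : Fin n) : gram B i j = B (bv i) (bv j) := rfl

theorem sum_smul_bv (u : E n) : u = ∑ i, u i • bv i := by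
  have := (EuclideanSpace.basisFun (Fin n) ℝ).sum_repr u
  simpa using this.symm

theorem pullback_apply {V W : Type*} [AddCommGroup V] [Module ℝ V] [TopologicalSpace V]
    [IsTopologicalAddGroup V] [ContinuousSMul ℝ V] [AddCommGroup W] [Module ℝ W]
    [TopologicalSpace W] [IsTopologicalAddGroup W] [ContinuousSMul ℝ W]
    (β : W →L[ℝ] W →L[ℝ] ℝ) (L : V →L[ℝ] W) (v w : V) :
    pullback β L v w = β (L v) (L w) := rfl

/-- The matrix of a linear map in the standard basis. -/
def lmat (L : E n →L[ℝ] E n) : Matrix (Fin n) (Fin n) ℝ := fun a i => L (bv i) a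

theorem gram_pullback (B : BL n) (L : E n →L[ℝ] E n) :
    gram (pullback B L) = (lmat L).transpose * gram B * lmat L := by
  ext i j
  rw [gram_apply, pullback_apply, sum_smul_bv (L (bv i)), sum_smul_bv (L (bv j))]
  simp only [map_sum, map_smul, sum_apply, smul_apply,
    smul_eq_mul, Matrix.mul_apply, Matrix.transpose_apply, lmat, gram_apply]
  exact Finset.sum_congr rfl fun _ _ => mul_comm _ _

theorem lmat_comp (L L' : E n →L[ℝ] E n) : lmat (L ∘L L') = lmat L * lmat L' := by
  ext a i
  simp only [lmat, ContinuousLinearMap.comp_apply, Matrix.mul_apply]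
  conv_lhs => rw [sum_smul_bv (L' (bv i))]
  simp [mul_comm]

theorem lmat_id : lmat (ContinuousLinearMap.id ℝ (E n)) = 1 := by
  ext a i
  simp [lmat, Matrix.one_apply]

/-- The contraction `∑ Gʲᵏ Rⱼₖ` of `R` with respect to `G`. -/
def contr {ι : Type*} [Fintype ι] [DecidableEq ι] (G R : Matrix ι ι ℝ) : ℝ :=
  ∑ j, ∑ k, G⁻¹ j k * R j k

theorem contr_eq_trace {ι : Type*} [Fintype ι] [DecidableEq ι] (G R : Matrix ι ι ℝ) :
    contr G R = (G⁻¹ * R.transpose).trace := by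
  simp [contr, Matrix.trace, Matrix.mul_apply]

/-- The inverse of `G` changes by `Q` where `R` changes by `P`; the factors meet and cancel under
the cyclic trace. -/
theorem contr_conj {ι : Type*} [Fintype ι] [DecidableEq ι] (G R P Q : Matrix ι ι ℝ)
    (h : P * Q = 1) : contr (P.transpose * G * P) (P.transpose * R * P) = contr G R := by
  have h' : Q * P = 1 := mul_eq_one_comm.1 h
  have hP : P⁻¹ = Q := Matrix.inv_eq_right_inv h
  have hPt : P.transpose⁻¹ = Q.transpose := by rw [← Matrix.transpose_nonsing_inv, hP]
  rw [contr_eq_trace, contr_eq_trace, Matrix.mul_inv_rev, Matrix.mul_inv_rev, hP, hPt]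
  simp only [Matrix.transpose_mul, Matrix.transpose_transpose]
  have : Q.transpose * P.transpose = 1 := by rw [← Matrix.transpose_mul, h, Matrix.transpose_one]
  calc (Q * (G⁻¹ * Q.transpose) * (P.transpose * (R.transpose * P))).trace
      = (Q * (G⁻¹ * ((Q.transpose * P.transpose) * (R.transpose * P)))).trace := by
        simp only [Matrix.mul_assoc]
    _ = (G⁻¹ * R.transpose).trace := by
        rw [this, Matrix.one_mul, Matrix.trace_mul_comm]
        simp only [Matrix.mul_assoc, h, Matrix.mul_one]

theorem contr_gram_pullback (G R : BL n) (L : E n ≃L[ℝ] E n) :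
    contr (gram (pullback G (L : E n →L[ℝ] E n))) (gram (pullback R (L : E n →L[ℝ] E n)))
      = contr (gram G) (gram R) := by
  rw [gram_pullback, gram_pullback]
  refine contr_conj _ _ _ (lmat (L.symm : E n →L[ℝ] E n)) ?_
  rw [← lmat_comp, ContinuousLinearEquiv.coe_comp_coe_symm, lmat_id]

theorem gram_mulVec (B : BL n) (v : Fin n → ℝ) (i : Fin n) :
    (gram B).mulVec v i = B (bv i) (WithLp.toLp 2 v) := by
  conv_rhs => rw [sum_smul_bv (WithLp.toLp 2 v)]
  simp [Matrix.mulVec, dotProduct, gram_apply, mul_comm]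

/-- The Gram matrix of a positive definite form is invertible. -/
theorem isUnit_gram {B : BL n} (hB : ∀ v, v ≠ 0 → 0 < B v v) : IsUnit (gram B).det := by
  rw [← Matrix.isUnit_iff_isUnit_det, ← Matrix.mulVec_injective_iff_isUnit]
  rw [← Matrix.coe_mulVecLin]
  refine (injective_iff_map_eq_zero _).2 fun v hv => ?_
  by_contra hne
  have h0 : B (WithLp.toLp 2 v) (WithLp.toLp 2 v) = 0 := by
    have h1 : ∀ w : E n, B w (WithLp.toLp 2 v) = ∑ i, w i * B (bv i) (WithLp.toLp 2 v) := by
      intro w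
      conv_lhs => rw [sum_smul_bv w]
      simp
    rw [h1]
    refine Finset.sum_eq_zero fun i _ => ?_
    rw [← gram_mulVec]
    have : (gram B).mulVec v i = 0 := congrFun hv i
    simp [this]
  refine (hB _ ?_).ne' h0
  simpa using hne

end Algebra

/-! ### Koszul formula and change of coordinates -/

section Koszul

variable {V W : Type*} [NormedAddCommGroup V] [NormedSpace ℝ V]
  [NormedAddCommGroup W] [NormedSpace ℝ W]

/-- The Koszul expression `½ (D u v w + D v u w - D w u v)`. -/
def koszul (D : V →L[ℝ] V →L[ℝ] V →L[ℝ] ℝ) : V →L[ℝ] V →L[ℝ] V →L[ℝ] ℝ :=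
  (1 / 2 : ℝ) • (D + D.flip -
    (ContinuousLinearMap.flipₗᵢ ℝ V V ℝ).toContinuousLinearEquiv.toContinuousLinearMap ∘L D.flip)

theorem koszul_apply (D : V →L[ℝ] V →L[ℝ] V →L[ℝ] ℝ) (u v w : V) :
    koszul D u v w = 1 / 2 * (D u v w + D v u w - D w u v) := by
  simp [koszul]

/-- The derivative of a pulled back bilinear form. -/
theorem hasFDerivWithinAt_pullback_apply {Ψ : V → W} {Ψ' : V → V →L[ℝ] W}
    {Ψ'' : V →L[ℝ] V →L[ℝ] W} {G : W → W →L[ℝ] W →L[ℝ] ℝ} {DG : W →L[ℝ] W →L[ℝ] W →L[ℝ] ℝ}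
    {A : Set V} {T : Set W} {z : V}
    (hΨ : HasFDerivWithinAt Ψ (Ψ' z) A z) (hΨ' : HasFDerivWithinAt Ψ' Ψ'' A z)
    (hG : HasFDerivWithinAt G DG T (Ψ z)) (hT : MapsTo Ψ A T) (v w : V) :
    ∃ L : V →L[ℝ] ℝ, HasFDerivWithinAt (fun y => pullback (G (Ψ y)) (Ψ' y) v w) L A z ∧
      ∀ u, L u = DG (Ψ' z u) (Ψ' z v) (Ψ' z w) + G (Ψ z) (Ψ'' u v) (Ψ' z w)
        + G (Ψ z) (Ψ' z v) (Ψ'' u w) := by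
  have h1 := hG.comp z hΨ hT
  have hv := hΨ'.clm_apply (hasFDerivWithinAt_const v z A)
  have hw := hΨ'.clm_apply (hasFDerivWithinAt_const w z A)
  refine ⟨_, (h1.clm_apply hv).clm_apply hw, fun u => ?_⟩
  simp
  ring

/-- Transformation law of the Koszul expression. -/
theorem koszul_pullback {Ψ : V → W} {Ψ' : V → V →L[ℝ] W}
    {Ψ'' : V →L[ℝ] V →L[ℝ] W} {G : W → W →L[ℝ] W →L[ℝ] ℝ} {DG : W →L[ℝ] W →L[ℝ] W →L[ℝ] ℝ}
    {A : Set V} {T : Set W} {z : V} {Gt : V → V →L[ℝ] V →L[ℝ] ℝ}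
    {DGt : V →L[ℝ] V →L[ℝ] V →L[ℝ] ℝ}
    (hΨ : HasFDerivWithinAt Ψ (Ψ' z) A z) (hΨ' : HasFDerivWithinAt Ψ' Ψ'' A z)
    (hG : HasFDerivWithinAt G DG T (Ψ z)) (hT : MapsTo Ψ A T)
    (hGt : HasFDerivWithinAt Gt DGt A z) (hA : UniqueDiffWithinAt ℝ A z) (hz : z ∈ A)
    (heq : ∀ y ∈ A, Gt y = pullback (G (Ψ y)) (Ψ' y))
    (hsymm : ∀ v w, G (Ψ z) v w = G (Ψ z) w v) (hΨs : ∀ u v, Ψ'' u v = Ψ'' v u) (u v w : V) :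
    koszul DGt u v w
      = koszul DG (Ψ' z u) (Ψ' z v) (Ψ' z w) + G (Ψ z) (Ψ'' u v) (Ψ' z w) := by
  have key : ∀ u v w, DGt u v w = DG (Ψ' z u) (Ψ' z v) (Ψ' z w) + G (Ψ z) (Ψ'' u v) (Ψ' z w)
      + G (Ψ z) (Ψ' z v) (Ψ'' u w) := fun u v w => by
    obtain ⟨L, hL, hLu⟩ := hasFDerivWithinAt_pullback_apply hΨ hΨ' hG hT v w
    have h2 : HasFDerivWithinAt (fun y => Gt y v w) _ A z :=
      (hGt.clm_apply (hasFDerivWithinAt_const v z A)).clm_apply (hasFDerivWithinAt_const w z A)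
    have h3 := hA.eq (hL.congr (fun y hy => by rw [heq y hy]) (by rw [heq z hz])) h2
    rw [← hLu, h3]
    simp
  -- Of the six terms with second derivatives of `Ψ`, symmetry of `Ψ''` and of `G` cancels four; the
  -- remaining two are equal and absorb the factor `1/2`.
  rw [koszul_apply, koszul_apply, key, key, key, hΨs v u, hΨs w u, hΨs w v,
    hsymm (Ψ' z v), hsymm (Ψ' z u)]
  ring

end Koszul

/-! ### Christoffel symbols and curvature in invariant form -/

section Curvature

variable {n : ℕ}

theorem pderiv_gram {G : E n → BL n} {DG : E n →L[ℝ] BL n} {s : Set (E n)} {y : E n}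
    (hG : HasFDerivWithinAt G DG s y) (hs : UniqueDiffWithinAt ℝ s y) (i j l : Fin n) :
    pderiv s i (fun z => gram (G z) j l) y = DG (bv i) (bv j) (bv l) := by
  have h2 : HasFDerivWithinAt (fun y => gram (G y) j l) _ s y :=
    (hG.clm_apply (hasFDerivWithinAt_const (bv j) y s)).clm_apply
      (hasFDerivWithinAt_const (bv l) y s)
  rw [pderiv, h2.fderivWithin hs]
  simp

theorem christoffel_gram {G : E n → BL n} {DG : E n →L[ℝ] BL n} {s : Set (E n)} {y : E n}
    (hG : HasFDerivWithinAt G DG s y) (hs : UniqueDiffWithinAt ℝ s y) (k i j : Fin n) :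
    christoffel s (fun z => gram (G z)) k i j y
      = ∑ l, (gram (G y))⁻¹ k l * koszul DG (bv i) (bv j) (bv l) := by
  simp only [christoffel, pderiv_gram hG hs, koszul_apply, Finset.mul_sum]
  exact Finset.sum_congr rfl fun l _ => by ring

/-- The Christoffel symbols as a bilinear map. -/
def christoffelMap (s : Set (E n)) (G : E n → BL n) (y : E n) : E n →L[ℝ] E n →L[ℝ] E n :=
  ∑ k, ∑ i, ∑ j, (EuclideanSpace.proj i : E n →L[ℝ] ℝ).smulRight
    ((EuclideanSpace.proj j : E n →L[ℝ] ℝ).smulRight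
      (christoffel s (fun z => gram (G z)) k i j y • bv k))

theorem christoffelMap_apply (s : Set (E n)) (G : E n → BL n) (y u v : E n) (k : Fin n) :
    christoffelMap s G y u v k
      = ∑ i, ∑ j, christoffel s (fun z => gram (G z)) k i j y * u i * v j := by
  simp only [christoffelMap, sum_apply, WithLp.ofLp_sum, Finset.sum_apply]
  rw [Finset.sum_eq_single k]
  · simp [mul_comm, mul_left_comm]
  · intro b _ hb
    simp [hb.symm]
  · simp

theorem christoffelMap_bv (s : Set (E n)) (G : E n → BL n) (y : E n) (i j k : Fin n) :
    christoffelMap s G y (bv i) (bv j) k = christoffel s (fun z => gram (G z)) k i j y := by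
  rw [christoffelMap_apply]
  simp

theorem trilinear_ext {F : Type*} [NormedAddCommGroup F] [NormedSpace ℝ F]
    {f g : E n →L[ℝ] E n →L[ℝ] E n →L[ℝ] F}
    (h : ∀ i j k, f (bv i) (bv j) (bv k) = g (bv i) (bv j) (bv k)) : f = g := by
  ext u v w
  rw [sum_smul_bv u, sum_smul_bv v, sum_smul_bv w]
  simp only [map_sum, map_smul, sum_apply, smul_apply, h]

/-- The Christoffel map is characterized by the Koszul formula. -/
theorem inner_christoffelMap {G : E n → BL n} {DG : E n →L[ℝ] BL n} {s : Set (E n)} {y : E n}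
    (hG : HasFDerivWithinAt G DG s y) (hs : UniqueDiffWithinAt ℝ s y)
    (hdet : IsUnit (gram (G y)).det) (hsymm : ∀ v w, G y v w = G y w v) (u v w : E n) :
    G y (christoffelMap s G y u v) w = koszul DG u v w := by
  have : (ContinuousLinearMap.compL ℝ (E n) (E n) (E n →L[ℝ] ℝ) (G y)) ∘L christoffelMap s G y
      = koszul DG := by
    refine trilinear_ext fun i j p => ?_
    simp only [ContinuousLinearMap.comp_apply, ContinuousLinearMap.compL_apply]
    rw [hsymm, sum_smul_bv (christoffelMap s G y (bv i) (bv j))]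
    simp only [map_sum, map_smul, smul_eq_mul, christoffelMap_bv, christoffel_gram hG hs,
      Finset.sum_mul]
    rw [Finset.sum_comm]
    have h1 : ∀ l, ∑ k, (gram (G y))⁻¹ k l * koszul DG (bv i) (bv j) (bv l) * G y (bv p) (bv k)
        = (1 : Matrix (Fin n) (Fin n) ℝ) p l * koszul DG (bv i) (bv j) (bv l) := fun l => by
      rw [← Matrix.mul_nonsing_inv _ hdet, Matrix.mul_apply, Finset.sum_mul]
      exact Finset.sum_congr rfl fun k _ => by rw [gram_apply]; ring
    simp [h1, Matrix.one_apply]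
  rw [← this]
  rfl

/-- The Riemann curvature `(w, u, v) ↦ R(w, u) v` of a connection with Christoffel map `Γ`, whose
derivative is `DΓ`. -/
def riem (Γ : E n →L[ℝ] E n →L[ℝ] E n) (DΓ : E n →L[ℝ] E n →L[ℝ] E n →L[ℝ] E n) :
    E n →L[ℝ] E n →L[ℝ] E n →L[ℝ] E n :=
  DΓ - DΓ.flip + (ContinuousLinearMap.compL ℝ (E n) (E n) (E n)).bilinearComp Γ Γ
    - ((ContinuousLinearMap.compL ℝ (E n) (E n) (E n)).bilinearComp Γ Γ).flip

theorem riem_apply (Γ : E n →L[ℝ] E n →L[ℝ] E n) (DΓ : E n →L[ℝ] E n →L[ℝ] E n →L[ℝ] E n)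
    (w u v : E n) :
    riem Γ DΓ w u v = DΓ w u v - DΓ u w v + Γ w (Γ u v) - Γ u (Γ w v) := by
  simp [riem]

/-- The Ricci form, `u, v ↦ tr (w ↦ R(w, u) v)`. -/
def ric (Γ : E n →L[ℝ] E n →L[ℝ] E n) (DΓ : E n →L[ℝ] E n →L[ℝ] E n →L[ℝ] E n) : BL n :=
  ∑ i, (ContinuousLinearMap.compL ℝ (E n) (E n) ℝ (EuclideanSpace.proj i)) ∘L
    (riem Γ DΓ (bv i))

theorem ric_apply (Γ : E n →L[ℝ] E n →L[ℝ] E n) (DΓ : E n →L[ℝ] E n →L[ℝ] E n →L[ℝ] E n)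
    (u v : E n) : ric Γ DΓ u v = ∑ i, riem Γ DΓ (bv i) u v i := by
  simp [ric]

theorem trace_eq_sum (L : E n →ₗ[ℝ] E n) : LinearMap.trace ℝ (E n) L = ∑ i, L (bv i) i := by
  rw [LinearMap.trace_eq_matrix_trace ℝ (EuclideanSpace.basisFun (Fin n) ℝ).toBasis,
    Matrix.trace]
  simp [LinearMap.toMatrix_apply]

/-- If a linear isomorphism intertwines two curvature tensors, it intertwines the Ricci forms. -/
theorem ric_eq_pullback {Γ Γt : E n →L[ℝ] E n →L[ℝ] E n}
    {DΓ DΓt : E n →L[ℝ] E n →L[ℝ] E n →L[ℝ] E n} (L : E n ≃L[ℝ] E n)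
    (h : ∀ w u v, L (riem Γt DΓt w u v) = riem Γ DΓ (L w) (L u) (L v)) :
    ric Γt DΓt = pullback (ric Γ DΓ) (L : E n →L[ℝ] E n) := by
  ext u v
  rw [pullback_apply, ric_apply, ric_apply]
  set R : E n →ₗ[ℝ] E n := (((riem Γ DΓ).flip (L u)).flip (L v)).toLinearMap with hR
  set Rt : E n →ₗ[ℝ] E n := (((riem Γt DΓt).flip u).flip v).toLinearMap with hRt
  -- For fixed `u` and `v` the two curvature endomorphisms are conjugate by `L`, so they have the
  -- same trace, and the Ricci form is that trace.
  have h1 : R = L.toLinearEquiv.conj Rt := by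
    ext1 w
    simp only [LinearEquiv.conj_apply, LinearMap.comp_apply, hR, hRt]
    simp [h]
  have h2 := trace_eq_sum R
  have h3 := trace_eq_sum Rt
  rw [h1, LinearMap.trace_conj', h3] at h2
  simpa [hR, hRt, h] using h2

/-- Transformation law of the curvature tensor under a change of coordinates. -/
theorem riem_transform {Ψ : E n → E n} {Ψ' : E n → E n →L[ℝ] E n}
    {Ψ'' : E n → E n →L[ℝ] E n →L[ℝ] E n} {Ψ''' : E n →L[ℝ] E n →L[ℝ] E n →L[ℝ] E n}
    {Γ Γt : E n → E n →L[ℝ] E n →L[ℝ] E n} {DΓ DΓt : E n →L[ℝ] E n →L[ℝ] E n →L[ℝ] E n} {z : E n}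
    (hΨ : HasFDerivAt Ψ (Ψ' z) z) (hΨ' : HasFDerivAt Ψ' (Ψ'' z) z)
    (hΨ'' : HasFDerivAt Ψ'' Ψ''' z) (hΓ : HasFDerivAt Γ DΓ (Ψ z)) (hΓt : HasFDerivAt Γt DΓt z)
    (hs : ∀ u v, Ψ'' z u v = Ψ'' z v u) (hs' : ∀ u v, Ψ''' u v = Ψ''' v u)
    (hlaw : ∀ᶠ y in 𝓝 z, ∀ u v,
      Ψ' y (Γt y u v) = Γ (Ψ y) (Ψ' y u) (Ψ' y v) + Ψ'' y u v) (w u v : E n) :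
    Ψ' z (riem (Γt z) DΓt w u v) = riem (Γ (Ψ z)) DΓ (Ψ' z w) (Ψ' z u) (Ψ' z v) := by
  -- The transformation law of the Christoffel maps, differentiated at `z` in the direction `w`.
  have key : ∀ w u v, Ψ'' z w (Γt z u v) + Ψ' z (DΓt w u v)
      = DΓ (Ψ' z w) (Ψ' z u) (Ψ' z v) + Γ (Ψ z) (Ψ'' z w u) (Ψ' z v)
        + Γ (Ψ z) (Ψ' z u) (Ψ'' z w v) + Ψ''' w u v := fun w u v => by
    have hu := hasFDerivAt_const (𝕜 := ℝ) u z
    have hv := hasFDerivAt_const (𝕜 := ℝ) v z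
    have h1 := hΨ'.clm_apply ((hΓt.clm_apply hu).clm_apply hv)
    have h2 := (((hΓ.comp z hΨ).clm_apply (hΨ'.clm_apply hu)).clm_apply (hΨ'.clm_apply hv)).add
      ((hΨ''.clm_apply hu).clm_apply hv)
    have h3 := h1.unique (h2.congr_of_eventuallyEq (hlaw.mono fun y hy => hy u v))
    have h4 := congrArg (fun L : E n →L[ℝ] E n => L w) h3
    simp only [add_apply, ContinuousLinearMap.comp_apply,
      ContinuousLinearMap.flip_apply, map_zero, zero_add,
      zero_apply] at h4
    rw [add_comm, h4]
    simp
    abel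
  have law := hlaw.self_of_nhds
  have e1 := key w u v
  have e2 := key u w v
  rw [riem_apply, riem_apply]
  simp only [map_add, map_sub, law]
  -- Antisymmetrizing in `w` and `u` removes `Ψ'''`; the terms with `Ψ''` cancel against those
  -- produced by applying `law` inside the quadratic part.
  rw [eq_sub_iff_add_eq'.2 e1, eq_sub_iff_add_eq'.2 e2, hs u w, hs' u w]
  abel

end Curvature

/-- A family of continuous linear maps is `C^k` at a point if all its applications are. -/
theorem contDiffWithinAt_clm_of_apply {V W F : Type*} [NormedAddCommGroup V] [NormedSpace ℝ V]
    [NormedAddCommGroup W] [NormedSpace ℝ W] [NormedAddCommGroup F] [NormedSpace ℝ F]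
    [FiniteDimensional ℝ W] {k : ℕ∞ω} {f : V → W →L[ℝ] F} {s : Set V} {x : V}
    (h : ∀ y, ContDiffWithinAt ℝ k (fun x => f x y) s x) : ContDiffWithinAt ℝ k f s x := by
  have hd : Module.finrank ℝ W = Module.finrank ℝ (Fin (Module.finrank ℝ W) → ℝ) :=
    (Module.finrank_fin_fun ℝ).symm
  let e₁ := ContinuousLinearEquiv.ofFinrankEq hd
  let e₂ := (e₁.arrowCongr (1 : F ≃L[ℝ] F)).trans
    (ContinuousLinearEquiv.piRing (Fin (Module.finrank ℝ W)))
  rw [← Function.id_comp f, ← e₂.symm_comp_self]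
  exact e₂.symm.contDiff.contDiffAt.comp_contDiffWithinAt x (contDiffWithinAt_pi.2 fun i => h _)

theorem contDiffWithinAt_bilin_of_apply {V : Type*} [NormedAddCommGroup V] [NormedSpace ℝ V]
    {n : ℕ} {k : ℕ∞ω} {f : V → BL n} {s : Set V} {x : V}
    (h : ∀ v w, ContDiffWithinAt ℝ k (fun x => f x v w) s x) : ContDiffWithinAt ℝ k f s x :=
  contDiffWithinAt_clm_of_apply fun v => contDiffWithinAt_clm_of_apply fun w => h v w

/-! ### Invariance of the scalar curvature under changes of coordinates -/

section Invariance

variable {n : ℕ}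

section
attribute [local instance] Matrix.linftyOpNormedRing Matrix.linftyOpNormedAlgebra

/-- The derivative of the entries of the inverse Gram matrix. -/
theorem hasFDerivAt_gram_inv {G : E n → BL n} {DG : E n →L[ℝ] BL n} {y : E n}
    (hG : HasFDerivAt G DG y) (hdet : IsUnit (gram (G y)).det) (k l : Fin n) :
    ∃ L : E n →L[ℝ] ℝ, HasFDerivAt (fun z => (gram (G z))⁻¹ k l) L y ∧
      ∀ u, L u = - ((gram (G y))⁻¹ * gram (DG u) * (gram (G y))⁻¹) k l := by
  let gl : BL n →ₗ[ℝ] Matrix (Fin n) (Fin n) ℝ :=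
    { toFun := gram, map_add' := fun _ _ => rfl, map_smul' := fun _ _ => rfl }
  let el : Matrix (Fin n) (Fin n) ℝ →ₗ[ℝ] ℝ :=
    { toFun := fun A => A k l, map_add' := fun _ _ => rfl, map_smul' := fun _ _ => rfl }
  have h1 : HasFDerivAt (fun z => gram (G z)) (gl.toContinuousLinearMap ∘L DG) y :=
    gl.toContinuousLinearMap.hasFDerivAt.comp y hG
  obtain ⟨a, ha⟩ : IsUnit (gram (G y)) := (Matrix.isUnit_iff_isUnit_det _).2 hdet
  -- The derivative of inversion at `a` is `X ↦ -a⁻¹ X a⁻¹`. The norm on matrices serves only to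
  -- state this; `gl` and `el` are continuous by finite dimension.
  have h2 := hasFDerivAt_ringInverse (𝕜 := ℝ) a
  rw [ha] at h2
  have h3 := (el.toContinuousLinearMap.hasFDerivAt).comp y (h2.comp y h1)
  have hinv : ((a⁻¹ : (Matrix (Fin n) (Fin n) ℝ)ˣ) : Matrix (Fin n) (Fin n) ℝ)
      = (gram (G y))⁻¹ := by
    rw [Matrix.coe_units_inv, ha]
  refine ⟨_, h3.congr_of_eventuallyEq (Eventually.of_forall fun z => ?_), fun u => ?_⟩
  · show (gram (G z))⁻¹ k l = (Ring.inverse (gram (G z))) k l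
    rw [Matrix.nonsing_inv_eq_ringInverse]
  · rw [hinv]
    rfl
end

theorem hasFDerivAt_koszul {D : E n → E n →L[ℝ] BL n} {D' : E n →L[ℝ] E n →L[ℝ] BL n} {y : E n}
    (hD : HasFDerivAt D D' y) (a b c : E n) :
    ∃ L : E n →L[ℝ] ℝ, HasFDerivAt (fun z => koszul (D z) a b c) L y ∧
      ∀ u, L u = koszul (D' u) a b c := by
  have h3 : ∀ a b c : E n, ∃ L : E n →L[ℝ] ℝ, HasFDerivAt (fun z => D z a b c) L y ∧
      ∀ u, L u = D' u a b c := fun a b c =>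
    ⟨_, ((hD.clm_apply (hasFDerivAt_const a y)).clm_apply (hasFDerivAt_const b y)).clm_apply
      (hasFDerivAt_const c y), fun u => by simp⟩
  obtain ⟨L1, h1, h1'⟩ := h3 a b c
  obtain ⟨L2, h2, h2'⟩ := h3 b a c
  obtain ⟨L3, h3, h3'⟩ := h3 c a b
  simp only [koszul_apply]
  exact ⟨_, ((h1.add h2).sub h3).const_mul (1 / 2), fun u => by simp [h1', h2', h3']⟩

/-- For `k ≠ ∞` being C^k at a point is an open condition. For `k = ∞` the neighbourhood may shrink
with the order. -/
theorem eventually_hasFDerivAt {V F : Type*} [NormedAddCommGroup V] [NormedSpace ℝ V]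
    [NormedAddCommGroup F] [NormedSpace ℝ F] {f : V → F} {y : V} {k : ℕ∞ω}
    (hf : ContDiffAt ℝ k f y) (hk : 1 ≤ k) (hk' : k ≠ ∞) :
    ∀ᶠ z in 𝓝 y, HasFDerivAt f (fderiv ℝ f z) z :=
  (hf.eventually hk').mono fun _ hz => (hz.differentiableAt (by
    rintro rfl; simp at hk)).hasFDerivAt

theorem hasFDerivAt_fderiv {V F : Type*} [NormedAddCommGroup V] [NormedSpace ℝ V]
    [NormedAddCommGroup F] [NormedSpace ℝ F] {f : V → F} {y : V}
    (hf : ContDiffAt ℝ 2 f y) : HasFDerivAt (fderiv ℝ f) (fderiv ℝ (fderiv ℝ f) y) y :=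
  ((hf.fderiv_right (m := 1) (by norm_num)).differentiableAt (by norm_num)).hasFDerivAt

/-- The derivative of the Christoffel symbols. -/
theorem hasFDerivAt_christoffel {G : E n → BL n} {y : E n} (hG : ContDiffAt ℝ 2 G y)
    (hdet : IsUnit (gram (G y)).det) (k i j : Fin n) :
    ∃ L : E n →L[ℝ] ℝ, HasFDerivAt (christoffel univ (fun z => gram (G z)) k i j) L y ∧
      ∀ u, L u = ∑ l, (- ((gram (G y))⁻¹ * gram (fderiv ℝ G y u) * (gram (G y))⁻¹) k l
          * koszul (fderiv ℝ G y) (bv i) (bv j) (bv l)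
        + (gram (G y))⁻¹ k l * koszul (fderiv ℝ (fderiv ℝ G) y u) (bv i) (bv j) (bv l)) := by
  have hev := eventually_hasFDerivAt hG (by norm_num) (by simp)
  have heq : ∀ᶠ z in 𝓝 y, christoffel univ (fun z => gram (G z)) k i j z
      = ∑ l, (gram (G z))⁻¹ k l * koszul (fderiv ℝ G z) (bv i) (bv j) (bv l) :=
    hev.mono fun z hz => christoffel_gram hz.hasFDerivWithinAt uniqueDiffWithinAt_univ k i j
  choose L hL hL' using fun l => hasFDerivAt_gram_inv hev.self_of_nhds hdet k l
  choose K hK hK' using fun l => hasFDerivAt_koszul (hasFDerivAt_fderiv hG) (bv i) (bv j) (bv l)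
  have := HasFDerivAt.fun_sum (u := Finset.univ) fun l _ => (hL l).mul (hK l)
  refine ⟨_, this.congr_of_eventuallyEq heq, fun u => ?_⟩
  simp only [sum_apply, add_apply, smul_apply, hL', hK', smul_eq_mul]
  exact Finset.sum_congr rfl fun l _ => by ring

theorem hasFDerivAt_christoffelMap {G : E n → BL n} {y : E n} (hG : ContDiffAt ℝ 2 G y)
    (hdet : IsUnit (gram (G y)).det) :
    HasFDerivAt (christoffelMap univ G) (fderiv ℝ (christoffelMap univ G) y) y := by
  refine DifferentiableAt.hasFDerivAt ?_
  unfold christoffelMap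
  refine DifferentiableAt.fun_sum fun k _ => DifferentiableAt.fun_sum fun i _ =>
    DifferentiableAt.fun_sum fun j _ => ?_
  obtain ⟨L, hL, -⟩ := hasFDerivAt_christoffel hG hdet k i j
  have h1 := hL.differentiableAt.smul_const (bv k)
  have h2 := (((ContinuousLinearMap.smulRightL ℝ (E n) (E n)
    (EuclideanSpace.proj j : E n →L[ℝ] ℝ)).differentiableAt (x := _)).comp y h1)
  exact (((ContinuousLinearMap.smulRightL ℝ (E n) (E n →L[ℝ] E n)
    (EuclideanSpace.proj i : E n →L[ℝ] ℝ)).differentiableAt (x := _)).comp y h2)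

/-- The coordinate formula is the trace of `riem` over its first argument, written on basis vectors;
this form exhibits Ricci as a tensor. -/
theorem ricci_eq_ric {G : E n → BL n} {y : E n} (hG : ContDiffAt ℝ 2 G y)
    (hdet : IsUnit (gram (G y)).det) :
    (fun j k => ricci (fun z => gram (G z)) j k y)
      = gram (ric (christoffelMap univ G y) (fderiv ℝ (christoffelMap univ G) y)) := by
  have hd := hasFDerivAt_christoffelMap hG hdet
  have hp : ∀ a i j k, pderiv univ a (christoffel univ (fun z => gram (G z)) i j k) y
      = fderiv ℝ (christoffelMap univ G) y (bv a) (bv j) (bv k) i := fun a i j k => by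
    have h1 : HasFDerivAt (fun z => (EuclideanSpace.proj i : E n →L[ℝ] ℝ)
        (christoffelMap univ G z (bv j) (bv k))) _ y :=
      (EuclideanSpace.proj i : E n →L[ℝ] ℝ).hasFDerivAt.comp y
        ((hd.clm_apply (hasFDerivAt_const (bv j) y)).clm_apply (hasFDerivAt_const (bv k) y))
    have h2 : (fun z => (EuclideanSpace.proj i : E n →L[ℝ] ℝ)
        (christoffelMap univ G z (bv j) (bv k)))
          = christoffel univ (fun z => gram (G z)) i j k := by
      funext z
      exact christoffelMap_bv univ G z j k i
    rw [h2] at h1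
    rw [pderiv, fderivWithin_univ, h1.fderiv]
    simp
  ext j k
  rw [gram_apply, ric_apply, ricci, ← Finset.sum_add_distrib]
  refine Finset.sum_congr rfl fun i _ => ?_
  rw [riem_apply]
  simp only [PiLp.sub_apply, PiLp.add_apply, hp]
  rw [christoffelMap_apply _ _ _ (bv i), christoffelMap_apply _ _ _ (bv j)]
  simp only [christoffelMap_bv]
  simp [Finset.sum_sub_distrib]
  ring

theorem scalarLocal_eq_contr {G : E n → BL n} {y : E n} (hG : ContDiffAt ℝ 2 G y)
    (hdet : IsUnit (gram (G y)).det) :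
    scalarLocal (fun z => gram (G z)) y = contr (gram (G y))
      (gram (ric (christoffelMap univ G y) (fderiv ℝ (christoffelMap univ G) y))) := by
  rw [← ricci_eq_ric hG hdet]
  rfl

/-- Invariance of the scalar curvature under a `C³` change of coordinates. -/
theorem scalarLocal_pullback {G Gt : E n → BL n} {Ψ : E n → E n} {z : E n} (L : E n ≃L[ℝ] E n)
    (hΨ : ContDiffAt ℝ 3 Ψ z) (hL : fderiv ℝ Ψ z = L) (hG : ContDiffAt ℝ 2 G (Ψ z))
    (hsymm : ∀ᶠ y in 𝓝 (Ψ z), ∀ v w, G y v w = G y w v)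
    (hpos : ∀ᶠ y in 𝓝 (Ψ z), ∀ v, v ≠ 0 → 0 < G y v v)
    (hGt : ∀ᶠ y in 𝓝 z, Gt y = pullback (G (Ψ y)) (fderiv ℝ Ψ y)) :
    scalarLocal (fun y => gram (Gt y)) z = scalarLocal (fun y => gram (G y)) (Ψ z) := by
  have hc : Tendsto Ψ (𝓝 z) (𝓝 (Ψ z)) := hΨ.continuousAt
  have hΨ1 : ContDiffAt ℝ 2 (fderiv ℝ Ψ) z := hΨ.fderiv_right (by norm_num)
  -- The pull-back involves the first derivative of `Ψ`, so C³ regularity of `Ψ` is what keeps the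
  -- metric C².
  have hGtC : ContDiffAt ℝ 2 Gt z := by
    have h1 : ContDiffAt ℝ 2 (fun y => G (Ψ y)) z :=
      hG.comp z (hΨ.of_le (by norm_num))
    refine ContDiffAt.congr_of_eventuallyEq ?_ hGt
    refine contDiffWithinAt_univ.1 (contDiffWithinAt_bilin_of_apply fun v w => ?_)
    rw [contDiffWithinAt_univ]
    exact (h1.clm_apply (hΨ1.clm_apply contDiffAt_const)).clm_apply
      (hΨ1.clm_apply contDiffAt_const)
  -- Invertible operators form an open set, so `Ψ` has invertible differential near `z` and not only
  -- at `z`.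
  have hinv : ∀ᶠ y in 𝓝 z, ∃ L' : E n ≃L[ℝ] E n, (L' : E n →L[ℝ] E n) = fderiv ℝ Ψ y := by
    have h1 := ContinuousLinearEquiv.nhds L
    rw [← hL] at h1
    exact hΨ1.continuousAt.eventually h1
  have hGtpos : ∀ᶠ y in 𝓝 z, ∀ v, v ≠ 0 → 0 < Gt y v v := by
    filter_upwards [hGt, hc.eventually hpos, hinv] with y h1 h2 ⟨L', hL'⟩ v hv
    rw [h1, pullback_apply, ← hL']
    exact h2 _ (by simpa using hv)
  have hGtsymm : ∀ᶠ y in 𝓝 z, ∀ v w, Gt y v w = Gt y w v := by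
    filter_upwards [hGt, hc.eventually hsymm] with y h1 h2 v w
    rw [h1, pullback_apply, pullback_apply, h2]
  have hdet := isUnit_gram hpos.self_of_nhds
  have hdett := isUnit_gram hGtpos.self_of_nhds
  have hlaw : ∀ᶠ y in 𝓝 z, ∀ u v, fderiv ℝ Ψ y (christoffelMap univ Gt y u v)
      = christoffelMap univ G (Ψ y) (fderiv ℝ Ψ y u) (fderiv ℝ Ψ y v)
        + fderiv ℝ (fderiv ℝ Ψ) y u v := by
    filter_upwards [hinv, hGtpos, hGtsymm, hc.eventually hpos, hc.eventually hsymm,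
      hΨ.eventually (by simp), hGtC.eventually (by simp),
      hc.eventually (hG.eventually (by simp)), hGt.eventually_nhds] with y ⟨L', hL'⟩ h1 h2 h3 h4
        h5 h6 h7 h8 u v
    have hΨy : HasFDerivAt Ψ (fderiv ℝ Ψ y) y := (h5.differentiableAt (by norm_num)).hasFDerivAt
    have hΨy' := hasFDerivAt_fderiv (h5.of_le (m := 2) (by norm_num))
    have hGy : HasFDerivAt G _ (Ψ y) := (h7.differentiableAt (by norm_num)).hasFDerivAt
    have hGty : HasFDerivAt Gt _ y := (h6.differentiableAt (by norm_num)).hasFDerivAt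
    have hs : ∀ u v, fderiv ℝ (fderiv ℝ Ψ) y u v = fderiv ℝ (fderiv ℝ Ψ) y v u := fun u v =>
      (h5.isSymmSndFDerivAt (by simp; norm_num)) u v
    have hk : ∀ w, koszul (fderiv ℝ Gt y) u v w = koszul (fderiv ℝ G (Ψ y)) (fderiv ℝ Ψ y u)
        (fderiv ℝ Ψ y v) (fderiv ℝ Ψ y w)
        + G (Ψ y) (fderiv ℝ (fderiv ℝ Ψ) y u v) (fderiv ℝ Ψ y w) := by
      obtain ⟨O, hO, hOo, hyO⟩ := eventually_nhds_iff.1 h8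
      exact fun w => koszul_pullback (A := O) (T := univ) hΨy.hasFDerivWithinAt
        hΨy'.hasFDerivWithinAt hGy.hasFDerivWithinAt (mapsTo_univ _ _) hGty.hasFDerivWithinAt
        (hOo.uniqueDiffWithinAt hyO) hyO hO h4 hs u v w
    have hGu := isUnit_gram h3
    have hGtu := isUnit_gram h1
    rw [← sub_eq_zero]
    -- If the two sides of the law differ by `X ≠ 0`, then `G X X > 0`. Since `X` lies in the image
    -- of the differential of `Ψ`, both Koszul formulas can be tested against it, and they give `G X
    -- X = 0`.
    by_contra hne
    refine (h3 _ hne).ne' ?_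
    set X := fderiv ℝ Ψ y (christoffelMap univ Gt y u v)
      - (christoffelMap univ G (Ψ y) (fderiv ℝ Ψ y u) (fderiv ℝ Ψ y v)
        + fderiv ℝ (fderiv ℝ Ψ) y u v) with hX
    have hXw : X = fderiv ℝ Ψ y (L'.symm X) := by rw [← hL']; simp
    have e1 : G (Ψ y) (fderiv ℝ Ψ y (christoffelMap univ Gt y u v)) X
        = koszul (fderiv ℝ Gt y) u v (L'.symm X) := by
      rw [← inner_christoffelMap hGty.hasFDerivWithinAt uniqueDiffWithinAt_univ hGtu h2]
      conv_lhs => rw [hXw]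
      rw [h8.self_of_nhds, pullback_apply]
    have e2 : G (Ψ y) (christoffelMap univ G (Ψ y) (fderiv ℝ Ψ y u) (fderiv ℝ Ψ y v)) X
        = koszul (fderiv ℝ G (Ψ y)) (fderiv ℝ Ψ y u) (fderiv ℝ Ψ y v) X :=
      inner_christoffelMap hGy.hasFDerivWithinAt uniqueDiffWithinAt_univ hGu h4 _ _ _
    have e3 := hk (L'.symm X)
    rw [← hXw] at e3
    have : G (Ψ y) X = G (Ψ y) (fderiv ℝ Ψ y (christoffelMap univ Gt y u v))
      - (G (Ψ y) (christoffelMap univ G (Ψ y) (fderiv ℝ Ψ y u) (fderiv ℝ Ψ y v))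
        + G (Ψ y) (fderiv ℝ (fderiv ℝ Ψ) y u v)) := by
      rw [hX, map_sub, map_add]
    rw [this]
    simp only [sub_apply, add_apply, e1, e2, e3]
    ring
  rw [scalarLocal_eq_contr hGtC hdett, scalarLocal_eq_contr hG hdet]
  have hR := riem_transform (Ψ' := fderiv ℝ Ψ) (Ψ'' := fderiv ℝ (fderiv ℝ Ψ))
    (hΨ.differentiableAt (by norm_num)).hasFDerivAt
    (hasFDerivAt_fderiv (hΨ.of_le (by norm_num))) (hasFDerivAt_fderiv hΨ1)
    (hasFDerivAt_christoffelMap hG hdet) (hasFDerivAt_christoffelMap hGtC hdett)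
    (fun u v => (hΨ.isSymmSndFDerivAt (by simp; norm_num)) u v)
    (fun u v => (hΨ1.isSymmSndFDerivAt (by simp)) u v) hlaw
  rw [hL] at hR
  rw [ric_eq_pullback L hR, hGt.self_of_nhds, hL, contr_gram_pullback]

end Invariance

/-! ### Scalar curvature when only the second normal derivatives are large -/

section Estimate

theorem abs_sum_fin_le {N : ℕ} {f : Fin N → ℝ} {b : ℝ} (h : ∀ i, |f i| ≤ b) :
    |∑ i, f i| ≤ N * b := by
  refine (Finset.abs_sum_le_sum_abs _ _).trans ((Finset.sum_le_sum fun i _ => h i).trans ?_)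
  simp

theorem abs_mul_le' {a b A B : ℝ} (ha : |a| ≤ A) (hb : |b| ≤ B) : |a * b| ≤ A * B := by
  rw [abs_mul]
  exact mul_le_mul ha hb (abs_nonneg _) ((abs_nonneg _).trans ha)

variable {m : ℕ}

/-- The contribution of the second normal derivatives `J` to the principal part of the scalar
curvature. -/
theorem sum_normal_second_derivatives (g J : Matrix (Fin (m + 1)) (Fin (m + 1)) ℝ)
    (h0 : ∀ a, g 0 a = if a = 0 then 1 else 0) (h0' : ∀ a, g a 0 = if a = 0 then 1 else 0)
    (hJ : ∀ a, J 0 a = 0)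
    (q : Fin (m + 1) → Fin (m + 1) → Fin (m + 1) → Fin (m + 1) → ℝ)
    (hq : ∀ a b c d, q a b c d = if a = 0 ∧ b = 0 then J c d else 0) :
    ∑ j, ∑ k, g j k * ∑ i, ∑ l, (g i l * (1 / 2 * (q i j k l + q i k j l - q i l j k))
      - g i l * (1 / 2 * (q j i k l + q j k i l - q j l i k))) = - ∑ j, ∑ k, g j k * J j k := by
  -- The terms `q i j k l` and `q j i k l` cancel by symmetry. Two mixed terms vanish because `g`
  -- has no normal-tangential entries and `J` no normal ones. Each of the two remaining terms
  -- contributes `-½ tr J`.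
  have e1 : ∀ j k i l, g j k * (g i l * (1 / 2 * (q i j k l + q i k j l - q i l j k))
      - g i l * (1 / 2 * (q j i k l + q j k i l - q j l i k)))
      = - (1 / 2) * (g j k * (g i l * q i l j k)) - 1 / 2 * (g j k * (g i l * q j k i l)) := by
    intro j k i l
    have t0 : q i j k l = q j i k l := by rw [hq, hq]; exact if_congr and_comm rfl rfl
    have t1 : g j k * g i l * q i k j l = 0 := by
      rw [hq]
      split_ifs with h
      · obtain ⟨rfl, rfl⟩ := h
        rw [h0']
        split_ifs with h
        · rw [h, hJ, mul_zero]
        · simp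
      · simp
    have t2 : g j k * g i l * q j l i k = 0 := by
      rw [hq]
      split_ifs with h
      · obtain ⟨rfl, rfl⟩ := h
        rw [h0' i]
        split_ifs with h
        · rw [h, hJ, mul_zero]
        · simp
      · simp
    linear_combination (1 / 2 * g j k * g i l) * t0 + 1 / 2 * t1 + 1 / 2 * t2
  simp only [Finset.mul_sum, e1]
  have g00 : g 0 0 = 1 := by simp [h0]
  have e2 : ∀ j k, ∑ i, ∑ l, g i l * q i l j k = J j k := by
    intro j k
    rw [Finset.sum_eq_single 0, Finset.sum_eq_single 0] <;> simp +contextual [hq, g00]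
  have e3 : ∑ j, ∑ k, ∑ i, ∑ l, g j k * (g i l * q j k i l) = ∑ i, ∑ l, g i l * J i l := by
    rw [Finset.sum_eq_single 0, Finset.sum_eq_single 0] <;> simp +contextual [hq, g00]
  have e4 : ∑ j, ∑ k, ∑ i, ∑ l, g j k * (g i l * q i l j k) = ∑ i, ∑ l, g i l * J i l := by
    refine Finset.sum_congr rfl fun j _ => Finset.sum_congr rfl fun k _ => ?_
    rw [← e2 j k]
    simp only [Finset.mul_sum]
  simp only [Finset.sum_sub_distrib, ← Finset.mul_sum] at e3 e4 ⊢
  rw [e3, e4]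
  ring

/-- The scalar curvature equals `- ∑ Gⁱʲ Jᵢⱼ` up to a bounded error, if `J` is the unbounded part of
the second normal derivatives of the metric. -/
theorem exists_abs_scalarLocal_add_contr_le (m : ℕ) (K : ℝ) :
    ∃ B : ℝ, ∀ (G : E (m + 1) → BL (m + 1)) (y : E (m + 1))
      (J : Matrix (Fin (m + 1)) (Fin (m + 1)) ℝ), ContDiffAt ℝ 2 G y → IsUnit (gram (G y)).det →
      (∀ i j, |(gram (G y))⁻¹ i j| ≤ K) →
      (∀ a c d, |fderiv ℝ G y (bv a) (bv c) (bv d)| ≤ K) →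
      (∀ a b c d, |fderiv ℝ (fderiv ℝ G) y (bv a) (bv b) (bv c) (bv d)
        - (if a = 0 ∧ b = 0 then J c d else 0)| ≤ K) →
      (∀ a, (gram (G y))⁻¹ 0 a = if a = 0 then 1 else 0) →
      (∀ a, (gram (G y))⁻¹ a 0 = if a = 0 then 1 else 0) →
      (∀ a, J 0 a = 0) →
      |scalarLocal (fun z => gram (G z)) y + contr (gram (G y)) J| ≤ B := by
  set N : ℝ := ((m + 1 : ℕ) : ℝ) with hN
  -- Successive bounds: `c1` for Koszul expressions, `c2` for Christoffel symbols, `c3` for the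
  -- derivative of the inverse metric, `c4` for each summand of the derivative of a Christoffel
  -- symbol with `J` removed, `c5` for the Ricci tensor with `J` removed.
  set c1 : ℝ := 1 / 2 * (K + K + K) with hc1
  set c2 : ℝ := N * (K * c1) with hc2
  set c3 : ℝ := N * (N * (K * K) * K) with hc3
  set c4 : ℝ := c3 * c1 + K * c1 with hc4
  set c5 : ℝ := N * (N * (c4 + c4)) + N * (N * (c2 * c2 + c2 * c2)) with hc5
  refine ⟨N * (N * (K * c5)), fun G y J hG hdet hg hD hD2 h0 h0' hJ => ?_⟩
  set g := (gram (G y))⁻¹ with hgdef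
  set q : Fin (m + 1) → Fin (m + 1) → Fin (m + 1) → Fin (m + 1) → ℝ :=
    fun a b c d => if a = 0 ∧ b = 0 then J c d else 0 with hq
  have hGd := (hG.differentiableAt (by norm_num)).hasFDerivAt
  have b1 : ∀ i j l, |koszul (fderiv ℝ G y) (bv i) (bv j) (bv l)| ≤ c1 := by
    intro i j l
    rw [koszul_apply, abs_mul, hc1, abs_of_nonneg (by norm_num : (0 : ℝ) ≤ 1 / 2)]
    have h1 := abs_le.1 (hD i j l)
    have h2 := abs_le.1 (hD j i l)
    have h3 := abs_le.1 (hD l i j)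
    exact mul_le_mul_of_nonneg_left (abs_le.2 ⟨by linarith, by linarith⟩) (by norm_num)
  have b1' : ∀ a i j l, |koszul (fderiv ℝ (fderiv ℝ G) y (bv a)) (bv i) (bv j) (bv l)
      - 1 / 2 * (q a i j l + q a j i l - q a l i j)| ≤ c1 := by
    intro a i j l
    rw [koszul_apply, ← mul_sub, abs_mul, hc1, abs_of_nonneg (by norm_num : (0 : ℝ) ≤ 1 / 2)]
    have h1 := abs_le.1 (hD2 a i j l)
    have h2 := abs_le.1 (hD2 a j i l)
    have h3 := abs_le.1 (hD2 a l i j)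
    exact mul_le_mul_of_nonneg_left (abs_le.2 ⟨by simp only [hq]; linarith, by
      simp only [hq]; linarith⟩) (by norm_num)
  have b2 : ∀ k i j, |christoffel univ (fun z => gram (G z)) k i j y| ≤ c2 := by
    intro k i j
    rw [christoffel_gram hGd.hasFDerivWithinAt uniqueDiffWithinAt_univ]
    exact abs_sum_fin_le fun l => abs_mul_le' (hg k l) (b1 i j l)
  have b3 : ∀ a k l, |(g * gram (fderiv ℝ G y (bv a)) * g) k l| ≤ c3 := by
    intro a k l
    rw [Matrix.mul_apply]
    refine abs_sum_fin_le fun i => abs_mul_le' ?_ (hg i l)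
    rw [Matrix.mul_apply]
    exact abs_sum_fin_le fun j => abs_mul_le' (hg k j) (hD a j i)
  -- The bounded part of the derivatives of the Christoffel symbols; what is left over is linear in
  -- `q`, hence in `J`.
  set r : Fin (m + 1) → Fin (m + 1) → Fin (m + 1) → Fin (m + 1) → Fin (m + 1) → ℝ :=
    fun a k i j l => - (g * gram (fderiv ℝ G y (bv a)) * g) k l
          * koszul (fderiv ℝ G y) (bv i) (bv j) (bv l)
        + g k l * (koszul (fderiv ℝ (fderiv ℝ G) y (bv a)) (bv i) (bv j) (bv l)
          - 1 / 2 * (q a i j l + q a j i l - q a l i j)) with hr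
  have b4 : ∀ a k i j l, |r a k i j l| ≤ c4 := by
    intro a k i j l
    refine (abs_add_le _ _).trans (add_le_add (abs_mul_le' ?_ (b1 i j l))
      (abs_mul_le' (hg k l) (b1' a i j l)))
    rw [abs_neg]
    exact b3 a k l
  have hp : ∀ a k i j, pderiv univ a (christoffel univ (fun z => gram (G z)) k i j) y
      = ∑ l, (r a k i j l + g k l * (1 / 2 * (q a i j l + q a j i l - q a l i j))) := by
    intro a k i j
    obtain ⟨L, hL, hL'⟩ := hasFDerivAt_christoffel hG hdet k i j
    rw [pderiv, fderivWithin_univ, hL.fderiv, hL']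
    exact Finset.sum_congr rfl fun l _ => by simp only [hr]; ring
  set rr : Fin (m + 1) → Fin (m + 1) → ℝ := fun j k =>
    ∑ i, ∑ l, (r i i j k l - r j i i k l)
      + ∑ i, ∑ p, (christoffel univ (fun z => gram (G z)) i i p y
          * christoffel univ (fun z => gram (G z)) p j k y
        - christoffel univ (fun z => gram (G z)) i j p y
          * christoffel univ (fun z => gram (G z)) p i k y) with hrr
  have b5 : ∀ j k, |rr j k| ≤ c5 := by
    intro j k
    refine (abs_add_le _ _).trans (add_le_add (abs_sum_fin_le fun i => abs_sum_fin_le fun l => ?_)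
      (abs_sum_fin_le fun i => abs_sum_fin_le fun p => ?_))
    · exact (abs_sub _ _).trans (add_le_add (b4 _ _ _ _ _) (b4 _ _ _ _ _))
    · exact (abs_sub _ _).trans (add_le_add (abs_mul_le' (b2 _ _ _) (b2 _ _ _))
        (abs_mul_le' (b2 _ _ _) (b2 _ _ _)))
  have hric : ∀ j k, ricci (fun z => gram (G z)) j k y = rr j k
      + ∑ i, ∑ l, (g i l * (1 / 2 * (q i j k l + q i k j l - q i l j k))
        - g i l * (1 / 2 * (q j i k l + q j k i l - q j l i k))) := by
    intro j k
    simp only [ricci, hp, hrr, ← Finset.sum_sub_distrib]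
    rw [add_right_comm]
    congr 1
    rw [← Finset.sum_add_distrib]
    refine Finset.sum_congr rfl fun i _ => ?_
    rw [← Finset.sum_add_distrib]
    exact Finset.sum_congr rfl fun l _ => by ring
  have hM := sum_normal_second_derivatives g J h0 h0' hJ q fun _ _ _ _ => rfl
  have : scalarLocal (fun z => gram (G z)) y + contr (gram (G y)) J
      = ∑ j, ∑ k, g j k * rr j k := by
    have h1 : contr (gram (G y)) J = ∑ j, ∑ k, g j k * J j k := rfl
    have h2 : scalarLocal (fun z => gram (G z)) y
        = ∑ j, ∑ k, g j k * ricci (fun z => gram (G z)) j k y := rfl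
    rw [h1, h2]
    simp only [hric, mul_add, Finset.sum_add_distrib]
    rw [hM]
    ring
  rw [this]
  exact abs_sum_fin_le fun j => abs_sum_fin_le fun k => abs_mul_le' (hg j k) (b5 j k)

end Estimate

/-! ### Profile functions: smoothings of the positive part -/

section Profile

/-- Outside `[-1,1]` this is the support condition; at the endpoints `±1` it follows by continuity.
-/
theorem IsMollifier.eq_zero {φ : ℝ → ℝ} (hφ : IsMollifier φ) {s : ℝ} (hs : 1 ≤ |s|) : φ s = 0 := by
  have hcl : IsClosed {s | φ s = 0} := isClosed_eq hφ.contDiff.continuous continuous_const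
  have hout : ∀ s, 1 < |s| → φ s = 0 := fun s hs => by
    by_contra h
    have := hφ.tsupport_subset (subset_tsupport φ h)
    exact absurd (abs_le.2 ⟨this.1, this.2⟩) (not_le.2 hs)
  have h1 : Ici (1 : ℝ) ⊆ {s | φ s = 0} := by
    rw [← closure_Ioi]
    exact closure_minimal (fun s hs => hout s (lt_of_lt_of_le hs (le_abs_self s))) hcl
  have h2 : Iic (-1 : ℝ) ⊆ {s | φ s = 0} := by
    rw [← closure_Iio]
    exact closure_minimal (fun s hs => hout s (lt_of_lt_of_le (lt_neg.1 hs) (neg_le_abs s))) hcl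
  rcases le_abs.1 hs with h | h
  · exact h1 h
  · exact h2 (le_neg.1 h : s ≤ -1)

/-- The mollifier rescaled to the interval `[-δ²/100, δ²/100]`. -/
def scaled (φ : ℝ → ℝ) (δ t : ℝ) : ℝ := 100 / δ ^ 2 * φ (100 * t / δ ^ 2)

theorem IsMollifier.scaled_eq_zero {φ : ℝ → ℝ} (hφ : IsMollifier φ) {δ t : ℝ} (hδ : 0 < δ)
    (ht : δ ^ 2 / 100 ≤ |t|) : scaled φ δ t = 0 := by
  rw [scaled, hφ.eq_zero, mul_zero]
  rw [abs_div, abs_mul, abs_of_pos (by positivity : 0 < δ ^ 2), le_div_iff₀ (by positivity)]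
  rw [abs_of_pos (by norm_num : (0 : ℝ) < 100)]
  linarith

theorem IsMollifier.scaled_nonneg {φ : ℝ → ℝ} (hφ : IsMollifier φ) (δ t : ℝ) :
    0 ≤ scaled φ δ t := mul_nonneg (by positivity) (hφ.nonneg _)

theorem IsMollifier.scaled_le {φ : ℝ → ℝ} (hφ : IsMollifier φ) (δ t : ℝ) :
    scaled φ δ t ≤ 100 / δ ^ 2 :=
  mul_le_of_le_one_right (by positivity) (hφ.le_one _)

theorem IsMollifier.contDiff_scaled {φ : ℝ → ℝ} (hφ : IsMollifier φ) (δ : ℝ) :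
    ContDiff ℝ ∞ (scaled φ δ) := by
  unfold scaled
  exact contDiff_const.mul (hφ.contDiff.comp ((contDiff_const.mul contDiff_id).div_const _))

theorem IsMollifier.integral_scaled {φ : ℝ → ℝ} (hφ : IsMollifier φ) {δ : ℝ} (hδ : 0 < δ) :
    ∫ t, scaled φ δ t = 1 := by
  have h : ∀ t, scaled φ δ t = 100 / δ ^ 2 * φ (100 / δ ^ 2 * t) := fun t => by
    rw [scaled]; congr 2; ring
  simp only [h]
  rw [MeasureTheory.integral_const_mul, MeasureTheory.Measure.integral_comp_mul_left,
    hφ.integral_eq, abs_of_pos (by positivity)]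
  simp only [smul_eq_mul, mul_one]
  exact mul_inv_cancel₀ (by positivity)

/-- Because `min t 0 = -max (-t) 0`, the smoothing used on the inner side is a reflected profile; it
has to be built from the reflected mollifier for both sides to see the same `φ`. -/
theorem IsMollifier.reflect {φ : ℝ → ℝ} (hφ : IsMollifier φ) : IsMollifier fun t => φ (-t) where
  contDiff := hφ.contDiff.comp contDiff_neg
  tsupport_subset := by
    refine closure_minimal (fun t ht => ?_) isClosed_Icc
    have := hφ.tsupport_subset (subset_tsupport φ ht)
    exact ⟨by linarith [this.2], by linarith [this.1]⟩
  nonneg t := hφ.nonneg _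
  le_one t := hφ.le_one _
  integral_eq := by rw [MeasureTheory.integral_neg_eq_self]; exact hφ.integral_eq

theorem bounded_of_eq_zero_off_Icc {f : ℝ → ℝ} (hf : Continuous f) (h : ∀ t ∉ Icc (0 : ℝ) 1, f t = 0) :
    ∃ K, ∀ t, |f t| ≤ K := by
  obtain ⟨K, hK⟩ := isCompact_Icc.exists_bound_of_continuousOn (s := Icc (0 : ℝ) 1) hf.continuousOn
  refine ⟨K, fun t => ?_⟩
  by_cases ht : t ∈ Icc (0 : ℝ) 1
  · exact hK t ht
  · rw [h t ht, abs_zero]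
    exact (norm_nonneg _).trans (hK 0 (by simp))

/-- The transition function is locally constant off `[0,1]`, so its derivatives are continuous with
support in a compact interval. -/
theorem smoothTransition_derivs_bounded : ∃ K, 0 ≤ K ∧ ∀ t,
    |deriv Real.smoothTransition t| ≤ K ∧ |deriv (deriv Real.smoothTransition) t| ≤ K := by
  have hs : ContDiff ℝ 2 Real.smoothTransition := Real.smoothTransition.contDiff
  have hs1 : ContDiff ℝ 1 (deriv Real.smoothTransition) := hs.deriv' 
  have hz : ∀ t ∉ Icc (0 : ℝ) 1, deriv Real.smoothTransition =ᶠ[𝓝 t] fun _ => 0 := by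
    intro t ht
    rw [mem_Icc, not_and_or, not_le, not_le] at ht
    rcases ht with ht | ht
    · filter_upwards [Iio_mem_nhds ht] with s hs
      have : Real.smoothTransition =ᶠ[𝓝 s] fun _ => 0 := by
        filter_upwards [Iio_mem_nhds hs] with r hr
        exact Real.smoothTransition.zero_of_nonpos (le_of_lt hr)
      rw [this.deriv_eq]; simp
    · filter_upwards [Ioi_mem_nhds ht] with s hs
      have : Real.smoothTransition =ᶠ[𝓝 s] fun _ => 1 := by
        filter_upwards [Ioi_mem_nhds hs] with r hr
        exact Real.smoothTransition.one_of_one_le (le_of_lt hr)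
      rw [this.deriv_eq]; simp
  obtain ⟨K₁, h₁⟩ := bounded_of_eq_zero_off_Icc hs1.continuous fun t ht => (hz t ht).self_of_nhds
  obtain ⟨K₂, h₂⟩ := bounded_of_eq_zero_off_Icc (hs1.continuous_deriv le_rfl) fun t ht => by
    rw [(hz t ht).deriv_eq]; simp
  exact ⟨max K₁ K₂, (abs_nonneg _).trans ((h₁ 0).trans (le_max_left _ _)),
    fun t => ⟨(h₁ t).trans (le_max_left _ _), (h₂ t).trans (le_max_right _ _)⟩⟩

/-- A double primitive of the rescaled mollifier. -/
theorem IsMollifier.exists_double_primitive {φ : ℝ → ℝ} (hφ : IsMollifier φ) {δ : ℝ} (hδ : 0 < δ) :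
    ∃ (p H : ℝ → ℝ) (a : ℝ), (∀ t, HasDerivAt p (scaled φ δ t) t) ∧ (∀ t, HasDerivAt H (p t) t) ∧
      (∀ t, 0 ≤ p t ∧ p t ≤ 1) ∧ Monotone H ∧ (∀ t ≤ -(δ ^ 2 / 100), H t = 0) ∧
      (∀ t, δ ^ 2 / 100 ≤ t → H t = t - a) ∧ |a| ≤ δ ^ 2 / 100 := by
  set c := δ ^ 2 / 100 with hc
  have hc0 : 0 < c := by positivity
  have hψ := (hφ.contDiff_scaled δ).continuous
  -- The mollifier starts at `-c`; with this lower limit both primitives vanish to the left of `-c`.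
  set p : ℝ → ℝ := fun t => ∫ s in (-c)..t, scaled φ δ s with hp
  have hpd : ∀ t, HasDerivAt p (scaled φ δ t) t := fun t =>
    intervalIntegral.integral_hasDerivAt_right (hψ.intervalIntegrable _ _)
      (hψ.stronglyMeasurableAtFilter _ _) hψ.continuousAt
  have hpc : Continuous p := continuous_iff_continuousAt.2 fun t => (hpd t).continuousAt
  have hpm : Monotone p := monotone_of_deriv_nonneg (fun t => (hpd t).differentiableAt)
    fun t => by rw [(hpd t).deriv]; exact hφ.scaled_nonneg δ t
  have hp0 : ∀ t ≤ -c, p t = 0 := fun t ht => by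
    refine intervalIntegral.integral_zero_ae (Eventually.of_forall fun s hs => ?_)
    rw [uIoc_of_ge ht] at hs
    refine hφ.scaled_eq_zero hδ (le_abs.2 (Or.inr ?_))
    linarith [hs.2]
  have hp1 : ∀ t, c ≤ t → p t = 1 := fun t ht => by
    rw [hp]
    dsimp only
    rw [intervalIntegral.integral_eq_integral_of_support_subset, hφ.integral_scaled hδ]
    intro s hs
    by_contra hcon
    refine hs (hφ.scaled_eq_zero hδ ?_)
    rw [mem_Ioc, not_and_or, not_lt, not_le] at hcon
    rcases hcon with h | h
    · exact le_abs.2 (Or.inr (by linarith))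
    · exact le_abs.2 (Or.inl (by linarith))
  have hp01 : ∀ t, 0 ≤ p t ∧ p t ≤ 1 := fun t =>
    ⟨(hp0 _ (min_le_right t (-c))).symm.le.trans (hpm (min_le_left _ _)),
      (hpm (le_max_left t c)).trans (hp1 _ (le_max_right _ _)).le⟩
  set H : ℝ → ℝ := fun t => ∫ s in (-c)..t, p s with hH
  have hHd : ∀ t, HasDerivAt H (p t) t := fun t =>
    intervalIntegral.integral_hasDerivAt_right (hpc.intervalIntegrable _ _)
      (hpc.stronglyMeasurableAtFilter _ _) hpc.continuousAt
  have hHm : Monotone H := monotone_of_deriv_nonneg (fun t => (hHd t).differentiableAt)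
    fun t => by rw [(hHd t).deriv]; exact (hp01 t).1
  have hH0 : ∀ t ≤ -c, H t = 0 := fun t ht => by
    refine intervalIntegral.integral_zero_ae (Eventually.of_forall fun s hs => ?_)
    rw [uIoc_of_ge ht] at hs
    exact hp0 s hs.2
  -- Beyond `c` the slope is one, so `H` is `t` minus the constant `c - H c`. This defect need not
  -- vanish, as `φ` is not assumed even.
  have hHc : ∀ t, c ≤ t → H t = t - (c - H c) := fun t ht => by
    have h1 : H t = H c + ∫ s in c..t, p s :=
      (intervalIntegral.integral_add_adjacent_intervals (hpc.intervalIntegrable _ _)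
        (hpc.intervalIntegrable _ _)).symm
    have h2 : ∫ s in c..t, p s = ∫ s in c..t, (1 : ℝ) := by
      refine intervalIntegral.integral_congr fun s hs => ?_
      rw [uIcc_of_le ht] at hs
      exact hp1 s hs.1
    rw [h1, h2]
    simp
    ring
  refine ⟨p, H, c - H c, hpd, hHd, hp01, hHm, hH0, hHc, ?_⟩
  have h1 : 0 ≤ H c := (hH0 (-c) le_rfl).symm.le.trans (hHm (by linarith))
  -- The slope is at most one on an interval of length `2c`, so the defect `c - H c` lies in `[-c,
  -- c]`.
  have h2 : H c ≤ 2 * c := by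
    have : H c ≤ ∫ s in (-c)..c, (1 : ℝ) :=
      intervalIntegral.integral_mono_on (by linarith) (hpc.intervalIntegrable _ _)
        (continuous_const.intervalIntegrable _ _) fun s _ => (hp01 s).2
    refine this.trans (le_of_eq ?_)
    simp
    ring
  exact abs_le.2 ⟨by linarith, by linarith⟩

/-- `h` is a smoothing of `t ↦ max t 0`, supported in `|t| < δ / 2`, whose second derivative is a
mollifier of width `δ²/100` up to a bounded error. -/
structure IsProfile (K : ℝ) (φ : ℝ → ℝ) (δ : ℝ) (h : ℝ → ℝ) : Prop where
  contDiff : ContDiff ℝ 2 h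
  nonneg : ∀ t, 0 ≤ h t
  eq_zero : ∀ t ≤ -(δ / 2), h t = 0
  eq_self : ∀ t, δ / 2 ≤ t → h t = t
  abs_sub_le : ∀ t, |h t - max t 0| ≤ 3 * (δ ^ 2 / 100)
  abs_deriv_le : ∀ t, |deriv h t| ≤ K
  abs_deriv_deriv_sub_le : ∀ t, |deriv (deriv h) t - scaled φ δ t| ≤ K

/-- A double primitive of the mollifier equals `t - a` past the mollified layer, with `|a| ≤
δ²/100`. Adding `a` times a transition of length `δ/4` restores `t`. The second derivative of this
correction is of order `|a|/δ²`, which is bounded exactly because the layer has width of order `δ²`.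
The constant comes from the transition function alone, so it depends neither on `φ` nor on `δ`. -/
theorem exists_isProfile : ∃ K : ℝ, 0 ≤ K ∧ ∀ φ, IsMollifier φ → ∀ δ ∈ Ioc (0 : ℝ) 1,
    ∃ h, IsProfile K φ δ h := by
  obtain ⟨K, hK, hθ⟩ := smoothTransition_derivs_bounded
  refine ⟨1 + K, by linarith, fun φ hφ δ hδ => ?_⟩
  obtain ⟨hδ0, hδ1⟩ := hδ
  obtain ⟨p, H, a, hpd, hHd, hp01, hHm, hH0, hHc, ha⟩ := hφ.exists_double_primitive hδ0
  set c := δ ^ 2 / 100 with hc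
  have hc0 : 0 < c := by positivity
  -- Since `δ ≤ 1`, the layer `|t| ≤ c` ends well before `δ/4`, where the correction begins.
  have hcδ : c ≤ δ / 100 := by rw [hc]; nlinarith
  have ha' := abs_le.1 ha
  set θ := Real.smoothTransition with hθdef
  have hθd : ∀ t, HasDerivAt θ (deriv θ t) t := fun t =>
    ((Real.smoothTransition.contDiff (n := 1)).differentiable (by norm_num) t).hasDerivAt
  have hθ1 : ContDiff ℝ 1 (deriv θ) := (Real.smoothTransition.contDiff (n := 2)).deriv'
  have hθd' : ∀ t, HasDerivAt (deriv θ) (deriv (deriv θ) t) t := fun t =>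
    (hθ1.differentiable (by norm_num) t).hasDerivAt
  have hl : ∀ t, HasDerivAt (fun t => 4 * t / δ - 1) (4 / δ) t := fun t => by
    simpa using (((hasDerivAt_id t).const_mul 4).div_const δ).sub_const 1
  -- The argument `4t/δ - 1` runs through `[0,1]` as `t` runs through `[δ/4, δ/2]`.
  set h : ℝ → ℝ := fun t => H t + a * θ (4 * t / δ - 1) with hh
  have hd : ∀ t, HasDerivAt h (p t + a * (deriv θ (4 * t / δ - 1) * (4 / δ))) t := fun t =>
    (hHd t).add (((hθd _).comp t (hl t)).const_mul a)
  have hdeq : deriv h = fun t => p t + a * (deriv θ (4 * t / δ - 1) * (4 / δ)) :=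
    funext fun t => (hd t).deriv
  have hd2 : ∀ t, HasDerivAt (deriv h) (scaled φ δ t
      + a * (deriv (deriv θ) (4 * t / δ - 1) * (4 / δ) * (4 / δ))) t := fun t => by
    rw [hdeq]
    exact (hpd t).add ((((hθd' _).comp t (hl t)).mul_const (4 / δ)).const_mul a)
  have hd2eq : deriv (deriv h) = fun t => scaled φ δ t
      + a * (deriv (deriv θ) (4 * t / δ - 1) * (4 / δ) * (4 / δ)) := funext fun t => (hd2 t).deriv
  have hθnn : ∀ t, 0 ≤ θ t := Real.smoothTransition.nonneg
  have hθle : ∀ t, θ t ≤ 1 := Real.smoothTransition.le_one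
  have haθ : ∀ t, |a * θ t| ≤ c := fun t => by
    rw [abs_mul, abs_of_nonneg (hθnn t)]
    exact (mul_le_of_le_one_right (abs_nonneg _) (hθle t)).trans ha
  have hHnn : ∀ t, 0 ≤ H t := fun t =>
    (hH0 _ (min_le_right t (-c))).symm.le.trans (hHm (min_le_left _ _))
  refine ⟨h, ?_, fun t => ?_, fun t ht => ?_, fun t ht => ?_, fun t => ?_, fun t => ?_, fun t => ?_⟩
  · rw [show (2 : ℕ∞ω) = 1 + 1 by norm_num, contDiff_succ_iff_deriv]
    refine ⟨fun t => (hd t).differentiableAt, by simp, ?_⟩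
    rw [show (1 : ℕ∞ω) = 0 + 1 by norm_num, contDiff_succ_iff_deriv]
    refine ⟨fun t => (hd2 t).differentiableAt, by simp, ?_⟩
    rw [hd2eq, contDiff_zero]
    refine (hφ.contDiff_scaled δ).continuous.add (continuous_const.mul
      ((((hθ1.continuous_deriv le_rfl).comp ?_).mul continuous_const).mul continuous_const))
    fun_prop
  · rcases le_or_gt t (δ / 4) with ht | ht
    · have : θ (4 * t / δ - 1) = 0 := Real.smoothTransition.zero_of_nonpos (by
        rw [sub_nonpos, div_le_one hδ0]; linarith)
      simp only [hh, this, mul_zero, add_zero]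
      exact hHnn t
    · simp only [hh]
      rw [hHc t (by linarith)]
      have := abs_le.1 (haθ (4 * t / δ - 1))
      linarith
  · have : θ (4 * t / δ - 1) = 0 := Real.smoothTransition.zero_of_nonpos (by
      rw [sub_nonpos, div_le_one hδ0]; linarith)
    simp only [hh, this, mul_zero, add_zero]
    exact hH0 t (by linarith)
  · have : θ (4 * t / δ - 1) = 1 := Real.smoothTransition.one_of_one_le (by
      rw [le_sub_iff_add_le, le_div_iff₀ hδ0]; linarith)
    simp only [hh, this, mul_one]
    rw [hHc t (by linarith)]
    ring
  · have h1 := abs_le.1 (haθ (4 * t / δ - 1))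
    -- Outside the layer the difference is `0` or `-a`; inside it both functions lie between `0` and
    -- `2c`.
    have h2 : |H t - max t 0| ≤ 2 * c := by
      rcases le_or_gt t (-c) with ht | ht
      · rw [hH0 t ht, max_eq_right (by linarith)]
        simp; linarith
      · rcases le_or_gt c t with ht' | ht'
        · rw [hHc t ht', max_eq_left (by linarith)]
          rw [abs_le]; constructor <;> linarith
        · have h3 := hHm ht'.le
          rw [hHc c le_rfl] at h3
          have h4 := hHnn t
          have h5 : max t 0 ≤ c := max_le ht'.le hc0.le
          have h6 : 0 ≤ max t 0 := le_max_right _ _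
          rw [abs_le]; constructor <;> linarith
    have h3 := abs_le.1 h2
    simp only [hh]
    rw [abs_le]
    constructor <;> linarith
  · rw [hdeq]
    refine (abs_add_le _ _).trans (add_le_add ?_ ?_)
    · rw [abs_of_nonneg (hp01 t).1]; exact (hp01 t).2
    · have h1 : |a * (deriv θ (4 * t / δ - 1) * (4 / δ))| ≤ c * (K * (4 / δ)) := by
        refine abs_mul_le' ha (abs_mul_le' (hθ _).1 ?_)
        rw [abs_of_pos (by positivity)]
      refine h1.trans ?_
      have : c * (K * (4 / δ)) = K * (4 * δ / 100) := by rw [hc]; field_simp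
      rw [this]
      exact mul_le_of_le_one_right hK (by linarith)
  · rw [hd2eq]
    simp only [add_sub_cancel_left]
    have h1 : |a * (deriv (deriv θ) (4 * t / δ - 1) * (4 / δ) * (4 / δ))|
        ≤ c * (K * (4 / δ) * (4 / δ)) := by
      have : |4 / δ| ≤ 4 / δ := by rw [abs_of_pos (by positivity)]
      exact abs_mul_le' ha (abs_mul_le' (abs_mul_le' (hθ _).2 this) this)
    refine h1.trans ?_
    -- The two factors `1/δ` from the chain rule are absorbed by `c = δ²/100`.
    have : c * (K * (4 / δ) * (4 / δ)) = K * (16 / 100) := by rw [hc]; field_simp; norm_num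
    rw [this]
    linarith

end Profile

/-! ### Substituting a function of the height for the normal coordinate -/

section Substitution

variable {m : ℕ} {F : Type*} [NormedAddCommGroup F] [NormedSpace ℝ F]

/-- The point `y` with its zeroth coordinate replaced by `s`. -/
def line (y : E (m + 1)) (s : ℝ) : E (m + 1) := y + (s - y 0) • bv 0

theorem line_zero_coord (y : E (m + 1)) (s : ℝ) : line y s 0 = s := by
  simp [line]

theorem line_self (y : E (m + 1)) : line y (y 0) = y := by
  simp [line]

theorem hasDerivAt_line (y : E (m + 1)) (s : ℝ) : HasDerivAt (line y) (bv 0) s := by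
  unfold line
  simpa using (((hasDerivAt_id s).sub_const (y 0)).smul_const (bv 0)).const_add y

/-- The scaling factors of the substitution of `k` for the zeroth coordinate. -/
def subScale (k : ℝ → ℝ) (y : E (m + 1)) (a : Fin (m + 1)) : ℝ :=
  if a = 0 then deriv k (y 0) else 1

theorem hasFDerivAt_sub {k : ℝ → ℝ} (hk : ContDiff ℝ 2 k) (y : E (m + 1)) :
    ∃ L : E (m + 1) →L[ℝ] E (m + 1), HasFDerivAt (fun y => line y (k (y 0))) L y ∧
      ∀ a, L (bv a) = subScale k y a • bv a := by
  have h0 : HasFDerivAt (fun y : E (m + 1) => y 0)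
      (EuclideanSpace.proj 0 : E (m + 1) →L[ℝ] ℝ) y :=
    (EuclideanSpace.proj 0 : E (m + 1) →L[ℝ] ℝ).hasFDerivAt
  have h1 := ((hk.differentiable (by norm_num) (y 0)).hasDerivAt).comp_hasFDerivAt y h0
  refine ⟨_, (hasFDerivAt_id y).add ((h1.sub h0).smul_const (bv 0)), fun a => ?_⟩
  by_cases ha : a = 0
  · subst ha
    simp [subScale, sub_smul]
  · simp [subScale, ha, Ne.symm ha]

theorem contDiff_sub {k : ℝ → ℝ} (hk : ContDiff ℝ 2 k) :
    ContDiff ℝ 2 (fun y : E (m + 1) => line y (k (y 0))) := by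
  have h0 : ContDiff ℝ 2 (fun y : E (m + 1) => y 0) :=
    (EuclideanSpace.proj 0 : E (m + 1) →L[ℝ] ℝ).contDiff
  exact contDiff_id.add (((hk.comp h0).sub h0).smul contDiff_const)

variable {G : E (m + 1) → F} {A O : Set (E (m + 1))} {k : ℝ → ℝ}

/-- `G` is C² only within `A`, up to its boundary, but the substitution maps the open set `O` into
`A`. The composite is therefore C² in the ordinary sense, also at points that are sent to the
boundary. This is how one-sided metrics produce a C² metric across Σ. -/
theorem contDiffAt_comp_sub (hG : ContDiffOn ℝ 2 G A) (hO : IsOpen O)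
    (hm : ∀ y ∈ O, line y (k (y 0)) ∈ A) (hk : ContDiff ℝ 2 k) {y : E (m + 1)} (hy : y ∈ O) :
    ContDiffAt ℝ 2 (fun y => G (line y (k (y 0)))) y :=
  (hG.comp (contDiff_sub hk).contDiffOn hm).contDiffAt (hO.mem_nhds hy)

theorem hasFDerivAt_comp_sub (hG : DifferentiableOn ℝ G A) (hO : IsOpen O)
    (hm : ∀ y ∈ O, line y (k (y 0)) ∈ A) (hk : ContDiff ℝ 2 k) {y : E (m + 1)} (hy : y ∈ O) :
    ∃ L : E (m + 1) →L[ℝ] F, HasFDerivAt (fun y => G (line y (k (y 0)))) L y ∧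
      ∀ a, L (bv a) = subScale k y a • fderivWithin ℝ G A (line y (k (y 0))) (bv a) := by
  obtain ⟨L, hL, hL'⟩ := hasFDerivAt_sub hk y
  have h1 := (hG _ (hm y hy)).hasFDerivWithinAt
  have h2 := h1.comp y hL.hasFDerivWithinAt hm
  refine ⟨_, h2.hasFDerivAt (hO.mem_nhds hy), fun a => ?_⟩
  simp [hL']

theorem fderiv_comp_sub (hG : DifferentiableOn ℝ G A) (hO : IsOpen O)
    (hm : ∀ y ∈ O, line y (k (y 0)) ∈ A) (hk : ContDiff ℝ 2 k) {y : E (m + 1)} (hy : y ∈ O)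
    (a : Fin (m + 1)) : fderiv ℝ (fun y => G (line y (k (y 0)))) y (bv a)
      = subScale k y a • fderivWithin ℝ G A (line y (k (y 0))) (bv a) := by
  obtain ⟨L, hL, hL'⟩ := hasFDerivAt_comp_sub hG hO hm hk hy
  rw [hL.fderiv, hL']

/-- Chain rule used twice: the factor `k''` occurs only in the normal-normal entry, multiplied by
the first normal derivative of `G`. -/
theorem fderiv_fderiv_comp_sub (hA : UniqueDiffOn ℝ A) (hG : ContDiffOn ℝ 2 G A) (hO : IsOpen O)
    (hm : ∀ y ∈ O, line y (k (y 0)) ∈ A) (hk : ContDiff ℝ 2 k) {y : E (m + 1)} (hy : y ∈ O)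
    (a b : Fin (m + 1)) : fderiv ℝ (fderiv ℝ (fun y => G (line y (k (y 0))))) y (bv a) (bv b)
      = (subScale k y a * subScale k y b) •
          fderivWithin ℝ (fderivWithin ℝ G A) A (line y (k (y 0))) (bv a) (bv b)
        + (if a = 0 ∧ b = 0 then deriv (deriv k) (y 0) else 0) •
          fderivWithin ℝ G A (line y (k (y 0))) (bv 0) := by
  have hGd := hG.differentiableOn (by norm_num)
  have hDG : DifferentiableOn ℝ (fderivWithin ℝ G A) A :=
    (hG.fderivWithin hA (m := 1) (by norm_num)).differentiableOn (by norm_num)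
  have h1 := hasFDerivAt_fderiv (contDiffAt_comp_sub hG hO hm hk hy)
  have h2 := h1.clm_apply (hasFDerivAt_const (bv b) y)
  obtain ⟨L, hL, hL'⟩ := hasFDerivAt_comp_sub hDG hO hm hk hy
  have h3 := hL.clm_apply (hasFDerivAt_const (bv b) y)
  have h0 : HasFDerivAt (fun y : E (m + 1) => y 0)
      (EuclideanSpace.proj 0 : E (m + 1) →L[ℝ] ℝ) y :=
    (EuclideanSpace.proj 0 : E (m + 1) →L[ℝ] ℝ).hasFDerivAt
  have hk1 : ContDiff ℝ 1 (deriv k) := hk.deriv'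
  have hk' := ((hk1.differentiable (by norm_num) (y 0)).hasDerivAt).comp_hasFDerivAt y h0
  have hs : ∃ M : E (m + 1) →L[ℝ] ℝ, HasFDerivAt (fun y => subScale k y b) M y ∧
      ∀ a, M (bv a) = if a = 0 ∧ b = 0 then deriv (deriv k) (y 0) else 0 := by
    by_cases hb : b = 0
    · subst hb
      refine ⟨_, hk', fun a => ?_⟩
      by_cases ha : a = 0
      · simp [ha]
      · simp [ha, Ne.symm ha]
    · simp only [subScale, hb, if_false]
      exact ⟨0, hasFDerivAt_const _ _, by simp⟩
  obtain ⟨M, hM, hM'⟩ := hs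
  have h4 := hM.fun_smul h3
  -- The formula for the first derivative holds on the whole open set `O`, so it may be
  -- differentiated again.
  have h5 := h4.congr_of_eventuallyEq (f₁ := fun y' => fderiv ℝ (fun y => G (line y (k (y 0)))) y'
    (bv b)) (by
      filter_upwards [hO.mem_nhds hy] with y' hy'
      exact fderiv_comp_sub hGd hO hm hk hy' b)
  have h6 := congrArg (fun L : E (m + 1) →L[ℝ] F => L (bv a)) (h2.unique h5)
  simp only [add_apply, ContinuousLinearMap.comp_apply, ContinuousLinearMap.flip_apply,
    zero_apply, map_zero, zero_add, smul_apply, ContinuousLinearMap.smulRight_apply, hM',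
    hL'] at h6
  rw [h6, smul_smul, mul_comm (subScale k y b)]
  by_cases hab : a = 0 ∧ b = 0
  · obtain ⟨rfl, rfl⟩ := hab
    rfl
  · simp [hab]

/-- Bounds for `G` and its derivatives along the normal line through `y`. -/
structure LineBound (G : E (m + 1) → F) (A : Set (E (m + 1))) (y : E (m + 1)) (I : Set ℝ)
    (C : ℝ) : Prop where
  convex : Convex ℝ I
  mem : ∀ s ∈ I, line y s ∈ A
  fderiv_le : ∀ s ∈ I, ‖fderivWithin ℝ G A (line y s)‖ ≤ C
  fderiv_fderiv_le : ∀ s ∈ I, ‖fderivWithin ℝ (fderivWithin ℝ G A) A (line y s)‖ ≤ C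

theorem norm_bv (i : Fin (m + 1)) : ‖(bv i : E (m + 1))‖ = 1 := by simp

/-- Mean value inequality on the normal segment; this is what the convexity in `LineBound` serves
for. -/
theorem norm_line_sub_le {F' : Type*} [NormedAddCommGroup F'] [NormedSpace ℝ F']
    {f : E (m + 1) → F'} {I : Set ℝ} {C : ℝ} {y : E (m + 1)}
    (hf : DifferentiableOn ℝ f A) (hI : Convex ℝ I) (hmem : ∀ s ∈ I, line y s ∈ A)
    (hb : ∀ s ∈ I, ‖fderivWithin ℝ f A (line y s)‖ ≤ C) {s t : ℝ} (hs : s ∈ I) (ht : t ∈ I) :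
    ‖f (line y s) - f (line y t)‖ ≤ C * |s - t| := by
  have h1 : ∀ r ∈ I, HasDerivWithinAt (fun r => f (line y r))
      (fderivWithin ℝ f A (line y r) (bv 0)) I r := fun r hr =>
    ((hf _ (hmem r hr)).hasFDerivWithinAt).comp_hasDerivWithinAt r
      (hasDerivAt_line y r).hasDerivWithinAt hmem
  refine hI.norm_image_sub_le_of_norm_hasDerivWithin_le h1 (fun r hr => ?_) ht hs
  refine ((fderivWithin ℝ f A (line y r)).le_opNorm _).trans ?_
  rw [norm_bv, mul_one]
  exact hb r hr

theorem LineBound.norm_sub_le {I : Set ℝ} {C : ℝ} {y : E (m + 1)} (h : LineBound G A y I C)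
    (hG : ContDiffOn ℝ 2 G A) {s t : ℝ} (hs : s ∈ I) (ht : t ∈ I) :
    ‖G (line y s) - G (line y t)‖ ≤ C * |s - t| :=
  norm_line_sub_le (hG.differentiableOn (by norm_num)) h.convex h.mem h.fderiv_le hs ht

theorem LineBound.norm_fderiv_sub_le {I : Set ℝ} {C : ℝ} {y : E (m + 1)}
    (h : LineBound G A y I C) (hA : UniqueDiffOn ℝ A) (hG : ContDiffOn ℝ 2 G A) {s t : ℝ}
    (hs : s ∈ I) (ht : t ∈ I) :
    ‖fderivWithin ℝ G A (line y s) - fderivWithin ℝ G A (line y t)‖ ≤ C * |s - t| :=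
  norm_line_sub_le ((hG.fderivWithin hA (m := 1) (by norm_num)).differentiableOn (by norm_num))
    h.convex h.mem h.fderiv_fderiv_le hs ht

theorem abs_subScale_le {K : ℝ} (hK : 0 ≤ K) {y : E (m + 1)} (h : |deriv k (y 0)| ≤ K)
    (a : Fin (m + 1)) : |subScale k y a| ≤ 1 + K := by
  rw [subScale]
  split_ifs
  · linarith
  · simp [hK]

/-- First and second derivatives of the substituted form. The second normal derivative is a multiple
of the first normal derivative at the hypersurface, up to a bounded error. -/
theorem LineBound.derivs_comp_sub {I : Set ℝ} {C K ψ : ℝ} {y : E (m + 1)}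
    (h : LineBound G A y I C) (hA : UniqueDiffOn ℝ A) (hG : ContDiffOn ℝ 2 G A) (hO : IsOpen O)
    (hm : ∀ y ∈ O, line y (k (y 0)) ∈ A) (hk : ContDiff ℝ 2 k) (hy : y ∈ O) (hK : 0 ≤ K)
    (hky : k (y 0) ∈ I) (h0 : 0 ∈ I) (hk1 : |deriv k (y 0)| ≤ K)
    (hk2 : |deriv (deriv k) (y 0) - ψ| ≤ K) (hψ : |ψ| * |k (y 0)| ≤ 4) (a b : Fin (m + 1)) :
    ‖fderiv ℝ (fun y => G (line y (k (y 0)))) y (bv a)‖ ≤ (1 + K) * C ∧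
    ‖fderiv ℝ (fderiv ℝ (fun y => G (line y (k (y 0))))) y (bv a) (bv b)
      - (if a = 0 ∧ b = 0 then ψ • fderivWithin ℝ G A (line y 0) (bv 0) else 0)‖
        ≤ (1 + K) * (1 + K) * C + (K * C + 4 * C) := by
  have hC : 0 ≤ C := (norm_nonneg _).trans (h.fderiv_le 0 h0)
  have hsc := abs_subScale_le hK hk1
  have e1 : ∀ a : Fin (m + 1), ‖fderivWithin ℝ G A (line y (k (y 0))) (bv a)‖ ≤ C := fun a => by
    refine ((fderivWithin ℝ G A _).le_opNorm _).trans ?_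
    rw [norm_bv, mul_one]
    exact h.fderiv_le _ hky
  constructor
  · rw [fderiv_comp_sub (hG.differentiableOn (by norm_num)) hO hm hk hy, norm_smul]
    exact mul_le_mul (hsc a) (e1 a) (norm_nonneg _) (by linarith)
  · rw [fderiv_fderiv_comp_sub hA hG hO hm hk hy, add_sub_assoc]
    refine (norm_add_le _ _).trans (add_le_add ?_ ?_)
    · rw [norm_smul, norm_mul]
      refine mul_le_mul (mul_le_mul (hsc a) (hsc b) (norm_nonneg _) (by linarith)) ?_
        (norm_nonneg _) (by positivity)
      refine ((fderivWithin ℝ (fderivWithin ℝ G A) A _).le_opNorm₂ _ _).trans ?_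
      rw [norm_bv, norm_bv, mul_one, mul_one]
      exact h.fderiv_fderiv_le _ hky
    · split_ifs with hab
      -- Split `k'' G'(k) - ψ G'(0)` as `(k'' - ψ) G'(k) + ψ (G'(k) - G'(0))`. The first factor is
      -- bounded by `K`; the second summand is at most `|ψ| · C |k| ≤ 4C`.
      · have : deriv (deriv k) (y 0) • fderivWithin ℝ G A (line y (k (y 0))) (bv 0)
            - ψ • fderivWithin ℝ G A (line y 0) (bv 0)
            = (deriv (deriv k) (y 0) - ψ) • fderivWithin ℝ G A (line y (k (y 0))) (bv 0)
              + ψ • ((fderivWithin ℝ G A (line y (k (y 0))) - fderivWithin ℝ G A (line y 0))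
                (bv 0)) := by
          rw [sub_apply, sub_smul, smul_sub]
          abel
        rw [this]
        refine (norm_add_le _ _).trans (add_le_add ?_ ?_)
        · rw [norm_smul]
          exact mul_le_mul hk2 (e1 0) (norm_nonneg _) hK
        · rw [norm_smul]
          have h1 : ‖(fderivWithin ℝ G A (line y (k (y 0))) - fderivWithin ℝ G A (line y 0))
              (bv 0)‖ ≤ C * |k (y 0)| := by
            refine (ContinuousLinearMap.le_opNorm _ _).trans ?_
            rw [norm_bv, mul_one]
            simpa using h.norm_fderiv_sub_le hA hG hky h0
          calc ‖ψ‖ * _ ≤ |ψ| * (C * |k (y 0)|) :=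
                mul_le_mul_of_nonneg_left h1 (norm_nonneg _)
            _ = |ψ| * |k (y 0)| * C := by ring
            _ ≤ 4 * C := mul_le_mul_of_nonneg_right hψ hC
      · rw [zero_smul, sub_zero, norm_zero]
        positivity

end Substitution

/-! ### Inverse Gram matrices and the normal direction -/

section Inverse

variable {n : ℕ}

/-- `B` is bounded below by `lam` times the Euclidean metric. -/
def Coercive (lam : ℝ) (B : BL n) : Prop := ∀ v, lam * ‖v‖ ^ 2 ≤ B v v

theorem Coercive.pos {lam : ℝ} {B : BL n} (h : Coercive lam B) (hlam : 0 < lam) (v : E n)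
    (hv : v ≠ 0) : 0 < B v v :=
  lt_of_lt_of_le (by have := norm_pos_iff.2 hv; positivity) (h v)

/-- The `j`-th column `w` of the inverse satisfies `B w w = w j ≤ ‖w‖`, while coercivity gives `lam
‖w‖² ≤ B w w`. -/
theorem Coercive.abs_inv_le {lam : ℝ} {B : BL n} (h : Coercive lam B) (hlam : 0 < lam)
    (i j : Fin n) : |(gram B)⁻¹ i j| ≤ 1 / lam := by
  have hdet := isUnit_gram (h.pos hlam)
  set w : E n := WithLp.toLp 2 (fun i => (gram B)⁻¹ i j) with hw
  have h1 : ∀ i, B (bv i) w = (1 : Matrix (Fin n) (Fin n) ℝ) i j := fun i => by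
    rw [hw, ← gram_mulVec, ← Matrix.mul_nonsing_inv _ hdet]
    rfl
  have h2 : B w w = w j := by
    have : ∀ u : E n, B u w = ∑ i, u i * B (bv i) w := fun u => by
      conv_lhs => rw [sum_smul_bv u]
      simp
    rw [this]
    simp [h1, Matrix.one_apply]
  have h3 : ∀ i, |w i| ≤ ‖w‖ := fun i => PiLp.norm_apply_le w i
  have h4 := h w
  rw [h2] at h4
  have h5 : lam * ‖w‖ ^ 2 ≤ ‖w‖ := h4.trans ((le_abs_self _).trans (h3 j))
  have h6 : ‖w‖ ≤ 1 / lam := by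
    rw [le_div_iff₀ hlam]
    by_cases h0 : ‖w‖ = 0
    · rw [h0]; linarith
    · have : 0 < ‖w‖ := lt_of_le_of_ne (norm_nonneg _) (Ne.symm h0)
      nlinarith
  exact (h3 i).trans h6

/-- From `G⁻¹ - G₀⁻¹ = G⁻¹ (G₀ - G) G₀⁻¹`. The bound is linear in `e`, so that it can later
compensate the large factor of the mollifier. -/
theorem abs_contr_sub_contr_le {G G₀ J : Matrix (Fin n) (Fin n) ℝ} {b e c : ℝ}
    (hG : IsUnit G.det) (hG₀ : IsUnit G₀.det) (h : ∀ i j, |G⁻¹ i j| ≤ b)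
    (h₀ : ∀ i j, |G₀⁻¹ i j| ≤ b) (he : ∀ i j, |(G₀ - G) i j| ≤ e) (hJ : ∀ i j, |J i j| ≤ c) :
    |contr G J - contr G₀ J| ≤ n * (n * (n * (n * (b * e) * b) * c)) := by
  have h1 : G⁻¹ - G₀⁻¹ = G⁻¹ * (G₀ - G) * G₀⁻¹ := by
    rw [Matrix.mul_sub, Matrix.sub_mul, Matrix.mul_assoc, Matrix.mul_nonsing_inv _ hG₀,
      Matrix.nonsing_inv_mul _ hG, Matrix.mul_one, Matrix.one_mul]
  have h2 : contr G J - contr G₀ J = ∑ j, ∑ k, (G⁻¹ * (G₀ - G) * G₀⁻¹) j k * J j k := by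
    rw [← h1, contr, contr, ← Finset.sum_sub_distrib]
    refine Finset.sum_congr rfl fun j _ => ?_
    rw [← Finset.sum_sub_distrib]
    exact Finset.sum_congr rfl fun k _ => by rw [Matrix.sub_apply]; ring
  rw [h2]
  refine abs_sum_fin_le fun j => abs_sum_fin_le fun k => abs_mul_le' ?_ (hJ j k)
  rw [Matrix.mul_apply]
  refine abs_sum_fin_le fun l => abs_mul_le' ?_ (h₀ l k)
  rw [Matrix.mul_apply]
  exact abs_sum_fin_le fun i => abs_mul_le' (h j i) (he i l)

theorem contr_smul (G J : Matrix (Fin n) (Fin n) ℝ) (r : ℝ) :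
    contr G (r • J) = r * contr G J := by
  simp only [contr, Finset.mul_sum, Matrix.smul_apply, smul_eq_mul]
  exact Finset.sum_congr rfl fun j _ => Finset.sum_congr rfl fun k _ => by ring

theorem contr_sub (G J J' : Matrix (Fin n) (Fin n) ℝ) :
    contr G (J - J') = contr G J - contr G J' := by
  simp only [contr, ← Finset.sum_sub_distrib, Matrix.sub_apply, mul_sub]

/-- The zeroth basis vector is a unit vector orthogonal to the others. -/
def Normal {m : ℕ} (B : BL (m + 1)) : Prop := ∀ v, B (bv 0) v = v 0 ∧ B v (bv 0) = v 0

/-- Row zero of the Gram matrix is the standard basis row, and this passes to the inverse. -/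
theorem Normal.inv_zero {m : ℕ} {B : BL (m + 1)} (h : Normal B) (hdet : IsUnit (gram B).det)
    (a : Fin (m + 1)) : (gram B)⁻¹ 0 a = if a = 0 then 1 else 0 := by
  have h1 : ((gram B) * (gram B)⁻¹) 0 a = (gram B)⁻¹ 0 a := by
    rw [Matrix.mul_apply]
    simp only [gram_apply, (h _).1]
    simp
  rw [← h1, Matrix.mul_nonsing_inv _ hdet, Matrix.one_apply]
  simp [eq_comm]

theorem Normal.inv_zero' {m : ℕ} {B : BL (m + 1)} (h : Normal B) (hdet : IsUnit (gram B).det)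
    (a : Fin (m + 1)) : (gram B)⁻¹ a 0 = if a = 0 then 1 else 0 := by
  have h1 : ((gram B)⁻¹ * (gram B)) a 0 = (gram B)⁻¹ a 0 := by
    rw [Matrix.mul_apply]
    simp only [gram_apply, (h _).2]
    simp
  rw [← h1, Matrix.nonsing_inv_mul _ hdet, Matrix.one_apply]

end Inverse

/-! ### Scalar curvature of the smoothed metric in coordinates -/

section Smoothing

variable {m : ℕ}

/-- The data of one side of the hypersurface at a point `y`: the metric coefficients `G` on the
half-space `A`, and the function `k` substituted for the normal coordinate. -/
structure Side (G : E (m + 1) → BL (m + 1)) (A O : Set (E (m + 1))) (k : ℝ → ℝ)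
    (y : E (m + 1)) (I : Set ℝ) (C : ℝ) : Prop where
  uniqueDiffOn : UniqueDiffOn ℝ A
  contDiffOn : ContDiffOn ℝ 2 G A
  maps : ∀ y ∈ O, line y (k (y 0)) ∈ A
  bound : LineBound G A y I C
  mem : k (y 0) ∈ I
  zero_mem : 0 ∈ I
  normal : ∀ y ∈ A, Normal (G y)

theorem Side.nonneg {G : E (m + 1) → BL (m + 1)} {A O : Set (E (m + 1))} {k : ℝ → ℝ}
    {y : E (m + 1)} {I : Set ℝ} {C : ℝ} (h : Side G A O k y I C) : 0 ≤ C :=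
  (norm_nonneg _).trans (h.bound.fderiv_le 0 h.zero_mem)

/-- Pairings with the normal vector are constant on `A`, so the jump of the normal derivative has no
normal components. The curvature estimate needs this of its matrix `J`. -/
theorem Side.fderiv_normal {G : E (m + 1) → BL (m + 1)} {A O : Set (E (m + 1))} {k : ℝ → ℝ}
    {y : E (m + 1)} {I : Set ℝ} {C : ℝ} (h : Side G A O k y I C) (u v : E (m + 1)) :
    fderivWithin ℝ G A (line y 0) u (bv 0) v = 0 := by
  have hmem := h.bound.mem 0 h.zero_mem
  have h1 := ((h.contDiffOn.differentiableOn (by norm_num)) _ hmem).hasFDerivWithinAt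
  have h2 := (h1.clm_apply (hasFDerivWithinAt_const (bv 0) _ A)).clm_apply
    (hasFDerivWithinAt_const v _ A)
  have h3 : HasFDerivWithinAt (fun _ : E (m + 1) => v 0) (0 : E (m + 1) →L[ℝ] ℝ) A (line y 0) :=
    hasFDerivWithinAt_const _ _ _
  have h4 := (h.uniqueDiffOn _ hmem).eq (h3.congr (fun y hy => (h.normal y hy v).1)
    (h.normal _ hmem v).1) h2
  have h5 := congrArg (fun L : E (m + 1) →L[ℝ] ℝ => L u) h4
  simpa using h5.symm

/-- The smoothed metric coefficients. -/
def smoothed (Gm Gp : E (m + 1) → BL (m + 1)) (a h : ℝ → ℝ) (y : E (m + 1)) : BL (m + 1) :=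
  Gm (line y (a (y 0))) + Gp (line y (h (y 0))) - Gm (line y 0)

/-- The reflection of a profile, a smoothing of `t ↦ min t 0`. -/
def reflect (h : ℝ → ℝ) (t : ℝ) : ℝ := - h (-t)

theorem deriv_reflect (h : ℝ → ℝ) : deriv (reflect h) = fun t => deriv h (-t) := by
  funext t
  unfold reflect
  rw [deriv.fun_neg, deriv_comp_neg, neg_neg]

theorem deriv_deriv_reflect (h : ℝ → ℝ) (t : ℝ) :
    deriv (deriv (reflect h)) t = - deriv (deriv h) (-t) := by
  rw [deriv_reflect, deriv_comp_neg]

theorem scaled_reflect (φ : ℝ → ℝ) (δ t : ℝ) :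
    scaled (fun s => φ (-s)) δ (-t) = scaled φ δ t := by
  rw [scaled, scaled]
  congr 2
  ring

/-- Where the mollifier is nonzero, `max t 0` is at most `δ²/100` and the profile exceeds it by at
most `3δ²/100`; the total `4δ²/100` balances the height `100/δ²`. -/
theorem IsProfile.scaled_mul_le {K δ : ℝ} {φ h : ℝ → ℝ} (hφ : IsMollifier φ) (hδ : 0 < δ)
    (hh : IsProfile K φ δ h) (t : ℝ) : |scaled φ δ t| * |h t| ≤ 4 := by
  by_cases ht : δ ^ 2 / 100 ≤ |t|
  · rw [hφ.scaled_eq_zero hδ ht]; simp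
  · rw [not_le] at ht
    have h1 := (abs_le.1 (hh.abs_sub_le t)).2
    have h2 : max t 0 ≤ δ ^ 2 / 100 := max_le ((le_abs_self t).trans ht.le) (by positivity)
    rw [abs_of_nonneg (hφ.scaled_nonneg δ t), abs_of_nonneg (hh.nonneg t)]
    calc scaled φ δ t * h t ≤ 100 / δ ^ 2 * (4 * (δ ^ 2 / 100)) :=
          mul_le_mul (hφ.scaled_le δ t) (by linarith) (hh.nonneg t) (by positivity)
      _ = 4 := by field_simp

theorem abs_apply_bv_le (B : BL (m + 1)) (c d : Fin (m + 1)) : |B (bv c) (bv d)| ≤ ‖B‖ := by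
  have := B.le_opNorm₂ (bv c) (bv d)
  rwa [norm_bv, norm_bv, mul_one, mul_one] at this

set_option maxHeartbeats 1000000 in
/-- The scalar curvature of the smoothed metric. -/
theorem exists_abs_scalarLocal_smoothed_le (m : ℕ) (K C lam : ℝ) (hK : 0 ≤ K) (hlam : 0 < lam) :
    ∃ B : ℝ, ∀ (Gm Gp : E (m + 1) → BL (m + 1)) (Am Ap O : Set (E (m + 1))) (h hm φ : ℝ → ℝ)
      (δ : ℝ) (y : E (m + 1)) (Im Ip : Set ℝ), IsMollifier φ → 0 < δ → IsProfile K φ δ h →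
      IsProfile K (fun t => φ (-t)) δ hm → IsOpen O → y ∈ O →
      Side Gm Am O (reflect hm) y Im C → Side Gp Ap O h y Ip C → (∀ y ∈ O, line y 0 ∈ Am) →
      Gp (line y 0) = Gm (line y 0) → Coercive lam (smoothed Gm Gp (reflect hm) h y) →
      Coercive lam (Gm (line y 0)) →
      |scalarLocal (fun z => gram (smoothed Gm Gp (reflect hm) h z)) y
        + scaled φ δ (y 0) * contr (gram (Gm (line y 0)))
          (gram (fderivWithin ℝ Gp Ap (line y 0) (bv 0)
            - fderivWithin ℝ Gm Am (line y 0) (bv 0)))| ≤ B := by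
  set k1 : ℝ := (1 + K) * C with hk1
  set k2 : ℝ := (1 + K) * (1 + K) * C + (K * C + 4 * C) with hk2
  -- The factors `3` count the three summands of `smoothed`, each contributing at most `k1` to first
  -- and `k2` to second derivatives.
  set K' : ℝ := 1 / lam + 3 * k1 + 3 * k2 with hK'
  obtain ⟨B, hB⟩ := exists_abs_scalarLocal_add_contr_le m K'
  set N : ℝ := ((m + 1 : ℕ) : ℝ) with hN
  -- The second summand pays for replacing the inverse metric at `y` by the one at height zero.
  refine ⟨B + N * (N * (N * (N * (1 / lam * (8 * C)) * (1 / lam)) * (2 * C))),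
    fun Gm Gp Am Ap O h hm φ δ y Im Ip hφ hδ hh hhm hO hy sm sp h0 hag hco hco0 => ?_⟩
  have hC := sm.nonneg
  have hk1n : 0 ≤ k1 := by positivity
  have hk2n : 0 ≤ k2 := by positivity
  have hlam' : 0 < 1 / lam := by positivity
  set ψ := scaled φ δ (y 0) with hψ
  set a := reflect hm with ha
  have hac : ContDiff ℝ 2 a := (hhm.contDiff.comp contDiff_neg).neg
  have hzc : ContDiff ℝ 2 (fun _ : ℝ => (0 : ℝ)) := contDiff_const
  have ψa : |ψ| * |a (y 0)| ≤ 4 := by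
    have := hhm.scaled_mul_le hφ.reflect hδ (-(y 0))
    rw [scaled_reflect] at this
    rwa [ha, reflect, abs_neg]
  have ψh : |ψ| * |h (y 0)| ≤ 4 := hh.scaled_mul_le hφ hδ _
  -- Reflection turns the profile into a concave bend, so its second derivative is close to `-ψ`.
  have ba := sm.bound.derivs_comp_sub (K := K) (ψ := -ψ) sm.uniqueDiffOn sm.contDiffOn hO sm.maps
    hac hy hK sm.mem sm.zero_mem (by rw [ha, deriv_reflect]; exact hhm.abs_deriv_le _) (by
      have h1 := hhm.abs_deriv_deriv_sub_le (-(y 0))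
      rw [scaled_reflect] at h1
      rw [ha, deriv_deriv_reflect, ← abs_neg]
      convert h1 using 2
      ring) (by rw [abs_neg]; exact ψa)
  have bh := sp.bound.derivs_comp_sub (K := K) (ψ := ψ) sp.uniqueDiffOn sp.contDiffOn hO sp.maps
    hh.contDiff hy hK sp.mem sp.zero_mem (hh.abs_deriv_le _) (hh.abs_deriv_deriv_sub_le _) ψh
  -- The term at height zero is also a substitution, with `k = 0` and `ψ = 0`.
  have bz := sm.bound.derivs_comp_sub (K := K) (ψ := 0) (k := fun _ => 0) sm.uniqueDiffOn
    sm.contDiffOn hO h0 hzc hy hK sm.zero_mem sm.zero_mem (by simpa using hK) (by simpa using hK)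
    (by simp)
  have ca : ∀ y ∈ O, ContDiffAt ℝ 2 (fun y => Gm (line y (a (y 0)))) y := fun y hy =>
    contDiffAt_comp_sub sm.contDiffOn hO sm.maps hac hy
  have ch : ∀ y ∈ O, ContDiffAt ℝ 2 (fun y => Gp (line y (h (y 0)))) y := fun y hy =>
    contDiffAt_comp_sub sp.contDiffOn hO sp.maps hh.contDiff hy
  have cz : ∀ y ∈ O, ContDiffAt ℝ 2 (fun y => Gm (line y 0)) y := fun y hy =>
    contDiffAt_comp_sub (k := fun _ => 0) sm.contDiffOn hO h0 hzc hy
  set S := smoothed Gm Gp a h with hS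
  have cS : ContDiffAt ℝ 2 S y := ((ca y hy).add (ch y hy)).sub (cz y hy)
  have two : (2 : ℕ∞ω) ≠ 0 := by norm_num
  have dS : ∀ y ∈ O, fderiv ℝ S y = fderiv ℝ (fun y => Gm (line y (a (y 0)))) y
      + fderiv ℝ (fun y => Gp (line y (h (y 0)))) y - fderiv ℝ (fun y => Gm (line y 0)) y :=
    fun y hy => ((((ca y hy).differentiableAt two).hasFDerivAt.add
      ((ch y hy).differentiableAt two).hasFDerivAt).sub
      ((cz y hy).differentiableAt two).hasFDerivAt).fderiv
  have ddS : fderiv ℝ (fderiv ℝ S) y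
      = fderiv ℝ (fderiv ℝ (fun y => Gm (line y (a (y 0))))) y
      + fderiv ℝ (fderiv ℝ (fun y => Gp (line y (h (y 0))))) y
      - fderiv ℝ (fderiv ℝ (fun y => Gm (line y 0))) y := by
    refine HasFDerivAt.fderiv ?_
    refine (((hasFDerivAt_fderiv (ca y hy)).add (hasFDerivAt_fderiv (ch y hy))).sub
      (hasFDerivAt_fderiv (cz y hy))).congr_of_eventuallyEq ?_
    filter_upwards [hO.mem_nhds hy] with y hy
    exact dS y hy
  set Dm := fderivWithin ℝ Gm Am (line y 0) (bv 0) with hDm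
  set Dp := fderivWithin ℝ Gp Ap (line y 0) (bv 0) with hDp
  have hdet := isUnit_gram (hco.pos hlam)
  have hdet0 := isUnit_gram (hco0.pos hlam)
  have hnorm : Normal (S y) := fun v => by
    have n1 := sm.normal _ (sm.maps y hy) v
    have n2 := sp.normal _ (sp.maps y hy) v
    have n3 := sm.normal _ (h0 y hy) v
    constructor
    · change Gm (line y (a (y 0))) (bv 0) v + Gp (line y (h (y 0))) (bv 0) v
        - Gm (line y 0) (bv 0) v = _
      rw [n1.1, n2.1, n3.1]; ring
    · change Gm (line y (a (y 0))) v (bv 0) + Gp (line y (h (y 0))) v (bv 0)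
        - Gm (line y 0) v (bv 0) = _
      rw [n1.2, n2.2, n3.2]; ring
  -- The unbounded part of the second normal derivatives is `ψ` times the jump of the first normal
  -- derivative across Σ.
  have hmain := hB S y (gram (ψ • (Dp - Dm))) cS hdet
    (fun i j => (hco.abs_inv_le hlam i j).trans (by linarith))
    (fun i c d => by
      refine (abs_apply_bv_le _ c d).trans ?_
      rw [dS y hy]
      refine (norm_sub_le_of_le (norm_add_le_of_le (ba i i).1 (bh i i).1) (bz i i).1).trans ?_
      linarith)
    (fun i j c d => by
      have : fderiv ℝ (fderiv ℝ S) y (bv i) (bv j) (bv c) (bv d)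
          - (if i = 0 ∧ j = 0 then gram (ψ • (Dp - Dm)) c d else 0)
          = (fderiv ℝ (fderiv ℝ S) y (bv i) (bv j)
            - (if i = 0 ∧ j = 0 then ψ • (Dp - Dm) else 0)) (bv c) (bv d) := by
        split_ifs <;> rfl
      rw [this]
      refine (abs_apply_bv_le _ c d).trans ?_
      rw [ddS]
      have e : (if i = 0 ∧ j = 0 then ψ • (Dp - Dm) else 0)
          = (if i = 0 ∧ j = 0 then (-ψ) • Dm else 0) + (if i = 0 ∧ j = 0 then ψ • Dp else 0)
            - (if i = 0 ∧ j = 0 then (0 : ℝ) • Dm else 0) := by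
        split_ifs
        · rw [zero_smul, sub_zero, neg_smul, smul_sub]; abel
        · simp
      rw [e]
      have := norm_sub_le_of_le (norm_add_le_of_le (ba i j).2 (bh i j).2) (bz i j).2
      refine le_trans (le_of_eq ?_) (this.trans (by linarith))
      congr 1
      simp only [sub_apply, add_apply]
      abel)
    (hnorm.inv_zero hdet) (hnorm.inv_zero' hdet)
    (fun i => by
      show ψ • ((Dp - Dm) (bv 0) (bv i)) = 0
      rw [sub_apply, sub_apply, sp.fderiv_normal, sm.fderiv_normal, sub_zero, smul_zero])
  have hgs : gram (ψ • (Dp - Dm)) = ψ • gram (Dp - Dm) := rfl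
  have hdiff : |contr (gram (S y)) (ψ • gram (Dp - Dm))
      - contr (gram (Gm (line y 0))) (ψ • gram (Dp - Dm))|
      ≤ N * (N * (N * (N * (1 / lam * (8 * C)) * (1 / lam)) * (2 * C))) := by
    have hd1 : ‖S y - Gm (line y 0)‖ ≤ C * |a (y 0)| + C * |h (y 0)| := by
      have e : S y - Gm (line y 0) = (Gm (line y (a (y 0))) - Gm (line y 0))
          + (Gp (line y (h (y 0))) - Gp (line y 0)) := by
        rw [hag, hS, smoothed]; abel
      rw [e]
      refine norm_add_le_of_le ?_ ?_
      · simpa using sm.bound.norm_sub_le sm.contDiffOn sm.mem sm.zero_mem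
      · simpa using sp.bound.norm_sub_le sp.contDiffOn sp.mem sp.zero_mem
    have hd2 : |ψ| * ‖S y - Gm (line y 0)‖ ≤ 8 * C := by
      calc |ψ| * ‖S y - Gm (line y 0)‖ ≤ |ψ| * (C * |a (y 0)| + C * |h (y 0)|) :=
            mul_le_mul_of_nonneg_left hd1 (abs_nonneg _)
        _ = C * (|ψ| * |a (y 0)|) + C * (|ψ| * |h (y 0)|) := by ring
        _ ≤ C * 4 + C * 4 := by gcongr
        _ = 8 * C := by ring
    -- Division by `|ψ|` comes next; without the mollifier both contractions vanish.
    by_cases hψ0 : ψ = 0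
    · rw [hψ0, zero_smul]
      have : contr (gram (S y)) 0 - contr (gram (Gm (line y 0))) 0 = 0 := by simp [contr]
      rw [this, abs_zero]
      positivity
    · have hψp : 0 < |ψ| := abs_pos.2 hψ0
      have hX : ∀ i j, |gram (Dp - Dm) i j| ≤ 2 * C := fun i j => by
        refine (abs_apply_bv_le _ i j).trans ?_
        have hbm : ‖Dm‖ ≤ C := by
          refine (ContinuousLinearMap.le_opNorm _ _).trans ?_
          rw [norm_bv, mul_one]
          exact sm.bound.fderiv_le 0 sm.zero_mem
        have hbp : ‖Dp‖ ≤ C := by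
          refine (ContinuousLinearMap.le_opNorm _ _).trans ?_
          rw [norm_bv, mul_one]
          exact sp.bound.fderiv_le 0 sp.zero_mem
        exact (norm_sub_le_of_le hbp hbm).trans (by linarith)
      -- The metrics at `y` and at height zero differ by at most `8C/|ψ|`, so the factor `|ψ|` in
      -- front cancels.
      have := abs_contr_sub_contr_le (J := gram (Dp - Dm)) (e := 8 * C / |ψ|) hdet hdet0
        (hco.abs_inv_le hlam) (hco0.abs_inv_le hlam) (fun i j => by
          rw [le_div_iff₀ hψp, mul_comm]
          refine le_trans (mul_le_mul_of_nonneg_left ?_ hψp.le) hd2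
          rw [norm_sub_rev]
          exact abs_apply_bv_le (Gm (line y 0) - S y) i j) hX
      rw [contr_smul, contr_smul, ← mul_sub, abs_mul]
      calc |ψ| * |contr (gram (S y)) (gram (Dp - Dm))
              - contr (gram (Gm (line y 0))) (gram (Dp - Dm))|
          ≤ |ψ| * (N * (N * (N * (N * (1 / lam * (8 * C / |ψ|)) * (1 / lam)) * (2 * C)))) :=
            mul_le_mul_of_nonneg_left this hψp.le
        _ = N * (N * (N * (N * (1 / lam * (8 * C)) * (1 / lam)) * (2 * C))) := by
            field_simp
  rw [hgs] at hmain
  have : scalarLocal (fun z => gram (S z)) y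
        + ψ * contr (gram (Gm (line y 0))) (gram (Dp - Dm))
      = (scalarLocal (fun z => gram (S z)) y + contr (gram (S y)) (ψ • gram (Dp - Dm)))
        - (contr (gram (S y)) (ψ • gram (Dp - Dm))
          - contr (gram (Gm (line y 0))) (ψ • gram (Dp - Dm))) := by
    rw [contr_smul (gram (Gm (line y 0)))]; ring
  rw [this]
  exact (abs_sub _ _).trans (add_le_add hmain hdiff)

end Smoothing

/-! ### Components of bilinear fields in charts -/

section Manifold

variable {n : ℕ} {N : Type*} [TopologicalSpace N] [ChartedSpace (E n) N]

/-- The value of a bilinear field, as a form on the model space. -/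
def BilinField.form (g : BilinField n N) (p : N) : BL n := g p

/-- The bilinear form of components of `g` in the coordinates given by a chart `e`. -/
def compB (e : OpenPartialHomeomorph N (E n)) (g : BilinField n N) (y : E n) : BL n :=
  pullback (g (e.symm y)) (mfderiv 𝓘(ℝ, E n) 𝓘(ℝ, E n) e.symm y)

theorem components_eq_gram (e : OpenPartialHomeomorph N (E n)) (g : BilinField n N) :
    components e g = fun y => gram (compB e g y) := rfl

/-- A field of bilinear forms is `C²` at the points of `s`. -/
abbrev SectionOn [IsManifold 𝓘(ℝ, E n) 1 N] (g : BilinField n N) (s : Set N) : Prop :=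
  ContMDiffOn 𝓘(ℝ, E n) (𝓘(ℝ, E n).prod 𝓘(ℝ, E n →L[ℝ] E n →L[ℝ] ℝ)) 2
    (fun p => Bundle.TotalSpace.mk' (E n →L[ℝ] E n →L[ℝ] ℝ)
      (E := fun p : N => TangentSpace 𝓘(ℝ, E n) p →L[ℝ] TangentSpace 𝓘(ℝ, E n) p →L[ℝ] ℝ)
      p (g p)) s

/-- The tangent map of a C³ map is C², so pulling back a C² section stays C². `F` is differentiated
within `A`, which may have boundary, while the section need only be C² on a set containing the image
of `B`. -/
theorem contDiffOn_pullback_apply [IsManifold 𝓘(ℝ, E n) 3 N] [IsManifold 𝓘(ℝ, E n) 1 N] {k : ℕ}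
    {g : BilinField n N} {s : Set N} (hg : SectionOn g s) {F : E k → N} {A B : Set (E k)}
    (hA : UniqueDiffOn ℝ A) (hF : ContMDiffOn 𝓘(ℝ, E k) 𝓘(ℝ, E n) 3 F A) (hBA : B ⊆ A)
    (hB : MapsTo F B s) (v w : E k) :
    ContDiffOn ℝ 2 (fun y => g (F y) (mfderivWithin 𝓘(ℝ, E k) 𝓘(ℝ, E n) F A y v)
      (mfderivWithin 𝓘(ℝ, E k) 𝓘(ℝ, E n) F A y w)) B := by
  have hT := hF.contMDiffOn_tangentMapWithin (m := 2) (by norm_num)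
    (uniqueMDiffOn_iff_uniqueDiffOn.2 hA)
  have hvec : ∀ v : E k, ContMDiffOn 𝓘(ℝ, E k) 𝓘(ℝ, E n).tangent 2
      (fun y => Bundle.TotalSpace.mk' (E n) (F y)
        (mfderivWithin 𝓘(ℝ, E k) 𝓘(ℝ, E n) F A y v : TangentSpace 𝓘(ℝ, E n) (F y))) B :=
      fun v => by
    have h1 : ContMDiffOn 𝓘(ℝ, E k) 𝓘(ℝ, E k).tangent 2
        (fun y : E k => (Bundle.TotalSpace.mk' (E k) y (v : TangentSpace 𝓘(ℝ, E k) y) :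
          TangentBundle 𝓘(ℝ, E k) (E k))) B :=
      contMDiffOn_vectorSpace_iff_contDiffOn.2 contDiffOn_const
    exact hT.comp h1 fun y hy => hBA hy
  have hFB : ContMDiffOn 𝓘(ℝ, E k) 𝓘(ℝ, E n) 2 F B :=
    (hF.mono hBA).of_le (by norm_num)
  rw [← contMDiffOn_iff_contDiffOn]
  intro x hx
  have : ContMDiffWithinAt 𝓘(ℝ, E k) (𝓘(ℝ, E n).prod 𝓘(ℝ, ℝ)) 2
      (fun y ↦ Bundle.TotalSpace.mk' ℝ (E := Bundle.Trivial N ℝ) (F y)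
        (g (F y) (mfderivWithin 𝓘(ℝ, E k) 𝓘(ℝ, E n) F A y v)
      (mfderivWithin 𝓘(ℝ, E k) 𝓘(ℝ, E n) F A y w))) B x := by
    apply ContMDiffWithinAt.clm_bundle_apply₂ (F₁ := E n) (F₂ := E n)
    · exact (hg.comp hFB hB) x hx
    · exact hvec v x hx
    · exact hvec w x hx
  simp only [Bundle.contMDiffWithinAt_totalSpace] at this
  exact this.2

/-- The tangent bundle is trivialized over the preferred chart by the differential of that chart, so
the section reads there as `compB` composed with the chart. -/
theorem contMDiffAt_section_of_compB [IsManifold 𝓘(ℝ, E n) 3 N] [IsManifold 𝓘(ℝ, E n) 1 N]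
    {g : BilinField n N} {p : N}
    (h : ContDiffAt ℝ 2 (compB (chartAt (E n) p) g) (chartAt (E n) p p)) :
    ContMDiffAt 𝓘(ℝ, E n) (𝓘(ℝ, E n).prod 𝓘(ℝ, E n →L[ℝ] E n →L[ℝ] ℝ)) 2
    (fun p => Bundle.TotalSpace.mk' (E n →L[ℝ] E n →L[ℝ] ℝ)
      (E := fun p : N => TangentSpace 𝓘(ℝ, E n) p →L[ℝ] TangentSpace 𝓘(ℝ, E n) p →L[ℝ] ℝ)
      p (g p)) p := by
  rw [contMDiffAt_hom_bundle]
  refine ⟨contMDiffAt_id, ?_⟩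
  have hc : ContMDiffAt 𝓘(ℝ, E n) 𝓘(ℝ, E n) 2 (chartAt (E n) p) p :=
    ((contMDiffAt_of_mem_maximalAtlas (I := 𝓘(ℝ, E n)) (n := 3)
      (IsManifold.chart_mem_maximalAtlas p)) (mem_chart_source _ p)).of_le (by norm_num)
  have h2 := h.contMDiffAt.comp p hc
  refine h2.congr_of_eventuallyEq ?_
  filter_upwards [(chartAt (E n) p).open_source.mem_nhds (mem_chart_source _ p)] with x hx
  ext v w
  have hx' : x ∈ (trivializationAt (E n) (TangentSpace 𝓘(ℝ, E n)) p).baseSet := by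
    rwa [TangentBundle.trivializationAt_baseSet]
  rw [inCoordinates_apply_eq₂ hx' hx' (Set.mem_univ _)]
  simp only [Bundle.Trivial.fiberBundle_trivializationAt', Bundle.Trivial.linearMapAt_trivialization]
  have hs : ∀ u : E n, (trivializationAt (E n) (TangentSpace 𝓘(ℝ, E n)) p).symm x u
      = mfderiv 𝓘(ℝ, E n) 𝓘(ℝ, E n) (chartAt (E n) p).symm (chartAt (E n) p x) u := fun u => by
    have := TangentBundle.symmL_trivializationAt (I := 𝓘(ℝ, E n)) hx
    have h2 := congrArg (fun L : E n →L[ℝ] TangentSpace 𝓘(ℝ, E n) x => L u) this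
    refine (Bundle.Trivialization.symmL_apply (R := ℝ) _ hx' u).symm.trans ?_
    simp only [mfld_simps] at h2
    exact h2
  rw [hs, hs]
  change _ = g ((chartAt (E n) p).symm (chartAt (E n) p x)) _ _
  have hxx := (chartAt (E n) p).left_inv hx
  -- Fibres over equal points have to be identified; evaluating on vectors of the model space makes
  -- this a substitution.
  have key : ∀ (q : N) (hq : q = x) (a b : E n), g x a b = g q a b := fun q hq a b => by
    subst hq; rfl
  exact key _ hxx _ _

theorem contDiffAt_transition [IsManifold 𝓘(ℝ, E n) 3 N]
    {e e' : OpenPartialHomeomorph N (E n)} (he : e ∈ atlas (E n) N) (he' : e' ∈ atlas (E n) N)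
    {y : E n} (hy : y ∈ e.target) (hy' : e.symm y ∈ e'.source) :
    ContDiffAt ℝ 3 (e' ∘ e.symm) y := by
  have h1 := contMDiffOn_symm_of_mem_maximalAtlas (I := 𝓘(ℝ, E n)) (n := 3)
    (IsManifold.subset_maximalAtlas he)
  have h2 := contMDiffAt_of_mem_maximalAtlas (I := 𝓘(ℝ, E n)) (n := 3)
    (IsManifold.subset_maximalAtlas he') hy'
  exact (h2.comp y ((h1 y hy).contMDiffAt (e.open_target.mem_nhds hy))).contDiffAt

/-- Change of chart for the components of a bilinear field. -/
theorem compB_eq_pullback [IsManifold 𝓘(ℝ, E n) 3 N] [IsManifold 𝓘(ℝ, E n) 1 N]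
    (g : BilinField n N)
    {e e' : OpenPartialHomeomorph N (E n)} (he : e ∈ atlas (E n) N) (he' : e' ∈ atlas (E n) N)
    {y : E n} (hy : y ∈ e.target) (hy' : e.symm y ∈ e'.source) :
    compB e g y = pullback (compB e' g (e' (e.symm y))) (fderiv ℝ (e' ∘ e.symm) y) := by
  have h1 : MDifferentiableAt 𝓘(ℝ, E n) 𝓘(ℝ, E n) e'.symm (e' (e.symm y)) :=
    mdifferentiableAt_atlas_symm he' (e'.map_source hy')
  have h2 : DifferentiableAt ℝ (e' ∘ e.symm) y :=
    (contDiffAt_transition he he' hy hy').differentiableAt (by norm_num)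
  have h3 : e.symm =ᶠ[𝓝 y] e'.symm ∘ (e' ∘ e.symm) := by
    filter_upwards [e.symm.continuousAt hy (e'.open_source.mem_nhds hy')] with z hz
    exact (e'.left_inv hz).symm
  have h4 := mfderiv_comp y (g := e'.symm) (f := e' ∘ e.symm) h1 h2.mdifferentiableAt
  have h5 := h3.mfderiv_eq (I := 𝓘(ℝ, E n)) (I' := 𝓘(ℝ, E n))
  rw [mfderiv_eq_fderiv] at h4
  change pullback (g.form (e.symm y)) (mfderiv 𝓘(ℝ, E n) 𝓘(ℝ, E n) e.symm y : E n →L[ℝ] E n)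
    = pullback (pullback (g.form (e'.symm (e' (e.symm y))))
      (mfderiv 𝓘(ℝ, E n) 𝓘(ℝ, E n) e'.symm (e' (e.symm y)) : E n →L[ℝ] E n)) _
  rw [e'.left_inv hy']
  exact congrArg (fun L : E n →L[ℝ] E n => pullback (g.form (e.symm y)) L) (h5.trans h4)

theorem fderiv_transition_comp [IsManifold 𝓘(ℝ, E n) 3 N]
    {e e' : OpenPartialHomeomorph N (E n)} (he : e ∈ atlas (E n) N) (he' : e' ∈ atlas (E n) N)
    {p : N} (hp : p ∈ e.source) (hp' : p ∈ e'.source) :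
    fderiv ℝ (e ∘ e'.symm) (e' p) ∘L fderiv ℝ (e' ∘ e.symm) (e p)
      = ContinuousLinearMap.id ℝ (E n) := by
  have hy : e.symm (e p) = p := e.left_inv hp
  have hy' : e'.symm (e' p) = p := e'.left_inv hp'
  have h1 : DifferentiableAt ℝ (e' ∘ e.symm) (e p) :=
    (contDiffAt_transition he he' (e.map_source hp) (by rwa [hy])).differentiableAt (by norm_num)
  have h2 : DifferentiableAt ℝ (e ∘ e'.symm) (e' p) :=
    (contDiffAt_transition he' he (e'.map_source hp') (by rwa [hy'])).differentiableAt (by norm_num)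
  have h3 : (e' ∘ e.symm) (e p) = e' p := by simp [hy]
  have h4 : (e ∘ e'.symm) ∘ (e' ∘ e.symm) =ᶠ[𝓝 (e p)] id := by
    filter_upwards [e.symm.continuousAt (x := e p) (e.map_source hp)
      (e'.open_source.mem_nhds (by rwa [hy])), e.open_target.mem_nhds (e.map_source hp)]
      with z hz hz'
    simp only [Function.comp_apply, id]
    rw [e'.left_inv hz, e.right_inv hz']
  rw [← h3] at h2 ⊢
  rw [← fderiv_comp _ h2 h1, h4.fderiv_eq, fderiv_id]

/-- The scalar curvature does not depend on the chart. -/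
theorem scalarLocal_components_eq [IsManifold 𝓘(ℝ, E n) 3 N] [IsManifold 𝓘(ℝ, E n) 1 N]
    {g : BilinField n N} (hsymm : ∀ p (v w : E n), g p v w = g p w v)
    (hpos : ∀ p (v : E n), v ≠ 0 → 0 < g p v v)
    {e e' : OpenPartialHomeomorph N (E n)} (he : e ∈ atlas (E n) N) (he' : e' ∈ atlas (E n) N)
    {p : N} (hp : p ∈ e.source) (hp' : p ∈ e'.source)
    (hg : ContDiffAt ℝ 2 (compB e' g) (e' p)) :
    scalarLocal (components e g) (e p) = scalarLocal (components e' g) (e' p) := by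
  have hy : e.symm (e p) = p := e.left_inv hp
  have h3 : (e' ∘ e.symm) (e p) = e' p := by simp [hy]
  let L : E n ≃L[ℝ] E n := ContinuousLinearEquiv.equivOfInverse (fderiv ℝ (e' ∘ e.symm) (e p))
    (fderiv ℝ (e ∘ e'.symm) (e' p))
    (fun v => congrArg (fun L : E n →L[ℝ] E n => L v) (fderiv_transition_comp he he' hp hp'))
    (fun v => congrArg (fun L : E n →L[ℝ] E n => L v) (fderiv_transition_comp he' he hp' hp))
  rw [components_eq_gram, components_eq_gram]
  have := scalarLocal_pullback (G := compB e' g) (Gt := compB e g) (Ψ := e' ∘ e.symm) (z := e p) L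
    (contDiffAt_transition he he' (e.map_source hp) (by rwa [hy])) rfl (by rwa [h3])
    (Eventually.of_forall fun y v w => hsymm _ _ _) ?_ ?_
  · rw [this, h3]
  · rw [h3]
    filter_upwards [e'.open_target.mem_nhds (e'.map_source hp')] with y hy v hv
    refine hpos _ _ fun h0 => hv ?_
    have := (mdifferentiable_of_mem_atlas (I := 𝓘(ℝ, E n)) he').comp_symm_deriv hy
    have h7 := congrArg (fun L : E n →L[ℝ] E n => L v) this
    change mfderiv 𝓘(ℝ, E n) 𝓘(ℝ, E n) e' (e'.symm y)
      (mfderiv 𝓘(ℝ, E n) 𝓘(ℝ, E n) e'.symm y v : E n) = v at h7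
    rw [← h7]
    exact (congrArg _ h0).trans (map_zero _)
  · filter_upwards [e.symm.continuousAt (x := e p) (e.map_source hp)
      (e'.open_source.mem_nhds (by rwa [hy])), e.open_target.mem_nhds (e.map_source hp)]
      with z hz hz'
    exact compB_eq_pullback g he he' hz' hz

end Manifold

/-- The quadratic forms attain a positive minimum on the compact set `K ×` unit sphere; homogeneity
extends the bound to all vectors. -/
theorem exists_coercive {n : ℕ} {X : Type*} [TopologicalSpace X] {G : X → BL n} {K : Set X}
    (hK : IsCompact K) (hG : ContinuousOn G K) (hpos : ∀ x ∈ K, ∀ v, v ≠ 0 → 0 < G x v v) :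
    ∃ lam > 0, ∀ x ∈ K, Coercive lam (G x) := by
  have hS : IsCompact (K ×ˢ Metric.sphere (0 : E n) 1) := hK.prod (isCompact_sphere _ _)
  have hc : ContinuousOn (fun p : X × E n => G p.1 p.2 p.2) (K ×ˢ Metric.sphere (0 : E n) 1) := by
    have h1 : ContinuousOn (fun p : X × E n => G p.1) (K ×ˢ Metric.sphere (0 : E n) 1) :=
      hG.comp continuousOn_fst fun p hp => hp.1
    exact (h1.clm_apply continuousOn_snd).clm_apply continuousOn_snd
  have main : ∃ lam > 0, ∀ p ∈ K ×ˢ Metric.sphere (0 : E n) 1, lam ≤ G p.1 p.2 p.2 := by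
    rcases (K ×ˢ Metric.sphere (0 : E n) 1).eq_empty_or_nonempty with h | h
    · exact ⟨1, one_pos, by simp [h]⟩
    · obtain ⟨p, hp, hmin⟩ := hS.exists_isMinOn h hc
      refine ⟨G p.1 p.2 p.2, hpos _ hp.1 _ fun h0 => ?_, fun q hq => hmin hq⟩
      have := hp.2
      simp [h0] at this
  obtain ⟨lam, hlam, h⟩ := main
  refine ⟨lam, hlam, fun x hx v => ?_⟩
  by_cases hv : v = 0
  · simp [hv]
  · have hv' : ‖v‖ ≠ 0 := norm_ne_zero_iff.2 hv
    have h1 := h (x, ‖v‖⁻¹ • v) ⟨hx, by simp [norm_smul, hv']⟩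
    simp only [map_smul, smul_apply, smul_eq_mul] at h1
    calc lam * ‖v‖ ^ 2 ≤ (‖v‖⁻¹ * (‖v‖⁻¹ * G x v v)) * ‖v‖ ^ 2 := by gcongr
      _ = G x v v := by field_simp

/-- A positive definite form on a finite-dimensional space is coercive. Boundedness of its unit ball
is part of the data of a Riemannian metric. -/
theorem isVonNBounded_of_pos {n : ℕ} {B : BL n} (hB : ∀ v, v ≠ 0 → 0 < B v v) :
    Bornology.IsVonNBounded ℝ {v : E n | B v v < 1} := by
  obtain ⟨lam, hlam, h⟩ := exists_coercive (G := fun _ : Unit => B) (K := univ) isCompact_univ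
    continuousOn_const (fun _ _ => hB)
  have h1 := h () (mem_univ _)
  refine (NormedSpace.isVonNBounded_ball ℝ (E n) (1 + 1 / lam)).subset fun v hv => ?_
  have h2 := (h1 v).trans_lt hv
  rw [mem_ball_zero_iff]
  have h3 : ‖v‖ ^ 2 < 1 / lam := by rw [lt_div_iff₀ hlam]; linarith
  by_contra! h4
  have h5 : 0 < 1 / lam := by positivity
  nlinarith

theorem pullback_comp {V W X : Type*} [AddCommGroup V] [Module ℝ V] [TopologicalSpace V]
    [IsTopologicalAddGroup V] [ContinuousSMul ℝ V] [AddCommGroup W] [Module ℝ W]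
    [TopologicalSpace W] [IsTopologicalAddGroup W] [ContinuousSMul ℝ W]
    [AddCommGroup X] [Module ℝ X] [TopologicalSpace X] [IsTopologicalAddGroup X]
    [ContinuousSMul ℝ X] (β : X →L[ℝ] X →L[ℝ] ℝ) (L : W →L[ℝ] X) (L' : V →L[ℝ] W) :
    pullback (pullback β L) L' = pullback β (L ∘L L') := rfl

/-! ### Linear coordinates on the collar -/

namespace Collar

section Coord

variable {m : ℕ}

theorem coord_zero (q : E m × ℝ) : coord m q 0 = q.2 := rfl

theorem coord_succ (q : E m × ℝ) (i : Fin m) : coord m q i.succ = q.1 i := rfl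

theorem coord_symm_snd (y : E (m + 1)) : ((coord m).symm y).2 = y 0 := by
  conv_rhs => rw [← (coord m).apply_symm_apply y]
  rw [coord_zero]

theorem coord_bv_zero : coord m (0, 1) = bv 0 := by
  ext i
  refine Fin.cases ?_ (fun i => ?_) i
  · simp [coord_zero]
  · simp [coord_succ]

theorem coord_bv_succ (i : Fin m) : coord m (bv i, 0) = bv i.succ := by
  ext j
  refine Fin.cases ?_ (fun j => ?_) j
  · simp [coord_zero]
  · simp [coord_succ]

theorem coord_symm_bv_zero : (coord m).symm (bv 0) = (0, 1) := by
  rw [← coord_bv_zero, ContinuousLinearEquiv.symm_apply_apply]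

theorem coord_symm_line (y : E (m + 1)) (s : ℝ) :
    (coord m).symm (line y s) = (((coord m).symm y).1, s) := by
  rw [line, map_add, map_smul, coord_symm_bv_zero]
  ext1
  · simp
  · simp [coord_symm_snd]

end Coord

variable {m : ℕ} {M S : Type*} [TopologicalSpace M] [ChartedSpace (E (m + 1)) M]
  [TopologicalSpace S] [ChartedSpace (E m) S]

/-- The points with `c`-coordinate in the domain of `c` and height in `J`. -/
def box (c : OpenPartialHomeomorph S (E m)) (J : Set ℝ) : Set (E (m + 1)) :=
  {y | ((coord m).symm y).1 ∈ c.target ∧ y 0 ∈ J}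

omit [ChartedSpace (E m) S] in
theorem line_mem_box {c : OpenPartialHomeomorph S (E m)} {J J' : Set ℝ} {y : E (m + 1)}
    (hy : y ∈ box c J) {s : ℝ} (hs : s ∈ J') : line y s ∈ box c J' := by
  refine ⟨?_, ?_⟩
  · rw [coord_symm_line]
    exact hy.1
  · rwa [line_zero_coord]

omit [ChartedSpace (E m) S] in
theorem box_eq (c : OpenPartialHomeomorph S (E m)) (J : Set ℝ) :
    box c J = (coord m).symm ⁻¹' (c.target ×ˢ J) := by
  ext y
  rw [mem_preimage, mem_prod, coord_symm_snd]
  rfl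

omit [ChartedSpace (E m) S] in
theorem uniqueDiffOn_box (c : OpenPartialHomeomorph S (E m)) {J : Set ℝ} (hJ : UniqueDiffOn ℝ J) :
    UniqueDiffOn ℝ (box c J) := by
  rw [box_eq]
  exact ((coord m).symm.uniqueDiffOn_preimage_iff).2 (c.open_target.uniqueDiffOn.prod hJ)

omit [ChartedSpace (E m) S] in
theorem isOpen_box (c : OpenPartialHomeomorph S (E m)) {J : Set ℝ} (hJ : IsOpen J) :
    IsOpen (box c J) := by
  rw [box_eq]
  exact (c.open_target.prod hJ).preimage (coord m).symm.continuous

/-- The point of `Σ × ℝ` with coordinates `y`. -/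
def param (c : OpenPartialHomeomorph S (E m)) (y : E (m + 1)) : S × ℝ :=
  (c.symm ((coord m).symm y).1, y 0)

omit [ChartedSpace (E m) S] in
theorem param_line (c : OpenPartialHomeomorph S (E m)) (y : E (m + 1)) (s : ℝ) :
    param c (line y s) = ((param c y).1, s) := by
  rw [param, coord_symm_line, line_zero_coord]
  rfl

/-- The differential of the inverse of a chart of `Σ`. -/
def dSymm (c : OpenPartialHomeomorph S (E m)) (z : E m) : E m →L[ℝ] E m :=
  mfderiv 𝓘(ℝ, E m) 𝓘(ℝ, E m) c.symm z

/-- The differential of `param`, followed by the linear identification with `ℝᵐ⁺¹`. -/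
def dParam (c : OpenPartialHomeomorph S (E m)) (y : E (m + 1)) : E (m + 1) →L[ℝ] E (m + 1) :=
  (coord m : (E m × ℝ) →L[ℝ] E (m + 1)) ∘L
    ((dSymm c ((coord m).symm y).1 ∘L
      (ContinuousLinearMap.fst ℝ (E m) ℝ)).prod (ContinuousLinearMap.snd ℝ (E m) ℝ)) ∘L
    ((coord m).symm : E (m + 1) →L[ℝ] E m × ℝ)

/-- The chart of Σ acts on the tangential coordinates only. Therefore substituting a function for
the height commutes with passing to chart components. -/
theorem dParam_line (c : OpenPartialHomeomorph S (E m)) (y : E (m + 1)) (s : ℝ) :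
    dParam c (line y s) = dParam c y := by
  rw [dParam, coord_symm_line]
  rfl

theorem dParam_apply (c : OpenPartialHomeomorph S (E m)) (y v : E (m + 1)) :
    dParam c y v = coord m (dSymm c ((coord m).symm y).1 ((coord m).symm v).1,
      ((coord m).symm v).2) := rfl

theorem dParam_apply_zero (c : OpenPartialHomeomorph S (E m)) (y v : E (m + 1)) :
    dParam c y v 0 = v 0 := by
  rw [dParam_apply, coord_zero, coord_symm_snd]

theorem dParam_bv_zero (c : OpenPartialHomeomorph S (E m)) (y : E (m + 1)) :
    dParam c y (bv 0) = bv 0 := by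
  rw [dParam_apply, coord_symm_bv_zero, ← coord_bv_zero, map_zero]

variable [IsManifold 𝓘(ℝ, E m) ∞ S]

theorem dParam_injective {c : OpenPartialHomeomorph S (E m)} (hc : c ∈ atlas (E m) S)
    {y : E (m + 1)} (hy : ((coord m).symm y).1 ∈ c.target) {v : E (m + 1)}
    (hv : dParam c y v = 0) : v = 0 := by
  rw [dParam_apply, ContinuousLinearEquiv.map_eq_zero_iff, Prod.mk_eq_zero] at hv
  have : IsManifold 𝓘(ℝ, E m) 1 S := inferInstance
  have h := (mdifferentiable_of_mem_atlas (I := 𝓘(ℝ, E m)) hc).comp_symm_deriv hy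
  have h7 := congrArg (fun L : E m →L[ℝ] E m => L ((coord m).symm v).1) h
  change (mfderiv 𝓘(ℝ, E m) 𝓘(ℝ, E m) c (c.symm ((coord m).symm y).1) : E m →L[ℝ] E m)
      (dSymm c ((coord m).symm y).1 ((coord m).symm v).1) = ((coord m).symm v).1 at h7
  have h8 := h7.symm.trans ((congrArg _ hv.1).trans (map_zero
    (mfderiv 𝓘(ℝ, E m) 𝓘(ℝ, E m) c (c.symm ((coord m).symm y).1) : E m →L[ℝ] E m)))
  rw [← (coord m).symm.map_eq_zero_iff]
  exact Prod.ext h8 hv.2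

theorem hasMFDerivAt_param {c : OpenPartialHomeomorph S (E m)} (hc : c ∈ atlas (E m) S)
    {y : E (m + 1)} (hy : ((coord m).symm y).1 ∈ c.target) :
    HasMFDerivAt 𝓘(ℝ, E (m + 1)) (𝓘(ℝ, E m).prod 𝓘(ℝ, ℝ)) (param c) y
      (((coord m).symm : E (m + 1) →L[ℝ] E m × ℝ) ∘L dParam c y) := by
  have : IsManifold 𝓘(ℝ, E m) 1 S := inferInstance
  have h1 := (mdifferentiableAt_atlas_symm (I := 𝓘(ℝ, E m)) hc hy).hasMFDerivAt
  have h2 : HasFDerivAt (fun y : E (m + 1) => ((coord m).symm y).1)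
      ((ContinuousLinearMap.fst ℝ (E m) ℝ) ∘L ((coord m).symm : E (m + 1) →L[ℝ] E m × ℝ)) y :=
    ((ContinuousLinearMap.fst ℝ (E m) ℝ) ∘L
      ((coord m).symm : E (m + 1) →L[ℝ] E m × ℝ)).hasFDerivAt
  have h3 : HasFDerivAt (fun y : E (m + 1) => y 0)
      ((ContinuousLinearMap.snd ℝ (E m) ℝ) ∘L ((coord m).symm : E (m + 1) →L[ℝ] E m × ℝ)) y := by
    have : (fun y : E (m + 1) => y 0) = fun y => ((coord m).symm y).2 :=
      funext fun y => (coord_symm_snd y).symm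
    rw [this]
    exact ((ContinuousLinearMap.snd ℝ (E m) ℝ) ∘L
      ((coord m).symm : E (m + 1) →L[ℝ] E m × ℝ)).hasFDerivAt
  have h4 := (HasMFDerivAt.comp y h1 h2.hasMFDerivAt).prodMk h3.hasMFDerivAt
  exact h4

end Collar

/-! ### The two halves of the collar -/

namespace Collar

variable {m : ℕ} {M S : Type*} [TopologicalSpace M] [ChartedSpace (E (m + 1)) M]
  [TopologicalSpace S] [ChartedSpace (E m) S] {D : Domain m M S} (C : Collar D)

/-- The differential at `q` of the half of the collar with heights in `J`. -/
def dHalf (J : Set ℝ) (q : S × ℝ) : (E m × ℝ) →L[ℝ] E (m + 1) :=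
  mfderivWithin (𝓘(ℝ, E m).prod 𝓘(ℝ, ℝ)) 𝓘(ℝ, E (m + 1)) C.Φ (univ ×ˢ J) q

/-- One half of a Gaussian collar: the heights in `J` correspond to the side `s` of `Σ`, which
carries the metric `g`. -/
structure IsHalf [IsManifold 𝓘(ℝ, E (m + 1)) 1 M] (g : BilinField (m + 1) M) (s : Set M)
    (J : Set ℝ) : Prop where
  convex : Convex ℝ J
  interior_nonempty : (interior J).Nonempty
  zero_mem : 0 ∈ J
  subset : J ⊆ Ioo (-(2 * C.ε)) (2 * C.ε)
  contMDiffOn : ContMDiffOn (𝓘(ℝ, E m).prod 𝓘(ℝ, ℝ)) 𝓘(ℝ, E (m + 1)) 3 C.Φ (univ ×ˢ J)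
  contMDiffOn_symm : ContMDiffOn 𝓘(ℝ, E (m + 1)) (𝓘(ℝ, E m).prod 𝓘(ℝ, ℝ)) 3 C.Φ.symm
    (C.Φ.target ∩ s)
  mem : ∀ x, ∀ t ∈ J, C.Φ (x, t) ∈ s
  of_mem : ∀ x, ∀ t ∈ Ioo (-(2 * C.ε)) (2 * C.ε), C.Φ (x, t) ∈ s → t ∈ J
  metric : IsMetricOn g s
  gaussian : ∀ x, ∀ t ∈ J, ∀ (v w : E m) (a b : ℝ),
    g.form (C.Φ (x, t)) (C.dHalf J (x, t) (v, a)) (C.dHalf J (x, t) (w, b))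
      = g.form (C.Φ (x, t)) (C.dHalf J (x, t) (v, 0)) (C.dHalf J (x, t) (w, 0)) + a * b

/-- The heights of the inner half of the collar. -/
def heightsMinus : Set ℝ := Ioc (-(2 * C.ε)) 0

/-- The heights of the outer half of the collar. -/
def heightsPlus : Set ℝ := Ico 0 (2 * C.ε)

theorem mem_closure_of_nonpos (x : S) {t : ℝ} (ht : t ∈ C.heightsMinus) :
    C.Φ (x, t) ∈ closure D.Ω := by
  rcases eq_or_lt_of_le ht.2 with h | h
  · rw [h, C.zero]
    exact frontier_subset_closure (D.range_ι ▸ mem_range_self x)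
  · exact subset_closure (C.neg x t ⟨ht.1, h⟩)

theorem notMem_of_nonneg (x : S) {t : ℝ} (ht : t ∈ C.heightsPlus) : C.Φ (x, t) ∈ D.Ωᶜ := by
  rcases eq_or_lt_of_le ht.1 with h | h
  · rw [← h, C.zero]
    have : D.ι x ∈ frontier D.Ω := D.range_ι ▸ mem_range_self x
    rw [D.isOpen.frontier_eq] at this
    exact this.2
  · exact fun h' => C.pos x t ⟨h, ht.2⟩ (subset_closure h')

/-- Both sides of Σ satisfy the same structure, so what follows is proved once and used for each of
them. -/
theorem isHalf_minus [IsManifold 𝓘(ℝ, E (m + 1)) 1 M] {gm gp : BilinField (m + 1) M}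
    (hg : IsCornerMetric D gm gp) (hC : C.IsGaussian gm gp) :
    C.IsHalf gm (closure D.Ω) C.heightsMinus where
  convex := convex_Ioc _ _
  interior_nonempty := by
    rw [heightsMinus, interior_Ioc, nonempty_Ioo]
    linarith [C.ε_pos]
  zero_mem := ⟨by linarith [C.ε_pos], le_rfl⟩
  subset := fun t ht => ⟨ht.1, by linarith [ht.2, C.ε_pos]⟩
  contMDiffOn := C.contMDiffOn_minus
  contMDiffOn_symm := C.contMDiffOn_symm_minus
  mem := fun x t ht => C.mem_closure_of_nonpos x ht
  of_mem := fun x t ht hx => ⟨ht.1, le_of_not_gt fun h => C.pos x t ⟨h, ht.2⟩ hx⟩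
  metric := hg.minus
  gaussian := hC.minus

theorem isHalf_plus [IsManifold 𝓘(ℝ, E (m + 1)) 1 M] {gm gp : BilinField (m + 1) M}
    (hg : IsCornerMetric D gm gp) (hC : C.IsGaussian gm gp) :
    C.IsHalf gp D.Ωᶜ C.heightsPlus where
  convex := convex_Ico _ _
  interior_nonempty := by
    rw [heightsPlus, interior_Ico, nonempty_Ioo]
    linarith [C.ε_pos]
  zero_mem := ⟨le_rfl, by linarith [C.ε_pos]⟩
  subset := fun t ht => ⟨by linarith [ht.1, C.ε_pos], ht.2⟩
  contMDiffOn := C.contMDiffOn_plus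
  contMDiffOn_symm := C.contMDiffOn_symm_plus
  mem := fun x t ht => C.notMem_of_nonneg x ht
  of_mem := fun x t ht hx => ⟨le_of_not_gt fun h => hx (C.neg x t ⟨ht.1, h⟩), ht.2⟩
  metric := hg.plus
  gaussian := hC.plus

/-- The metric on one side of `Σ` at the point with collar coordinates `q`, as a bilinear form
on `ℝᵐ⁺¹`. -/
def halfForm (g : BilinField (m + 1) M) (J : Set ℝ) (q : S × ℝ) : BL (m + 1) :=
  pullback (g.form (C.Φ q)) (C.dHalf J q ∘L ((coord m).symm : E (m + 1) →L[ℝ] E m × ℝ))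

/-- The metric on one side of `Σ` in the coordinates of the collar given by a chart `c`. -/
def halfComp (g : BilinField (m + 1) M) (J : Set ℝ) (c : OpenPartialHomeomorph S (E m))
    (y : E (m + 1)) : BL (m + 1) :=
  pullback (C.halfForm g J (param c y)) (dParam c y)

theorem halfComp_line (g : BilinField (m + 1) M) (J : Set ℝ) (c : OpenPartialHomeomorph S (E m))
    (y : E (m + 1)) (s : ℝ) : C.halfComp g J c (line y s)
      = pullback (C.halfForm g J ((param c y).1, s)) (dParam c y) := by
  rw [halfComp, param_line, dParam_line]

theorem halfComp_apply (g : BilinField (m + 1) M) (J : Set ℝ)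
    (c : OpenPartialHomeomorph S (E m)) (y v w : E (m + 1)) : C.halfComp g J c y v w
      = C.halfForm g J ((param c y).1, y 0) (dParam c y v) (dParam c y w) := rfl

theorem mem_source (x : S) {t : ℝ} (ht : t ∈ Ioo (-(2 * C.ε)) (2 * C.ε)) :
    (x, t) ∈ C.Φ.source := by
  rw [C.source_eq]
  exact ⟨mem_univ _, ht⟩

namespace IsHalf

variable {C} [IsManifold 𝓘(ℝ, E m) ∞ S] [IsManifold 𝓘(ℝ, E (m + 1)) ∞ M]
  {g : BilinField (m + 1) M} {s : Set M} {J : Set ℝ} (h : C.IsHalf g s J)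
include h

theorem uniqueDiffOn : UniqueDiffOn ℝ J := uniqueDiffOn_convex h.convex h.interior_nonempty

theorem uniqueMDiffOn : UniqueMDiffOn (𝓘(ℝ, E m).prod 𝓘(ℝ, ℝ)) ((univ : Set S) ×ˢ J) :=
  have : IsManifold 𝓘(ℝ, E m) 1 S := inferInstance
  uniqueMDiffOn_univ.prod (uniqueMDiffOn_iff_uniqueDiffOn.2 h.uniqueDiffOn)

theorem hasMFDerivWithinAt (x : S) {t : ℝ} (ht : t ∈ J) :
    HasMFDerivWithinAt (𝓘(ℝ, E m).prod 𝓘(ℝ, ℝ)) 𝓘(ℝ, E (m + 1)) C.Φ (univ ×ˢ J) (x, t)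
      (C.dHalf J (x, t)) :=
  ((h.contMDiffOn (x, t) ⟨mem_univ _, ht⟩).mdifferentiableWithinAt (by norm_num)).hasMFDerivWithinAt

/-- On the half collar `Φ.symm ∘ Φ` is the identity. Derivatives within it are unique, so the
one-sided differential of `Φ.symm` is a left inverse. -/
theorem dHalf_injective (x : S) {t : ℝ} (ht : t ∈ J) {u : E m × ℝ}
    (hu : C.dHalf J (x, t) u = 0) : u = 0 := by
  have h1 := h.hasMFDerivWithinAt x ht
  have hsrc := C.mem_source x (h.subset ht)
  have h2 := ((h.contMDiffOn_symm (C.Φ (x, t)) ⟨C.Φ.map_source hsrc, h.mem x t ht⟩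
    ).mdifferentiableWithinAt (by norm_num)).hasMFDerivWithinAt
  have h3 := HasMFDerivWithinAt.comp (x, t) h2 h1
    (fun q hq => ⟨C.Φ.map_source (C.mem_source q.1 (h.subset hq.2)), h.mem q.1 q.2 hq.2⟩)
  have h4 : HasMFDerivWithinAt (𝓘(ℝ, E m).prod 𝓘(ℝ, ℝ)) (𝓘(ℝ, E m).prod 𝓘(ℝ, ℝ))
      (C.Φ.symm ∘ C.Φ) (univ ×ˢ J) (x, t) (ContinuousLinearMap.id ℝ (E m × ℝ)) :=
    (hasMFDerivWithinAt_id (univ ×ˢ J) (x, t)).congr_of_eventuallyEq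
      (eventually_of_mem self_mem_nhdsWithin
        fun q hq => C.Φ.left_inv (C.mem_source q.1 (h.subset hq.2)))
      (C.Φ.left_inv hsrc)
  have h5 := (h.uniqueMDiffOn (x, t) ⟨mem_univ _, ht⟩).eq h4 h3
  have h6 := congrArg (fun L : (E m × ℝ) →L[ℝ] (E m × ℝ) => L u) h5
  have h7 : ∀ L : E (m + 1) →L[ℝ] E m × ℝ, L (C.dHalf J (x, t) u) = 0 := fun L => by
    rw [hu, map_zero]
  exact h6.trans (h7 _)

theorem halfForm_symm (x : S) {t : ℝ} (ht : t ∈ J) (v w : E (m + 1)) :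
    C.halfForm g J (x, t) v w = C.halfForm g J (x, t) w v :=
  h.metric.symm _ (h.mem x t ht) _ _

theorem halfForm_pos (x : S) {t : ℝ} (ht : t ∈ J) (v : E (m + 1)) (hv : v ≠ 0) :
    0 < C.halfForm g J (x, t) v v := by
  refine h.metric.pos _ (h.mem x t ht) _ fun h0 => hv ?_
  exact ((coord m).symm.map_eq_zero_iff).1 (h.dHalf_injective x ht h0)

/-- The Gaussian form `γ + dt²` applied to `∂ₜ` and `v` leaves only the `dt²` term, the height
component of `v`. -/
theorem halfForm_normal (x : S) {t : ℝ} (ht : t ∈ J) : Normal (C.halfForm g J (x, t)) := by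
  have key : ∀ v w : E (m + 1), C.halfForm g J (x, t) v w
      = g.form (C.Φ (x, t)) (C.dHalf J (x, t) ((coord m).symm v)) 
        (C.dHalf J (x, t) ((coord m).symm w)) := fun v w => rfl
  have h1 : ∀ v : E (m + 1), C.halfForm g J (x, t) (bv 0) v = v 0 := fun v => by
    rw [key, coord_symm_bv_zero, ← Prod.mk.eta (p := (coord m).symm v), h.gaussian x t ht,
      coord_symm_snd, Prod.mk_zero_zero, map_zero, map_zero]
    simp
  exact fun v => ⟨h1 v, by rw [h.halfForm_symm x ht, h1]⟩

variable {c : OpenPartialHomeomorph S (E m)} (hc : c ∈ atlas (E m) S)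

include hc in
theorem halfComp_pos {y : E (m + 1)} (hy : y ∈ box c J) (v : E (m + 1)) (hv : v ≠ 0) :
    0 < C.halfComp g J c y v v := by
  rw [halfComp_apply]
  exact h.halfForm_pos _ hy.2 _ fun h0 => hv (dParam_injective hc hy.1 h0)

theorem halfComp_normal {y : E (m + 1)} (hy : y ∈ box c J) : Normal (C.halfComp g J c y) := by
  intro v
  have h1 := h.halfForm_normal (param c y).1 hy.2 (dParam c y v)
  rw [dParam_apply_zero] at h1
  rwa [halfComp_apply, halfComp_apply, dParam_bv_zero]

include hc in
theorem hasMFDerivWithinAt_comp_param {y : E (m + 1)} (hy : y ∈ box c J) :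
    HasMFDerivWithinAt 𝓘(ℝ, E (m + 1)) 𝓘(ℝ, E (m + 1)) (C.Φ ∘ param c) (box c J) y
      (C.dHalf J (param c y) ∘L ((coord m).symm : E (m + 1) →L[ℝ] E m × ℝ) ∘L dParam c y) :=
  HasMFDerivWithinAt.comp y (h.hasMFDerivWithinAt (param c y).1 hy.2)
    (hasMFDerivAt_param hc hy.1).hasMFDerivWithinAt fun _ hy' => ⟨mem_univ _, hy'.2⟩

include hc in
theorem contMDiffOn_comp_param :
    ContMDiffOn 𝓘(ℝ, E (m + 1)) 𝓘(ℝ, E (m + 1)) 3 (C.Φ ∘ param c) (box c J) := by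
  have h1 := contMDiffOn_prodParam (m := m) hc
  have h2 : ContMDiffOn 𝓘(ℝ, E (m + 1)) (𝓘(ℝ, E m).prod 𝓘(ℝ, ℝ)) 3 (param c) (box c J) :=
    (h1.mono fun y hy => hy.1).congr fun y _ => by rw [param, coord_symm_snd]
  exact h.contMDiffOn.comp h2 fun _ hy' => ⟨mem_univ _, hy'.2⟩

include hc in
theorem halfComp_eq {y : E (m + 1)} (hy : y ∈ box c J) :
    C.halfComp g J c y = pullback (g.form (C.Φ (param c y)))
      (mfderivWithin 𝓘(ℝ, E (m + 1)) 𝓘(ℝ, E (m + 1)) (C.Φ ∘ param c) (box c J) y :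
        E (m + 1) →L[ℝ] E (m + 1)) := by
  have h1 := (h.hasMFDerivWithinAt_comp_param hc hy).mfderivWithin
    (uniqueMDiffOn_iff_uniqueDiffOn.2 (uniqueDiffOn_box c h.uniqueDiffOn) y hy)
  exact (congrArg (fun L : E (m + 1) →L[ℝ] E (m + 1) =>
    pullback (g.form (C.Φ (param c y))) L) h1).symm

include hc in
theorem contDiffOn_halfComp : ContDiffOn ℝ 2 (C.halfComp g J c) (box c J) := by
  have : IsManifold 𝓘(ℝ, E (m + 1)) 3 M := inferInstance
  intro y hy
  refine contDiffWithinAt_bilin_of_apply fun v w => ?_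
  have h1 := contDiffOn_pullback_apply h.metric.contMDiffOn (F := C.Φ ∘ param c)
    (uniqueDiffOn_box c h.uniqueDiffOn) (h.contMDiffOn_comp_param hc) Subset.rfl
    (fun y hy => h.mem _ _ hy.2) v w
  refine (h1 y hy).congr (fun z hz => ?_) ?_
  · rw [h.halfComp_eq hc hz]; rfl
  · rw [h.halfComp_eq hc hy]; rfl

end IsHalf

/-- The two metrics agree on `Σ`. -/
theorem halfForm_zero_eq [IsManifold 𝓘(ℝ, E m) ∞ S] [IsManifold 𝓘(ℝ, E (m + 1)) ∞ M]
    {gm gp : BilinField (m + 1) M} (hg : IsCornerMetric D gm gp) (hC : C.IsGaussian gm gp)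
    (x : S) : C.halfForm gp C.heightsPlus (x, 0) = C.halfForm gm C.heightsMinus (x, 0) := by
  -- Either half restricted to height zero is `ι`, so both one-sided differentials agree on
  -- tangential vectors; the normal parts agree by the Gaussian form.
  have key : ∀ {g : BilinField (m + 1) M} {s : Set M} {J : Set ℝ}, C.IsHalf g s J →
      ∀ v : E m, C.dHalf J (x, 0) (v, 0)
        = (mfderiv 𝓘(ℝ, E m) 𝓘(ℝ, E (m + 1)) D.ι x : E m →L[ℝ] E (m + 1)) v := by
    intro g s J h v
    have h1 : HasMFDerivAt 𝓘(ℝ, E m) (𝓘(ℝ, E m).prod 𝓘(ℝ, ℝ)) (fun x : S => (x, (0 : ℝ))) x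
        ((ContinuousLinearMap.id ℝ (E m)).prod (0 : E m →L[ℝ] ℝ)) :=
      (hasMFDerivAt_id x).prodMk (hasMFDerivAt_const (0 : ℝ) x)
    have h2 := HasMFDerivWithinAt.comp x (h.hasMFDerivWithinAt x h.zero_mem)
      (h1.hasMFDerivWithinAt (s := univ)) (fun x _ => mk_mem_prod (mem_univ _) h.zero_mem)
    rw [hasMFDerivWithinAt_univ] at h2
    have h3 : (C.Φ ∘ fun x : S => (x, (0 : ℝ))) = D.ι := funext C.zero
    rw [h3] at h2
    exact congrArg (fun L : E m →L[ℝ] E (m + 1) => L v) h2.mfderiv.symm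
  have e1 := C.isHalf_minus hg hC
  have e2 := C.isHalf_plus hg hC
  ext v w
  change gp.form (C.Φ (x, 0)) (C.dHalf C.heightsPlus (x, 0) ((coord m).symm v)) 
        (C.dHalf C.heightsPlus (x, 0) ((coord m).symm w)) =
    gm.form (C.Φ (x, 0)) (C.dHalf C.heightsMinus (x, 0) ((coord m).symm v)) 
        (C.dHalf C.heightsMinus (x, 0) ((coord m).symm w))
  rw [← Prod.mk.eta (p := (coord m).symm v), ← Prod.mk.eta (p := (coord m).symm w),
    e1.gaussian x 0 e1.zero_mem, e2.gaussian x 0 e2.zero_mem, key e1, key e1, key e2, key e2,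
    C.zero]
  congr 1
  exact (hg.agree x _ _).symm

end Collar

/-! ### Charts and differentials on the modified manifold -/

namespace Collar

variable {m : ℕ} {M S : Type*} [TopologicalSpace M] [ChartedSpace (E (m + 1)) M]
  [TopologicalSpace S] [ChartedSpace (E m) S] {D : Domain m M S} (C : Collar D)

/-- The collar as a map into the modified manifold. -/
def incl (q : S × ℝ) : C.Glued := C.pt q.1 q.2

/-- The inverse of `incl`. -/
def inclSymm (p : C.Glued) : S × ℝ := C.Φ.symm p

/-- The chart of the modified manifold induced by a chart `c` of `Σ`. -/
def gluedChart (c : OpenPartialHomeomorph S (E m)) : OpenPartialHomeomorph C.Glued (E (m + 1)) :=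
  C.collarChart c

theorem gluedChart_mem_atlas {c : OpenPartialHomeomorph S (E m)} (hc : c ∈ atlas (E m) S) :
    C.gluedChart c ∈ atlas (E (m + 1)) C.Glued :=
  Or.inr (Or.inr ⟨c, hc, rfl⟩)

theorem chartAt_pt (x : S) {t : ℝ} (ht : t ∈ Ioo (-(2 * C.ε)) (2 * C.ε)) :
    chartAt (E (m + 1)) (C.pt x t) = C.gluedChart (chartAt (E m) x) := by
  have hsrc := C.mem_source x ht
  change C.gluedChartAt (C.Φ (x, t)) = C.collarChart _
  rw [gluedChartAt, if_pos (C.Φ.map_source hsrc), C.Φ.left_inv hsrc]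

theorem gluedChart_pt (c : OpenPartialHomeomorph S (E m)) (x : S) {t : ℝ}
    (ht : t ∈ Ioo (-(2 * C.ε)) (2 * C.ε)) : C.gluedChart c (C.pt x t) = coord m (c x, t) := by
  change coord m (c (C.Φ.symm (C.Φ (x, t))).1, (C.Φ.symm (C.Φ (x, t))).2) = _
  rw [C.Φ.left_inv (C.mem_source x ht)]

theorem gluedChart_symm_apply (c : OpenPartialHomeomorph S (E m)) (y : E (m + 1)) :
    (C.gluedChart c).symm y = C.incl (param c y) := by
  change C.Φ (c.symm ((coord m).symm y).1, ((coord m).symm y).2) = C.Φ (param c y)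
  rw [param, ← coord_symm_snd]

theorem gluedChart_target (c : OpenPartialHomeomorph S (E m)) :
    (C.gluedChart c).target = box c (Ioo (-(2 * C.ε)) (2 * C.ε)) := by
  change (C.collarChart c).target = _
  ext y
  simp only [collarChart, box, OpenPartialHomeomorph.trans_target]
  simp [C.source_eq, coord_symm_snd]

theorem inclSymm_pt (x : S) {t : ℝ} (ht : t ∈ Ioo (-(2 * C.ε)) (2 * C.ε)) :
    C.inclSymm (C.pt x t) = (x, t) := C.Φ.left_inv (C.mem_source x ht)

/-- The preferred chart of the modified manifold at a collar point lies over the preferred chart of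
Σ; in these charts the inclusion is `coord` itself. -/
theorem hasMFDerivAt_incl (x : S) {t : ℝ} (ht : t ∈ Ioo (-(2 * C.ε)) (2 * C.ε)) :
    HasMFDerivAt (𝓘(ℝ, E m).prod 𝓘(ℝ, ℝ)) 𝓘(ℝ, E (m + 1)) C.incl (x, t)
      (coord m : (E m × ℝ) →L[ℝ] E (m + 1)) := by
  have hsrc := C.mem_source x ht
  refine ⟨C.Φ.continuousAt hsrc, ?_⟩
  have h1 : HasFDerivWithinAt (coord m) (coord m : (E m × ℝ) →L[ℝ] E (m + 1))
      (range (𝓘(ℝ, E m).prod 𝓘(ℝ, ℝ)))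
      (extChartAt (𝓘(ℝ, E m).prod 𝓘(ℝ, ℝ)) (x, t) (x, t)) := (coord m).hasFDerivWithinAt
  have key : ∀ y ∈ (chartAt (E m) x).target ×ˢ Ioo (-(2 * C.ε)) (2 * C.ε),
      writtenInExtChartAt (𝓘(ℝ, E m).prod 𝓘(ℝ, ℝ)) 𝓘(ℝ, E (m + 1)) (x, t) C.incl y
        = coord m y := by
    intro y hy
    simp only [writtenInExtChartAt, extChartAt, Function.comp_apply]
    change chartAt (E (m + 1)) (C.pt x t) (C.pt ((chartAt (E m) x).symm y.1) y.2) = _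
    rw [C.chartAt_pt x ht, C.gluedChart_pt _ _ hy.2]
    rw [(chartAt (E m) x).right_inv hy.1]
  have hmem : (extChartAt (𝓘(ℝ, E m).prod 𝓘(ℝ, ℝ)) (x, t) (x, t)) ∈
      (chartAt (E m) x).target ×ˢ Ioo (-(2 * C.ε)) (2 * C.ε) :=
    ⟨(chartAt (E m) x).map_source (mem_chart_source _ x), ht⟩
  refine h1.congr_of_eventuallyEq ?_ (key _ hmem)
  refine eventually_of_mem (mem_nhdsWithin_of_mem_nhds ?_) key
  exact ((chartAt (E m) x).open_target.prod isOpen_Ioo).mem_nhds hmem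

theorem hasMFDerivAt_inclSymm (x : S) {t : ℝ} (ht : t ∈ Ioo (-(2 * C.ε)) (2 * C.ε)) :
    HasMFDerivAt 𝓘(ℝ, E (m + 1)) (𝓘(ℝ, E m).prod 𝓘(ℝ, ℝ)) C.inclSymm (C.pt x t)
      ((coord m).symm : E (m + 1) →L[ℝ] E m × ℝ) := by
  have hsrc := C.mem_source x ht
  refine ⟨C.Φ.continuousAt_symm (C.Φ.map_source hsrc), ?_⟩
  have h1 : HasFDerivWithinAt (coord m).symm ((coord m).symm : E (m + 1) →L[ℝ] E m × ℝ)
      (range 𝓘(ℝ, E (m + 1)))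
      (extChartAt 𝓘(ℝ, E (m + 1)) (C.pt x t) (C.pt x t)) := (coord m).symm.hasFDerivWithinAt
  have key : ∀ y ∈ box (chartAt (E m) x) (Ioo (-(2 * C.ε)) (2 * C.ε)),
      writtenInExtChartAt 𝓘(ℝ, E (m + 1)) (𝓘(ℝ, E m).prod 𝓘(ℝ, ℝ)) (C.pt x t) C.inclSymm y
        = (coord m).symm y := by
    intro y hy
    have e1 : ((extChartAt 𝓘(ℝ, E (m + 1)) (C.pt x t)).symm y : C.Glued)
        = C.incl (param (chartAt (E m) x) y) := by
      change (chartAt (E (m + 1)) (C.pt x t)).symm y = _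
      rw [C.chartAt_pt x ht, C.gluedChart_symm_apply]
    have e2 : C.inclSymm ((extChartAt 𝓘(ℝ, E (m + 1)) (C.pt x t)).symm y)
        = param (chartAt (E m) x) y := by
      rw [e1]
      exact C.Φ.left_inv (C.mem_source _ hy.2)
    simp only [writtenInExtChartAt, Function.comp_apply]
    rw [e2, C.inclSymm_pt x ht]
    change (chartAt (E m) x ((chartAt (E m) x).symm ((coord m).symm y).1), y 0) = _
    rw [(chartAt (E m) x).right_inv hy.1, ← coord_symm_snd]
  have hmem : (extChartAt 𝓘(ℝ, E (m + 1)) (C.pt x t) (C.pt x t)) ∈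
      box (chartAt (E m) x) (Ioo (-(2 * C.ε)) (2 * C.ε)) := by
    rw [← gluedChart_target, ← C.chartAt_pt x ht]
    exact (chartAt (E (m + 1)) (C.pt x t)).map_source (mem_chart_source _ _)
  refine h1.congr_of_eventuallyEq ?_ (key _ hmem)
  exact eventually_of_mem (mem_nhdsWithin_of_mem_nhds ((isOpen_box _ isOpen_Ioo).mem_nhds hmem)) key

variable [IsManifold 𝓘(ℝ, E m) ∞ S] [IsManifold 𝓘(ℝ, E (m + 1)) ∞ M]

/-- On the collar the identity map to `M` factors as `Φ ∘ inclSymm`, and `Φ` is known to be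
differentiable only from each side. -/
theorem IsHalf.hasMFDerivWithinAt_toM {C : Collar D} {g : BilinField (m + 1) M} {s : Set M}
    {J : Set ℝ} (h : C.IsHalf g s J) (x : S) {t : ℝ} (ht : t ∈ J) :
    HasMFDerivWithinAt 𝓘(ℝ, E (m + 1)) 𝓘(ℝ, E (m + 1)) C.toM (C.toM ⁻¹' s) (C.pt x t)
      (C.dHalf J (x, t) ∘L ((coord m).symm : E (m + 1) →L[ℝ] E m × ℝ)) := by
  have ht' := h.subset ht
  have hsrc := C.mem_source x ht'
  have htar : C.toM ⁻¹' C.Φ.target ∈ 𝓝 (C.pt x t) := C.Φ.open_target.mem_nhds (C.Φ.map_source hsrc)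
  have h1 := (C.hasMFDerivAt_inclSymm x ht').hasMFDerivWithinAt
    (s := C.toM ⁻¹' s ∩ C.toM ⁻¹' C.Φ.target)
  have h2 := h.hasMFDerivWithinAt x ht
  rw [← C.inclSymm_pt x ht'] at h2
  have h3 := HasMFDerivWithinAt.comp (C.pt x t) h2 h1 fun p hp => by
    refine ⟨mem_univ _, h.of_mem (C.inclSymm p).1 _ ?_ ?_⟩
    · have := C.Φ.map_target hp.2
      rw [C.source_eq] at this
      exact this.2
    · have := C.Φ.right_inv hp.2
      change C.Φ (C.Φ.symm p) ∈ s
      rw [show C.Φ (C.Φ.symm p) = p from this]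
      exact hp.1
  rw [C.inclSymm_pt x ht'] at h3
  have h4 := h3.congr_of_eventuallyEq (f₁ := C.toM)
    (eventually_of_mem self_mem_nhdsWithin fun p hp => (C.Φ.right_inv hp.2).symm)
    (C.Φ.right_inv (C.Φ.map_source hsrc)).symm
  exact (hasMFDerivWithinAt_inter (s := C.toM ⁻¹' s) htar).1 h4

/-- The side contains the image of the half collar under a map with surjective differential, and
such images inherit unique differentiability. -/
theorem IsHalf.uniqueMDiffWithinAt_toM {C : Collar D} {g : BilinField (m + 1) M} {s : Set M}
    {J : Set ℝ} (h : C.IsHalf g s J) (x : S) {t : ℝ} (ht : t ∈ J) :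
    UniqueMDiffWithinAt 𝓘(ℝ, E (m + 1)) (C.toM ⁻¹' s) (C.pt x t) := by
  have h1 := (h.uniqueMDiffOn (x, t) ⟨mem_univ _, ht⟩).image_denseRange
    (C.hasMFDerivAt_incl x (h.subset ht)).hasMFDerivWithinAt (coord m).surjective.denseRange
  refine h1.mono ?_
  rintro _ ⟨q, hq, rfl⟩
  exact h.mem q.1 q.2 hq.2

theorem IsHalf.pullback_toM {C : Collar D} {g : BilinField (m + 1) M} {s : Set M}
    {J : Set ℝ} (h : C.IsHalf g s J) (x : S) {t : ℝ} (ht : t ∈ J) :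
    (pullback (g (C.toM (C.pt x t)))
        (mfderivWithin 𝓘(ℝ, E (m + 1)) 𝓘(ℝ, E (m + 1)) C.toM (C.toM ⁻¹' s) (C.pt x t)) : BL (m + 1))
      = C.halfForm g J (x, t) := by
  rw [(h.hasMFDerivWithinAt_toM x ht).mfderivWithin (h.uniqueMDiffWithinAt_toM x ht)]
  rfl

theorem gluedMetric_of_mem {gm gp : BilinField (m + 1) M} {p : C.Glued}
    (hp : C.toM p ∈ closure D.Ω) : (C.gluedMetric gm gp).form p
      = (pullback (gm (C.toM p))
        (mfderivWithin 𝓘(ℝ, E (m + 1)) 𝓘(ℝ, E (m + 1)) C.toM (C.toM ⁻¹' closure D.Ω) p) :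
          BL (m + 1)) :=
  if_pos hp

theorem gluedMetric_of_notMem {gm gp : BilinField (m + 1) M} {p : C.Glued}
    (hp : C.toM p ∉ closure D.Ω) : (C.gluedMetric gm gp).form p
      = (pullback (gp (C.toM p))
        (mfderivWithin 𝓘(ℝ, E (m + 1)) 𝓘(ℝ, E (m + 1)) C.toM (C.toM ⁻¹' D.Ωᶜ) p) : BL (m + 1)) :=
  if_neg hp

variable {C} {gm gp : BilinField (m + 1) M}

theorem gluedMetric_pt_of_nonpos (hg : IsCornerMetric D gm gp) (hC : C.IsGaussian gm gp)
    (x : S) {t : ℝ} (ht : t ∈ C.heightsMinus) :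
    (C.gluedMetric gm gp).form (C.pt x t) = C.halfForm gm C.heightsMinus (x, t) := by
  rw [C.gluedMetric_of_mem (p := C.pt x t) (C.mem_closure_of_nonpos x ht), (C.isHalf_minus hg hC).pullback_toM x ht]

/-- At height zero the glued metric is defined through `gm`; there the agreement of the two forms on
Σ is used. -/
theorem gluedMetric_pt_of_nonneg (hg : IsCornerMetric D gm gp) (hC : C.IsGaussian gm gp)
    (x : S) {t : ℝ} (ht : t ∈ C.heightsPlus) :
    (C.gluedMetric gm gp).form (C.pt x t) = C.halfForm gp C.heightsPlus (x, t) := by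
  rcases eq_or_lt_of_le ht.1 with h | h
  · subst h
    rw [C.halfForm_zero_eq hg hC,
      gluedMetric_pt_of_nonpos hg hC x (C.isHalf_minus hg hC).zero_mem]
  · rw [C.gluedMetric_of_notMem (p := C.pt x t) (C.pos x t ⟨h, ht.2⟩), (C.isHalf_plus hg hC).pullback_toM x ht]

end Collar

/-! ### The smoothed metric on the modified manifold -/

namespace Collar

variable {m : ℕ} {M S : Type*} [TopologicalSpace M] [ChartedSpace (E (m + 1)) M]
  [TopologicalSpace S] [ChartedSpace (E m) S] {D : Domain m M S} (C : Collar D)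

/-- The smoothed metric at the point with collar coordinates `q`. -/
def smoothForm (gm gp : BilinField (m + 1) M) (a h : ℝ → ℝ) (q : S × ℝ) : BL (m + 1) :=
  C.halfForm gm C.heightsMinus (q.1, a q.2) + C.halfForm gp C.heightsPlus (q.1, h q.2)
    - C.halfForm gm C.heightsMinus (q.1, 0)

open Classical in
/-- The smoothed metric on the modified manifold. -/
def smoothMetric (gm gp : BilinField (m + 1) M) (a h : ℝ → ℝ) : BilinField (m + 1) C.Glued :=
  fun p => if C.toM p ∈ C.Φ.target then C.smoothForm gm gp a h (C.inclSymm p)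
    else C.gluedMetric gm gp p

variable {C} {gm gp : BilinField (m + 1) M} {a h : ℝ → ℝ}

theorem smoothMetric_pt (x : S) {t : ℝ} (ht : t ∈ Ioo (-(2 * C.ε)) (2 * C.ε)) :
    (C.smoothMetric gm gp a h).form (C.pt x t) = C.smoothForm gm gp a h (x, t) := by
  have : (C.smoothMetric gm gp a h).form (C.pt x t)
      = C.smoothForm gm gp a h (C.inclSymm (C.pt x t)) :=
    if_pos (C.Φ.map_source (C.mem_source x ht))
  rw [this, C.inclSymm_pt x ht]

theorem smoothMetric_of_notMem {p : C.Glued} (hp : C.toM p ∉ C.Φ.target) :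
    (C.smoothMetric gm gp a h).form p = (C.gluedMetric gm gp).form p :=
  if_neg hp

theorem exists_eq_pt {p : C.Glued} (hp : C.toM p ∈ C.Φ.target) :
    ∃ x, ∃ t ∈ Ioo (-(2 * C.ε)) (2 * C.ε), p = C.pt x t := by
  have h1 := C.Φ.map_target hp
  rw [C.source_eq] at h1
  exact ⟨_, _, h1.2, (C.Φ.right_inv hp).symm⟩

/-- The functions `a` and `h` are smooth, and equal to `min t 0` and `max t 0` outside
`(-r, r)`. -/
structure IsCutoff (ε r : ℝ) (a h : ℝ → ℝ) : Prop where
  contDiff_left : ContDiff ℝ 2 a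
  contDiff_right : ContDiff ℝ 2 h
  lt : r < 2 * ε
  left_mem : ∀ t ∈ Ioo (-(2 * ε)) (2 * ε), a t ∈ Ioc (-(2 * ε)) 0
  right_mem : ∀ t ∈ Ioo (-(2 * ε)) (2 * ε), h t ∈ Ico 0 (2 * ε)
  left_eq : ∀ t, t ≤ -r → a t = t ∧ h t = 0
  right_eq : ∀ t, r ≤ t → a t = 0 ∧ h t = t

variable [IsManifold 𝓘(ℝ, E m) ∞ S] [IsManifold 𝓘(ℝ, E (m + 1)) ∞ M]
  {r : ℝ}

/-- For `t ≥ r` the two inner terms at height zero cancel outright; for `t ≤ -r` an inner and an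
outer term at height zero cancel because the metrics agree on Σ. -/
theorem IsCutoff.smoothMetric_pt_eq (ha : IsCutoff C.ε r a h) (hr : 0 < r)
    (hg : IsCornerMetric D gm gp)
    (hC : C.IsGaussian gm gp) (x : S) {t : ℝ} (ht : t ∈ Ioo (-(2 * C.ε)) (2 * C.ε))
    (htr : r ≤ |t|) :
    (C.smoothMetric gm gp a h).form (C.pt x t) = (C.gluedMetric gm gp).form (C.pt x t) := by
  rw [smoothMetric_pt x ht, smoothForm]
  rcases le_abs.1 htr with h1 | h1
  · rw [(ha.right_eq t h1).1, (ha.right_eq t h1).2,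
      gluedMetric_pt_of_nonneg hg hC x ⟨hr.le.trans h1, ht.2⟩]
    abel
  · rw [(ha.left_eq t (by linarith)).1, (ha.left_eq t (by linarith)).2,
      gluedMetric_pt_of_nonpos hg hC x ⟨ht.1, by linarith⟩, C.halfForm_zero_eq hg hC]
    abel

theorem IsCutoff.smoothMetric_eq (ha : IsCutoff C.ε r a h) (hr : 0 < r)
    (hg : IsCornerMetric D gm gp)
    (hC : C.IsGaussian gm gp) {p : C.Glued} (hp : p ∉ C.strip r) :
    (C.smoothMetric gm gp a h).form p = (C.gluedMetric gm gp).form p := by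
  by_cases hp' : C.toM p ∈ C.Φ.target
  · obtain ⟨x, t, ht, rfl⟩ := exists_eq_pt hp'
    exact ha.smoothMetric_pt_eq hr hg hC x ht (le_of_not_gt fun h' => hp ⟨x, t, h', rfl⟩)
  · exact smoothMetric_of_notMem hp'

theorem smoothed_halfComp (c : OpenPartialHomeomorph S (E m)) (y : E (m + 1)) :
    smoothed (C.halfComp gm C.heightsMinus c) (C.halfComp gp C.heightsPlus c) a h y
      = pullback (C.smoothForm gm gp a h ((param c y).1, y 0)) (dParam c y) := by
  rw [smoothed, halfComp_line, halfComp_line, halfComp_line, smoothForm]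
  ext v w
  simp [pullback_apply]

/-- This reduces the geometry of the smoothed metric to the estimates for `smoothed` on open subsets
of Euclidean space. -/
theorem compB_smoothMetric {c : OpenPartialHomeomorph S (E m)} (hc : c ∈ atlas (E m) S)
    {y : E (m + 1)} (hy : y ∈ box c (Ioo (-(2 * C.ε)) (2 * C.ε))) :
    compB (C.gluedChart c) (C.smoothMetric gm gp a h) y
      = smoothed (C.halfComp gm C.heightsMinus c) (C.halfComp gp C.heightsPlus c) a h y := by
  have h1 := HasMFDerivAt.comp y (C.hasMFDerivAt_incl (param c y).1 hy.2)
    (hasMFDerivAt_param hc hy.1)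
  have h2 : (C.gluedChart c).symm = C.incl ∘ param c := funext (C.gluedChart_symm_apply c)
  rw [← h2] at h1
  have h3 : (mfderiv 𝓘(ℝ, E (m + 1)) 𝓘(ℝ, E (m + 1)) (C.gluedChart c).symm y :
      E (m + 1) →L[ℝ] E (m + 1)) = dParam c y := by
    refine h1.mfderiv.trans ?_
    ext1 v
    exact (coord m).apply_symm_apply _
  change pullback ((C.smoothMetric gm gp a h).form ((C.gluedChart c).symm y))
    (mfderiv 𝓘(ℝ, E (m + 1)) 𝓘(ℝ, E (m + 1)) (C.gluedChart c).symm y :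
      E (m + 1) →L[ℝ] E (m + 1)) = _
  rw [h3, C.gluedChart_symm_apply]
  change pullback ((C.smoothMetric gm gp a h).form (C.pt (param c y).1 (y 0))) (dParam c y) = _
  rw [smoothMetric_pt _ hy.2, smoothed_halfComp]

theorem contDiffAt_smoothed (ha : IsCutoff C.ε r a h) (hg : IsCornerMetric D gm gp)
    (hC : C.IsGaussian gm gp) {c : OpenPartialHomeomorph S (E m)} (hc : c ∈ atlas (E m) S)
    {y : E (m + 1)} (hy : y ∈ box c (Ioo (-(2 * C.ε)) (2 * C.ε))) :
    ContDiffAt ℝ 2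
      (smoothed (C.halfComp gm C.heightsMinus c) (C.halfComp gp C.heightsPlus c) a h) y := by
  have hO := isOpen_box c (isOpen_Ioo (a := -(2 * C.ε)) (b := 2 * C.ε))
  have hm := C.isHalf_minus hg hC
  have hp := C.isHalf_plus hg hC
  refine ((contDiffAt_comp_sub (hm.contDiffOn_halfComp hc) hO
    (fun y hy => line_mem_box hy (ha.left_mem _ hy.2)) ha.contDiff_left hy).add
    (contDiffAt_comp_sub (hp.contDiffOn_halfComp hc) hO
    (fun y hy => line_mem_box hy (ha.right_mem _ hy.2)) ha.contDiff_right hy)).sub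
    (contDiffAt_comp_sub (k := fun _ => 0) (hm.contDiffOn_halfComp hc) hO
    (fun y hy => line_mem_box hy hm.zero_mem) contDiff_const hy)

theorem contDiffAt_compB_smoothMetric (ha : IsCutoff C.ε r a h) (hg : IsCornerMetric D gm gp)
    (hC : C.IsGaussian gm gp) {c : OpenPartialHomeomorph S (E m)} (hc : c ∈ atlas (E m) S)
    {y : E (m + 1)} (hy : y ∈ box c (Ioo (-(2 * C.ε)) (2 * C.ε))) :
    ContDiffAt ℝ 2 (compB (C.gluedChart c) (C.smoothMetric gm gp a h)) y := by
  refine (contDiffAt_smoothed ha hg hC hc hy).congr_of_eventuallyEq ?_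
  filter_upwards [(isOpen_box c isOpen_Ioo).mem_nhds hy] with z hz
  exact compB_smoothMetric hc hz

/-- The point of the modified manifold given by a point of `M`. -/
def ofM (C : Collar D) (p : M) : C.Glued := p

/-! ### Points away from the hypersurface -/

section Inner

variable {s : Set M} (hs : IsOpen s)
  (hat : ∀ e ∈ atlas (E (m + 1)) M, (e.restr s : OpenPartialHomeomorph M (E (m + 1))) ∈
    C.gluedAtlas)
include hs hat

/-- Off Σ the restricted charts of `M` belong to the atlas of the modified manifold, so the identity
map reads as the identity. -/
theorem contMDiffAt_toM {p : C.Glued} (hp : C.toM p ∈ s) :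
    ContMDiffAt 𝓘(ℝ, E (m + 1)) 𝓘(ℝ, E (m + 1)) 3 C.toM p := by
  have : IsManifold 𝓘(ℝ, E (m + 1)) 3 M := inferInstance
  let e := chartAt (E (m + 1)) (C.toM p)
  let e' : OpenPartialHomeomorph C.Glued (E (m + 1)) := e.restr s
  have he : e ∈ atlas (E (m + 1)) M := chart_mem_atlas _ _
  have he' : e' ∈ atlas (E (m + 1)) C.Glued := hat e he
  have hsrc : e'.source = C.toM ⁻¹' (e.source ∩ s) := e.restr_source' _ hs
  have hp' : p ∈ e'.source := by rw [hsrc]; exact ⟨mem_chart_source _ _, hp⟩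
  have h1 := contMDiffAt_of_mem_maximalAtlas (I := 𝓘(ℝ, E (m + 1))) (n := 3)
    (IsManifold.subset_maximalAtlas he') hp'
  have h2 : ContMDiffAt 𝓘(ℝ, E (m + 1)) 𝓘(ℝ, E (m + 1)) 3 e.symm (e' p) :=
    (contMDiffOn_symm_of_mem_maximalAtlas (I := 𝓘(ℝ, E (m + 1))) (n := 3)
    (IsManifold.subset_maximalAtlas he)).contMDiffAt
      (e.open_target.mem_nhds (e.map_source (mem_chart_source _ _)))
  refine (h2.comp p h1).congr_of_eventuallyEq ?_
  filter_upwards [e'.open_source.mem_nhds hp'] with q hq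
  rw [hsrc] at hq
  exact (e.left_inv hq.1).symm

theorem contMDiffAt_ofM {p : M} (hp : p ∈ s) :
    ContMDiffAt 𝓘(ℝ, E (m + 1)) 𝓘(ℝ, E (m + 1)) 3 C.ofM p := by
  have : IsManifold 𝓘(ℝ, E (m + 1)) 3 M := inferInstance
  let e := chartAt (E (m + 1)) p
  let e' : OpenPartialHomeomorph C.Glued (E (m + 1)) := e.restr s
  have he : e ∈ atlas (E (m + 1)) M := chart_mem_atlas _ _
  have he' : e' ∈ atlas (E (m + 1)) C.Glued := hat e he
  have hsrc : e'.source = C.toM ⁻¹' (e.source ∩ s) := e.restr_source' _ hs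
  have hp' : C.ofM p ∈ e'.source := by rw [hsrc]; exact ⟨mem_chart_source _ _, hp⟩
  have h1 := contMDiffAt_of_mem_maximalAtlas (I := 𝓘(ℝ, E (m + 1))) (n := 3)
    (IsManifold.subset_maximalAtlas he) (mem_chart_source (E (m + 1)) p)
  have h2 : ContMDiffAt 𝓘(ℝ, E (m + 1)) 𝓘(ℝ, E (m + 1)) 3 e'.symm (e p) :=
    (contMDiffOn_symm_of_mem_maximalAtlas (I := 𝓘(ℝ, E (m + 1))) (n := 3)
    (IsManifold.subset_maximalAtlas he')).contMDiffAt
      (e'.open_target.mem_nhds (e'.map_source hp'))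
  refine (h2.comp p h1).congr_of_eventuallyEq ?_
  filter_upwards [e.open_source.mem_nhds (mem_chart_source (E (m + 1)) p)] with q hq
  exact (e.left_inv hq).symm

theorem mfderiv_toM_injective {p : C.Glued} (hp : C.toM p ∈ s) {v : E (m + 1)}
    (hv : (mfderiv 𝓘(ℝ, E (m + 1)) 𝓘(ℝ, E (m + 1)) C.toM p : E (m + 1) →L[ℝ] E (m + 1)) v = 0) :
    v = 0 := by
  have h1 := ((contMDiffAt_toM hs hat hp).mdifferentiableAt (by norm_num)).hasMFDerivAt
  have h2 := ((contMDiffAt_ofM hs hat hp).mdifferentiableAt (by norm_num)).hasMFDerivAt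
  have h3 := (HasMFDerivAt.comp p h2 h1).mfderiv
  have h4 : mfderiv 𝓘(ℝ, E (m + 1)) 𝓘(ℝ, E (m + 1)) (C.ofM ∘ C.toM) p
      = ContinuousLinearMap.id ℝ (E (m + 1)) := mfderiv_id
  have h6 := congrArg (fun L : E (m + 1) →L[ℝ] E (m + 1) => L v) (h4.symm.trans h3)
  have h7 : ∀ L : E (m + 1) →L[ℝ] E (m + 1), L ((mfderiv 𝓘(ℝ, E (m + 1)) 𝓘(ℝ, E (m + 1)) C.toM p :
      E (m + 1) →L[ℝ] E (m + 1)) v) = 0 := fun L =>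
    (congrArg L hv).trans (map_zero L)
  exact h6.trans (h7 _)

variable {g : BilinField (m + 1) M} {β : BilinField (m + 1) C.Glued}
  (hgs : SectionOn g s)
  (hβ : ∀ p : C.Glued, C.toM p ∈ s → β.form p = pullback (g.form (C.toM p))
    (mfderiv 𝓘(ℝ, E (m + 1)) 𝓘(ℝ, E (m + 1)) C.toM p : E (m + 1) →L[ℝ] E (m + 1)))
include hgs hβ

/-- The identity map is C³ here, so the pull-back of a C² field under it has C² components in every
chart. -/
theorem contDiffAt_compB_of_eq_pullback {p : C.Glued} (hp : C.toM p ∈ s) :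
    ContDiffAt ℝ 2 (compB (chartAt (E (m + 1)) p) β) (chartAt (E (m + 1)) p p) := by
  have : IsManifold 𝓘(ℝ, E (m + 1)) 3 M := inferInstance
  set k := chartAt (E (m + 1)) p with hk
  have hkp : k.symm (k p) = p := k.left_inv (mem_chart_source _ _)
  set A : Set (E (m + 1)) := k.target ∩ k.symm ⁻¹' (C.toM ⁻¹' s) with hAdef
  have hA : IsOpen A := k.isOpen_inter_preimage_symm hs
  have hmem : k p ∈ A := ⟨k.map_source (mem_chart_source _ _), by
    change C.toM (k.symm (k p)) ∈ s
    rwa [hkp]⟩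
  have hsymm := contMDiffOn_symm_of_mem_maximalAtlas (I := 𝓘(ℝ, E (m + 1))) (n := 3)
    (IsManifold.subset_maximalAtlas (chart_mem_atlas (E (m + 1)) p))
  have hsymm' : ∀ y ∈ A, ContMDiffAt 𝓘(ℝ, E (m + 1)) 𝓘(ℝ, E (m + 1)) 3 k.symm y := fun y hy =>
    hsymm.contMDiffAt (k.open_target.mem_nhds hy.1)
  have hF : ContMDiffOn 𝓘(ℝ, E (m + 1)) 𝓘(ℝ, E (m + 1)) 3 (C.toM ∘ k.symm) A := fun y hy =>
    (ContMDiffAt.comp y (contMDiffAt_toM hs hat hy.2) (hsymm' y hy)).contMDiffWithinAt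
  have heq : ∀ y ∈ A, compB k β y = pullback (g.form ((C.toM ∘ k.symm) y))
      (mfderivWithin 𝓘(ℝ, E (m + 1)) 𝓘(ℝ, E (m + 1)) (C.toM ∘ k.symm) A y :
        E (m + 1) →L[ℝ] E (m + 1)) := by
    intro y hy
    have h1 := mfderiv_comp y ((contMDiffAt_toM hs hat hy.2).mdifferentiableAt (by norm_num))
      ((hsymm' y hy).mdifferentiableAt (by norm_num))
    have h2 := mfderivWithin_of_isOpen (I := 𝓘(ℝ, E (m + 1))) (I' := 𝓘(ℝ, E (m + 1)))
      (f := C.toM ∘ k.symm) hA hy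
    change pullback (β.form (k.symm y)) (mfderiv 𝓘(ℝ, E (m + 1)) 𝓘(ℝ, E (m + 1)) k.symm y :
        E (m + 1) →L[ℝ] E (m + 1)) = _
    rw [hβ _ hy.2]
    exact congrArg (fun L : E (m + 1) →L[ℝ] E (m + 1) =>
      pullback (g.form (C.toM (k.symm y))) L) (h2.trans h1).symm
  have hc : ContDiffWithinAt ℝ 2 (compB k β) A (k p) := by
    refine contDiffWithinAt_bilin_of_apply fun v w => ?_
    have h1 := contDiffOn_pullback_apply hgs (F := C.toM ∘ k.symm)
      hA.uniqueDiffOn hF Subset.rfl (fun y hy => hy.2) v w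
    refine (h1 _ hmem).congr (fun z hz => ?_) ?_
    · rw [heq _ hz]; rfl
    · rw [heq _ hmem]; rfl
  exact hc.contDiffAt (hA.mem_nhds hmem)

end Inner

end Collar

section

variable {m : ℕ} {M S : Type*} [TopologicalSpace M] [ChartedSpace (E (m + 1)) M]
  [TopologicalSpace S] [ChartedSpace (E m) S]

/-- Σ is embedded onto the frontier of `Ω`, a closed subset of the compact closure. All uniform
bounds rest on this. -/
theorem Domain.compactSpace (D : Domain m M S) : CompactSpace S := by
  rw [← isCompact_univ_iff, D.isSmoothEmbedding.isEmbedding.isCompact_iff, image_univ, D.range_ι]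
  exact D.isCompact_closure.of_isClosed_subset isClosed_frontier frontier_subset_closure

end

/-! ### Symmetry, positivity and regularity of the metrics -/

namespace Collar

variable {m : ℕ} {M S : Type*} [TopologicalSpace M] [ChartedSpace (E (m + 1)) M]
  [TopologicalSpace S] [ChartedSpace (E m) S] {D : Domain m M S} {C : Collar D}
  {gm gp : BilinField (m + 1) M} {a h : ℝ → ℝ} {r : ℝ}

theorem restr_mem_gluedAtlas_inner (e : OpenPartialHomeomorph M (E (m + 1)))
    (he : e ∈ atlas (E (m + 1)) M) : e.restr D.Ω ∈ C.gluedAtlas := Or.inl ⟨e, he, rfl⟩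

theorem restr_mem_gluedAtlas_outer (e : OpenPartialHomeomorph M (E (m + 1)))
    (he : e ∈ atlas (E (m + 1)) M) : e.restr (closure D.Ω)ᶜ ∈ C.gluedAtlas :=
  Or.inr (Or.inl ⟨e, he, rfl⟩)

variable [IsManifold 𝓘(ℝ, E m) ∞ S] [IsManifold 𝓘(ℝ, E (m + 1)) ∞ M]

theorem gluedMetric_inner (p : C.Glued) (hp : C.toM p ∈ D.Ω) :
    (C.gluedMetric gm gp).form p = pullback (gm.form (C.toM p))
    (mfderiv 𝓘(ℝ, E (m + 1)) 𝓘(ℝ, E (m + 1)) C.toM p : E (m + 1) →L[ℝ] E (m + 1)) := by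
  rw [C.gluedMetric_of_mem (subset_closure hp)]
  have h1 : C.toM ⁻¹' closure D.Ω ∈ 𝓝 p :=
    mem_of_superset (D.isOpen.mem_nhds hp : D.Ω ∈ 𝓝 (C.toM p)) subset_closure
  rw [mfderivWithin_of_mem_nhds h1]
  rfl

theorem gluedMetric_outer (p : C.Glued) (hp : C.toM p ∈ (closure D.Ω)ᶜ) :
    (C.gluedMetric gm gp).form p = pullback (gp.form (C.toM p))
    (mfderiv 𝓘(ℝ, E (m + 1)) 𝓘(ℝ, E (m + 1)) C.toM p : E (m + 1) →L[ℝ] E (m + 1)) := by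
  rw [C.gluedMetric_of_notMem hp]
  have h1 : C.toM ⁻¹' D.Ωᶜ ∈ 𝓝 p :=
    mem_of_superset (isClosed_closure.isOpen_compl.mem_nhds hp : (closure D.Ω)ᶜ ∈ 𝓝 (C.toM p))
      (compl_subset_compl.2 subset_closure)
  rw [mfderivWithin_of_mem_nhds h1]
  rfl

theorem mem_or_of_notMem_target {p : M} (hp : p ∉ C.Φ.target) :
    p ∈ D.Ω ∨ p ∈ (closure D.Ω)ᶜ := by
  by_contra! h'
  refine hp (C.mem_target_of_mem_frontier ?_)
  rw [D.isOpen.frontier_eq]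
  exact ⟨not_not.1 h'.2, h'.1⟩

theorem gluedMetric_symm (hg : IsCornerMetric D gm gp) (p : C.Glued)
    (v w : E (m + 1)) : (C.gluedMetric gm gp).form p v w = (C.gluedMetric gm gp).form p w v := by
  by_cases hp : C.toM p ∈ closure D.Ω
  · rw [C.gluedMetric_of_mem hp]
    exact hg.minus.symm _ hp _ _
  · rw [C.gluedMetric_of_notMem hp]
    exact hg.plus.symm _ (fun h' => hp (subset_closure h')) _ _

theorem gluedMetric_pos (hg : IsCornerMetric D gm gp) (hC : C.IsGaussian gm gp) (p : C.Glued)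
    (v : E (m + 1)) (hv : v ≠ 0) : 0 < (C.gluedMetric gm gp).form p v v := by
  by_cases hp : C.toM p ∈ C.Φ.target
  · obtain ⟨x, t, ht, rfl⟩ := exists_eq_pt hp
    rcases le_total t 0 with h0 | h0
    · rw [gluedMetric_pt_of_nonpos hg hC x ⟨ht.1, h0⟩]
      exact (C.isHalf_minus hg hC).halfForm_pos x ⟨ht.1, h0⟩ v hv
    · rw [gluedMetric_pt_of_nonneg hg hC x ⟨h0, ht.2⟩]
      exact (C.isHalf_plus hg hC).halfForm_pos x ⟨h0, ht.2⟩ v hv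
  · rcases mem_or_of_notMem_target hp with hp | hp
    · rw [gluedMetric_inner p hp]
      exact hg.minus.pos _ (subset_closure hp) _ fun h0 =>
        hv (mfderiv_toM_injective D.isOpen restr_mem_gluedAtlas_inner hp h0)
    · rw [gluedMetric_outer p hp]
      exact hg.plus.pos _ (fun h' => hp (subset_closure h')) _ fun h0 =>
        hv (mfderiv_toM_injective isClosed_closure.isOpen_compl restr_mem_gluedAtlas_outer hp h0)

theorem IsCutoff.smoothMetric_symm (ha : IsCutoff C.ε r a h) (hg : IsCornerMetric D gm gp)
    (hC : C.IsGaussian gm gp) (p : C.Glued) (v w : E (m + 1)) :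
    (C.smoothMetric gm gp a h).form p v w = (C.smoothMetric gm gp a h).form p w v := by
  by_cases hp : C.toM p ∈ C.Φ.target
  · obtain ⟨x, t, ht, rfl⟩ := exists_eq_pt hp
    have h1 := C.isHalf_minus hg hC
    have h2 := C.isHalf_plus hg hC
    rw [smoothMetric_pt x ht, smoothForm]
    simp only [add_apply, sub_apply]
    rw [h1.halfForm_symm x (ha.left_mem t ht) v w, h2.halfForm_symm x (ha.right_mem t ht) v w,
      h1.halfForm_symm x h1.zero_mem v w]
  · rw [smoothMetric_of_notMem hp]
    exact gluedMetric_symm hg p v w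

/-- In the collar this is the regularity of the substituted form. Elsewhere the glued metric is C²,
but a point on the edge of the collar has collar points in each of its neighbourhoods; one must know
that the smoothed metric still equals the glued one near such a point. -/
theorem IsCutoff.contDiffAt_compB [T2Space M] (ha : IsCutoff C.ε r a h) (hr : 0 < r)
    (hg : IsCornerMetric D gm gp) (hC : C.IsGaussian gm gp) (p : C.Glued) :
    ContDiffAt ℝ 2 (compB (chartAt (E (m + 1)) p) (C.smoothMetric gm gp a h))
      (chartAt (E (m + 1)) p p) := by
  by_cases hp : C.toM p ∈ C.Φ.target
  · obtain ⟨x, t, ht, rfl⟩ := exists_eq_pt hp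
    have h1 := (chartAt (E (m + 1)) (C.pt x t)).map_source (mem_chart_source _ _)
    rw [C.chartAt_pt x ht] at h1 ⊢
    rw [gluedChart_target] at h1
    exact contDiffAt_compB_smoothMetric ha hg hC (chart_mem_atlas _ _) h1
  · have h1 : ContDiffAt ℝ 2 (compB (chartAt (E (m + 1)) p) (C.gluedMetric gm gp))
        (chartAt (E (m + 1)) p p) := by
      rcases mem_or_of_notMem_target hp with hp | hp
      · exact contDiffAt_compB_of_eq_pullback D.isOpen restr_mem_gluedAtlas_inner
          (hg.minus.contMDiffOn.mono subset_closure) gluedMetric_inner hp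
      · exact contDiffAt_compB_of_eq_pullback isClosed_closure.isOpen_compl
          restr_mem_gluedAtlas_outer (hg.plus.contMDiffOn.mono
          (compl_subset_compl.2 subset_closure)) gluedMetric_outer hp
    have := D.compactSpace
    have hsub : (univ : Set S) ×ˢ Icc (-r) r ⊆ C.Φ.source := by
      rw [C.source_eq]
      exact prod_mono_right fun t ht => ⟨by linarith [ht.1, ha.lt], by linarith [ht.2, ha.lt]⟩
    -- The closed inner strip is compact, hence closed in the Hausdorff space `M`; its complement is
    -- a neighbourhood of `p` where nothing was changed.
    have hK : IsCompact (C.Φ '' ((univ : Set S) ×ˢ Icc (-r) r)) :=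
      (isCompact_univ.prod isCompact_Icc).image_of_continuousOn (C.Φ.continuousOn.mono hsub)
    have hp1 : C.toM p ∈ (C.Φ '' ((univ : Set S) ×ˢ Icc (-r) r))ᶜ := by
      rintro ⟨q, hq, hqp⟩
      exact hp (hqp ▸ C.Φ.map_source (hsub hq))
    have hV : C.toM ⁻¹' (C.Φ '' ((univ : Set S) ×ˢ Icc (-r) r))ᶜ ∈ 𝓝 p :=
      hK.isClosed.isOpen_compl.mem_nhds hp1
    set k := chartAt (E (m + 1)) p with hk
    have hkp : k.symm (k p) = p := k.left_inv (mem_chart_source _ _)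
    have hev : ∀ᶠ y in 𝓝 (k p),
        k.symm y ∈ C.toM ⁻¹' (C.Φ '' ((univ : Set S) ×ˢ Icc (-r) r))ᶜ := by
      refine k.symm.continuousAt (x := k p) (k.map_source (mem_chart_source _ _)) ?_
      rwa [hkp]
    refine h1.congr_of_eventuallyEq ?_
    filter_upwards [hev] with y hy
    have h2 : k.symm y ∉ C.strip r := by
      rintro ⟨x, t, ht, hxt⟩
      refine hy ⟨(x, t), ⟨mem_univ _, abs_le.1 ht.le⟩, ?_⟩
      rw [hxt]
      rfl
    exact congrArg (fun B : BL (m + 1) => pullback B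
      (mfderiv 𝓘(ℝ, E (m + 1)) 𝓘(ℝ, E (m + 1)) k.symm y : E (m + 1) →L[ℝ] E (m + 1)))
      (ha.smoothMetric_eq hr hg hC h2)

/-- The smoothed metric as a Riemannian metric. -/
def IsCutoff.riemannianMetric [T2Space M] (ha : IsCutoff C.ε r a h) (hr : 0 < r)
    (hg : IsCornerMetric D gm gp) (hC : C.IsGaussian gm gp)
    (hpos : ∀ (p : C.Glued) (v : E (m + 1)), v ≠ 0 → 0 < (C.smoothMetric gm gp a h).form p v v) :
    Bundle.ContMDiffRiemannianMetric 𝓘(ℝ, E (m + 1)) 2 (E (m + 1))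
      (fun p : C.Glued => TangentSpace 𝓘(ℝ, E (m + 1)) p) where
  inner := C.smoothMetric gm gp a h
  symm := ha.smoothMetric_symm hg hC
  pos := hpos
  isVonNBounded p := isVonNBounded_of_pos (hpos p)
  contMDiff p := contMDiffAt_section_of_compB (ha.contDiffAt_compB hr hg hC p)

end Collar

/-! ### Gram sums and differentials of charts -/

/-- The Gram matrix is block diagonal, so the tangential block of its inverse is the inverse of the
tangential block. -/
theorem Normal.contr_eq {m : ℕ} {B R : BL (m + 1)} (hB : Normal B)
    (hdet : IsUnit (gram B).det) (hR : ∀ v, R (bv 0) v = 0) :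
    contr (gram B) (gram R) = ∑ i : Fin m, ∑ j : Fin m,
      (Matrix.of fun i j : Fin m => B (bv i.succ) (bv j.succ))⁻¹ i j
        * R (bv i.succ) (bv j.succ) := by
  have hinv : (Matrix.of fun i j : Fin m => B (bv i.succ) (bv j.succ))⁻¹
      = Matrix.of fun i j : Fin m => (gram B)⁻¹ i.succ j.succ := by
    refine Matrix.inv_eq_right_inv ?_
    ext i j
    have h1 : (gram B * (gram B)⁻¹) i.succ j.succ = (1 : Matrix _ _ ℝ) i.succ j.succ := by
      rw [Matrix.mul_nonsing_inv _ hdet]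
    rw [Matrix.mul_apply, Fin.sum_univ_succ, hB.inv_zero hdet, if_neg (Fin.succ_ne_zero j),
      mul_zero, zero_add] at h1
    rw [Matrix.mul_apply]
    refine h1.trans ?_
    simp [Matrix.one_apply]
  rw [hinv, contr, Fin.sum_univ_succ, Fin.sum_univ_succ]
  simp only [gram_apply, hR, mul_zero, Finset.sum_const_zero, add_zero, zero_add]
  refine Finset.sum_congr rfl fun i _ => ?_
  rw [Fin.sum_univ_succ, hB.inv_zero' hdet, if_neg (Fin.succ_ne_zero i), zero_mul, zero_add]
  rfl

theorem bilin_eq_sum {n : ℕ} (B : BL n) (u v : E n) :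
    B u v = ∑ k, ∑ l, gram B k l * u k * v l := by
  conv_lhs => rw [sum_smul_bv u, sum_smul_bv v]
  simp only [map_sum, map_smul, sum_apply, smul_apply, smul_eq_mul, gram_apply, Finset.mul_sum]
  rw [Finset.sum_comm]
  exact Finset.sum_congr rfl fun k _ => Finset.sum_congr rfl fun l _ => by ring

/-- The differential of a chart. -/
def dChart {n : ℕ} {N : Type*} [TopologicalSpace N] [ChartedSpace (E n) N]
    (e : OpenPartialHomeomorph N (E n)) (p : N) : E n →L[ℝ] E n :=
  mfderiv 𝓘(ℝ, E n) 𝓘(ℝ, E n) e p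

/-- The differential of the inverse of a chart. -/
def dChartSymm {n : ℕ} {N : Type*} [TopologicalSpace N] [ChartedSpace (E n) N]
    (e : OpenPartialHomeomorph N (E n)) (y : E n) : E n →L[ℝ] E n :=
  mfderiv 𝓘(ℝ, E n) 𝓘(ℝ, E n) e.symm y

theorem compB_eq {n : ℕ} {N : Type*} [TopologicalSpace N] [ChartedSpace (E n) N]
    (e : OpenPartialHomeomorph N (E n)) (g : BilinField n N) (y : E n) :
    compB e g y = pullback (g.form (e.symm y)) (dChartSymm e y) := rfl

theorem dChartSymm_comp_dChart {n : ℕ} {N : Type*} [TopologicalSpace N] [ChartedSpace (E n) N]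
    [IsManifold 𝓘(ℝ, E n) 1 N] {e : OpenPartialHomeomorph N (E n)} (he : e ∈ atlas (E n) N)
    {p : N} (hp : p ∈ e.source) :
    dChartSymm e (e p) ∘L dChart e p = ContinuousLinearMap.id ℝ (E n) :=
  (mdifferentiable_of_mem_atlas (I := 𝓘(ℝ, E n)) he).symm_comp_deriv hp

theorem dChart_comp_dChartSymm {n : ℕ} {N : Type*} [TopologicalSpace N] [ChartedSpace (E n) N]
    [IsManifold 𝓘(ℝ, E n) 1 N] {e : OpenPartialHomeomorph N (E n)} (he : e ∈ atlas (E n) N)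
    {y : E n} (hy : y ∈ e.target) :
    dChart e (e.symm y) ∘L dChartSymm e y = ContinuousLinearMap.id ℝ (E n) :=
  (mdifferentiable_of_mem_atlas (I := 𝓘(ℝ, E n)) he).comp_symm_deriv hy

theorem contDiffOn_compB {n : ℕ} {N : Type*} [TopologicalSpace N] [ChartedSpace (E n) N]
    [IsManifold 𝓘(ℝ, E n) 3 N] [IsManifold 𝓘(ℝ, E n) 1 N] {g : BilinField n N} {s : Set N}
    (hg : SectionOn g s) {e : OpenPartialHomeomorph N (E n)} (he : e ∈ atlas (E n) N) :
    ContDiffOn ℝ 2 (compB e g) (e.target ∩ e.symm ⁻¹' s) := by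
  intro y hy
  have h0 := contMDiffOn_symm_of_mem_maximalAtlas (I := 𝓘(ℝ, E n)) (n := 3)
    (IsManifold.subset_maximalAtlas he)
  refine contDiffWithinAt_bilin_of_apply fun v w => ?_
  have h1 := contDiffOn_pullback_apply hg (F := e.symm) e.open_target.uniqueDiffOn h0
    (inter_subset_left (t := e.symm ⁻¹' s)) (fun y hy => hy.2) v w
  have h2 : ∀ y ∈ e.target ∩ e.symm ⁻¹' s, compB e g y v w
      = g (e.symm y) (mfderivWithin 𝓘(ℝ, E n) 𝓘(ℝ, E n) e.symm e.target y v)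
        (mfderivWithin 𝓘(ℝ, E n) 𝓘(ℝ, E n) e.symm e.target y w) := fun y hy => by
    rw [mfderivWithin_of_isOpen e.open_target hy.1]
    rfl
  exact (h1 y hy).congr h2 (h2 y hy)

/-! ### The half collar read in charts -/

namespace Collar

variable {m : ℕ} {M S : Type*} [TopologicalSpace M] [ChartedSpace (E (m + 1)) M]
  [TopologicalSpace S] [ChartedSpace (E m) S] {D : Domain m M S} {C : Collar D}
  [IsManifold 𝓘(ℝ, E m) ∞ S] [IsManifold 𝓘(ℝ, E (m + 1)) ∞ M]
  {g : BilinField (m + 1) M} {s : Set M} {J : Set ℝ}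

/-- The domain of the half collar in the coordinates `c` and `e`. -/
def halfDomain (C : Collar D) (J : Set ℝ) (c : OpenPartialHomeomorph S (E m))
    (e : OpenPartialHomeomorph M (E (m + 1))) : Set (E (m + 1)) :=
  box c J ∩ (C.Φ ∘ param c) ⁻¹' e.source

/-- The half collar in the coordinates `c` and `e`. -/
def halfMap (C : Collar D) (c : OpenPartialHomeomorph S (E m))
    (e : OpenPartialHomeomorph M (E (m + 1))) (y : E (m + 1)) : E (m + 1) :=
  e (C.Φ (param c y))

namespace IsHalf

variable (h : C.IsHalf g s J) {c : OpenPartialHomeomorph S (E m)} (hc : c ∈ atlas (E m) S)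
  {e : OpenPartialHomeomorph M (E (m + 1))} (he : e ∈ atlas (E (m + 1)) M)
include h hc

theorem preimage_mem_nhdsWithin {y : E (m + 1)} (hy : y ∈ C.halfDomain J c e) :
    (C.Φ ∘ param c) ⁻¹' e.source ∈ 𝓝[box c J] y :=
  ((h.contMDiffOn_comp_param hc).continuousOn y hy.1).preimage_mem_nhdsWithin
    (e.open_source.mem_nhds hy.2)

theorem uniqueDiffOn_halfDomain : UniqueDiffOn ℝ (C.halfDomain J c e) := fun y hy =>
  (uniqueDiffOn_box c h.uniqueDiffOn y hy.1).inter' (h.preimage_mem_nhdsWithin hc hy)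

/-- Moving along the normal line into the interior of `J` gives nearby interior points. One-sided
second derivatives are symmetric only at limits of interior points. -/
theorem mem_closure_interior_halfDomain {y : E (m + 1)} (hy : y ∈ C.halfDomain J c e) :
    y ∈ closure (interior (C.halfDomain J c e)) := by
  obtain ⟨W, hW, hyW, hWs⟩ := mem_nhdsWithin.1 (h.preimage_mem_nhdsWithin hc hy)
  rw [mem_closure_iff]
  intro O hO hyO
  have h1 : y 0 ∈ closure (interior J) := by
    rw [h.convex.closure_interior_eq_closure_of_nonempty_interior h.interior_nonempty]
    exact subset_closure hy.1.2
  have hcont : Continuous (line y) :=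
    continuous_iff_continuousAt.2 fun t => (hasDerivAt_line y t).continuousAt
  obtain ⟨t, ht, htJ⟩ := mem_closure_iff.1 h1 (line y ⁻¹' (O ∩ W)) ((hO.inter hW).preimage hcont)
    (by rw [mem_preimage, line_self]; exact ⟨hyO, hyW⟩)
  have h2 : line y t ∈ box c (interior J) := line_mem_box hy.1 htJ
  refine ⟨line y t, ht.1, mem_interior.2 ⟨box c (interior J) ∩ W, fun z hz => ?_,
    (isOpen_box c isOpen_interior).inter hW, h2, ht.2⟩⟩
  have h3 : z ∈ box c J := ⟨hz.1.1, interior_subset hz.1.2⟩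
  exact ⟨h3, hWs ⟨hz.2, h3⟩⟩

include he

theorem contDiffOn_halfMap : ContDiffOn ℝ 3 (C.halfMap c e) (C.halfDomain J c e) := by
  have : IsManifold 𝓘(ℝ, E (m + 1)) 3 M := inferInstance
  have h1 := contMDiffOn_of_mem_maximalAtlas (I := 𝓘(ℝ, E (m + 1))) (n := 3)
    (IsManifold.subset_maximalAtlas he)
  exact contMDiffOn_iff_contDiffOn.1
    (h1.comp ((h.contMDiffOn_comp_param hc).mono inter_subset_left) fun y hy => hy.2)

theorem fderivWithin_halfMap {y : E (m + 1)} (hy : y ∈ C.halfDomain J c e) :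
    fderivWithin ℝ (C.halfMap c e) (C.halfDomain J c e) y
      = dChart e (C.Φ (param c y)) ∘L
        (C.dHalf J (param c y) ∘L ((coord m).symm : E (m + 1) →L[ℝ] E m × ℝ) ∘L dParam c y) := by
  have : IsManifold 𝓘(ℝ, E (m + 1)) 1 M := inferInstance
  have h1 := (mdifferentiableAt_atlas (I := 𝓘(ℝ, E (m + 1))) he hy.2).hasMFDerivAt
  have h2 := (h.hasMFDerivWithinAt_comp_param hc hy.1).mono
    (inter_subset_left (t := (C.Φ ∘ param c) ⁻¹' e.source))
  have h3 := HasMFDerivAt.comp_hasMFDerivWithinAt y h1 h2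
  have h4 : HasFDerivWithinAt (C.halfMap c e)
      (dChart e (C.Φ (param c y)) ∘L
        (C.dHalf J (param c y) ∘L ((coord m).symm : E (m + 1) →L[ℝ] E m × ℝ) ∘L dParam c y))
      (C.halfDomain J c e) y := hasMFDerivWithinAt_iff_hasFDerivWithinAt.1 h3
  exact h4.fderivWithin (h.uniqueDiffOn_halfDomain hc y hy)

/-- This presents the collar components as a one-sided pull-back of the chart components of `M`, the
situation of `koszul_pullback`. -/
theorem halfComp_eq_pullback {y : E (m + 1)} (hy : y ∈ C.halfDomain J c e) :
    C.halfComp g J c y = pullback (compB e g (C.halfMap c e y))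
      (fderivWithin ℝ (C.halfMap c e) (C.halfDomain J c e) y) := by
  have : IsManifold 𝓘(ℝ, E (m + 1)) 1 M := inferInstance
  have hy' : C.Φ (param c y) ∈ e.source := hy.2
  rw [h.fderivWithin_halfMap hc he hy, compB_eq, pullback_comp, ← ContinuousLinearMap.comp_assoc,
    halfMap, dChartSymm_comp_dChart he hy', ContinuousLinearMap.id_comp, halfComp, halfForm,
    pullback_comp, e.left_inv hy']
  rfl

end IsHalf

end Collar

/-! ### Mean curvature as the trace of the normal derivative -/

namespace Collar

variable {m : ℕ}

/-- The inclusion of `ℝᵐ` as the hyperplane of height zero. -/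
def slice (m : ℕ) : E m →L[ℝ] E (m + 1) :=
  (coord m : (E m × ℝ) →L[ℝ] E (m + 1)) ∘L ContinuousLinearMap.inl ℝ (E m) ℝ

theorem slice_apply (z : E m) : slice m z = coord m (z, 0) := rfl

theorem slice_bv (i : Fin m) : slice m (bv i) = bv i.succ := coord_bv_succ i

theorem coord_symm_slice (z : E m) : (coord m).symm (slice m z) = (z, 0) :=
  (coord m).symm_apply_apply _

theorem slice_zero (z : E m) : slice m z 0 = 0 := rfl

variable {M S : Type*} [TopologicalSpace M] [ChartedSpace (E (m + 1)) M]
  [TopologicalSpace S] [ChartedSpace (E m) S] {D : Domain m M S} {C : Collar D}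
  {g : BilinField (m + 1) M} {s : Set M} {J : Set ℝ}

theorem param_slice (c : OpenPartialHomeomorph S (E m)) (z : E m) :
    param c (slice m z) = (c.symm z, 0) := by
  rw [param, coord_symm_slice, slice_zero]

theorem halfMap_slice (x : S) (z : E m) :
    C.halfMap (chartAt (E m) x) (chartAt (E (m + 1)) (D.ι x)) (slice m z) = D.param x z := by
  rw [halfMap, param_slice, C.zero]
  rfl

variable [IsManifold 𝓘(ℝ, E m) ∞ S] [IsManifold 𝓘(ℝ, E (m + 1)) ∞ M]

namespace IsHalf

variable (h : C.IsHalf g s J)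
include h

theorem slice_mem {c : OpenPartialHomeomorph S (E m)}
    {e : OpenPartialHomeomorph M (E (m + 1))} {z : E m}
    (hz : z ∈ c.target) (hz' : D.ι (c.symm z) ∈ e.source) : slice m z ∈ C.halfDomain J c e := by
  refine ⟨⟨by rwa [coord_symm_slice], by rw [slice_zero]; exact h.zero_mem⟩, ?_⟩
  rw [mem_preimage, Function.comp_apply, param_slice, C.zero]
  exact hz'

theorem eventually_slice_mem {c : OpenPartialHomeomorph S (E m)}
    {e : OpenPartialHomeomorph M (E (m + 1))} {z : E m}
    (hz : z ∈ c.target) (hz' : D.ι (c.symm z) ∈ e.source) :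
    ∀ᶠ w in 𝓝 z, slice m w ∈ C.halfDomain J c e := by
  have h1 : ContinuousAt (fun w => D.ι (c.symm w)) z :=
    (D.isSmoothEmbedding.isEmbedding.continuous.continuousAt).comp (c.continuousAt_symm hz)
  filter_upwards [h1 (e.open_source.mem_nhds hz'), c.open_target.mem_nhds hz] with w hw hw'
  exact h.slice_mem hw' hw

/-- The local parametrization of Σ is the half collar restricted to height zero, so its derivatives
are tangential one-sided derivatives of `halfMap`. -/
theorem hasFDerivAt_param {x : S} {z : E m} (hz : z ∈ (chartAt (E m) x).target)
    (hz' : D.ι ((chartAt (E m) x).symm z) ∈ (chartAt (E (m + 1)) (D.ι x)).source) :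
    HasFDerivAt (D.param x) (fderivWithin ℝ
      (C.halfMap (chartAt (E m) x) (chartAt (E (m + 1)) (D.ι x)))
      (C.halfDomain J (chartAt (E m) x) (chartAt (E (m + 1)) (D.ι x))) (slice m z) ∘L slice m) z := by
  have hc := chart_mem_atlas (E m) x
  have he := chart_mem_atlas (E (m + 1)) (D.ι x)
  have h1 := ((h.contDiffOn_halfMap hc he).differentiableOn (by norm_num) _
    (h.slice_mem hz hz')).hasFDerivWithinAt
  have h2 := h1.comp_hasFDerivAt (f := slice m) z (slice m).hasFDerivAt
    (h.eventually_slice_mem hz hz')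
  exact h2.congr_of_eventuallyEq (Eventually.of_forall fun w => (halfMap_slice x w).symm)

theorem param₁_eq {x : S} {z : E m} (hz : z ∈ (chartAt (E m) x).target)
    (hz' : D.ι ((chartAt (E m) x).symm z) ∈ (chartAt (E (m + 1)) (D.ι x)).source) (i : Fin m)
    (k : Fin (m + 1)) : D.param₁ x i k z = fderivWithin ℝ
      (C.halfMap (chartAt (E m) x) (chartAt (E (m + 1)) (D.ι x)))
      (C.halfDomain J (chartAt (E m) x) (chartAt (E (m + 1)) (D.ι x))) (slice m z) (bv i.succ) k := by
  have h1 := ((EuclideanSpace.proj k : E (m + 1) →L[ℝ] ℝ).hasFDerivAt).comp z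
    (h.hasFDerivAt_param hz hz')
  have h2 : HasFDerivAt (fun z' => D.param x z' k) _ z := h1
  rw [Domain.param₁, pderiv, fderivWithin_univ, h2.fderiv]
  simp only [ContinuousLinearMap.comp_apply]
  rw [← slice_bv]
  rfl

theorem pderiv_param₁_eq {x : S} {z : E m} (hz : z ∈ (chartAt (E m) x).target)
    (hz' : D.ι ((chartAt (E m) x).symm z) ∈ (chartAt (E (m + 1)) (D.ι x)).source) (i j : Fin m)
    (k : Fin (m + 1)) : pderiv univ i (D.param₁ x j k) z = fderivWithin ℝ (fderivWithin ℝ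
      (C.halfMap (chartAt (E m) x) (chartAt (E (m + 1)) (D.ι x)))
      (C.halfDomain J (chartAt (E m) x) (chartAt (E (m + 1)) (D.ι x))))
      (C.halfDomain J (chartAt (E m) x) (chartAt (E (m + 1)) (D.ι x))) (slice m z)
        (bv i.succ) (bv j.succ) k := by
  have hc := chart_mem_atlas (E m) x
  have he := chart_mem_atlas (E (m + 1)) (D.ι x)
  have h1 := (((h.contDiffOn_halfMap hc he).fderivWithin (m := 2)
    (h.uniqueDiffOn_halfDomain hc) (by norm_num)).differentiableOn (by norm_num) _
    (h.slice_mem hz hz')).hasFDerivWithinAt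
  have h2 := h1.comp_hasFDerivAt (f := slice m) z (slice m).hasFDerivAt
    (h.eventually_slice_mem hz hz')
  have h3 := h2.clm_apply (hasFDerivAt_const (bv j.succ) z)
  have h4 := ((EuclideanSpace.proj k : E (m + 1) →L[ℝ] ℝ).hasFDerivAt).comp z h3
  have h5 := h4.congr_of_eventuallyEq (f₁ := D.param₁ x j k) (by
    have hι : ContinuousAt (fun w => D.ι ((chartAt (E m) x).symm w)) z :=
      (D.isSmoothEmbedding.isEmbedding.continuous.continuousAt).comp
        ((chartAt (E m) x).continuousAt_symm hz)
    filter_upwards [hι ((chartAt (E (m + 1)) (D.ι x)).open_source.mem_nhds hz'),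
      (chartAt (E m) x).open_target.mem_nhds hz] with w hw hw'
    exact h.param₁_eq hw' hw j k)
  rw [pderiv, fderivWithin_univ, h5.fderiv]
  simp only [ContinuousLinearMap.comp_apply, add_apply, ContinuousLinearMap.flip_apply,
    zero_apply, map_zero, zero_add]
  rw [show (EuclideanSpace.single i (1 : ℝ) : E m) = bv i from rfl, slice_bv]
  rfl

theorem halfComp_fderiv_normal {c : OpenPartialHomeomorph S (E m)} (hc : c ∈ atlas (E m) S)
    {y : E (m + 1)} (hy : y ∈ box c J) (u v : E (m + 1)) :
    fderivWithin ℝ (C.halfComp g J c) (box c J) y u (bv 0) v = 0 ∧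
      fderivWithin ℝ (C.halfComp g J c) (box c J) y u v (bv 0) = 0 := by
  have hu := uniqueDiffOn_box c h.uniqueDiffOn y hy
  have h1 := ((h.contDiffOn_halfComp hc).differentiableOn (by norm_num) y hy).hasFDerivWithinAt
  have h3 : HasFDerivWithinAt (fun _ : E (m + 1) => v 0) (0 : E (m + 1) →L[ℝ] ℝ) (box c J) y :=
    hasFDerivWithinAt_const _ _ _
  have h2 : ∀ v w : E (m + 1), HasFDerivWithinAt (fun y => C.halfComp g J c y v w)
      ((fderivWithin ℝ (C.halfComp g J c) (box c J) y).flip v |>.flip w) (box c J) y := fun v w => by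
    have := (h1.clm_apply (hasFDerivWithinAt_const v y (box c J))).clm_apply
      (hasFDerivWithinAt_const w y (box c J))
    refine this.congr_fderiv ?_
    ext u
    simp
  constructor
  · have h4 := hu.eq (h3.congr (fun y hy => (h.halfComp_normal hy v).1)
      (h.halfComp_normal hy v).1) (h2 (bv 0) v)
    exact (congrArg (fun L : E (m + 1) →L[ℝ] ℝ => L u) h4).symm
  · have h4 := hu.eq (h3.congr (fun y hy => (h.halfComp_normal hy v).2)
      (h.halfComp_normal hy v).2) (h2 v (bv 0))
    exact (congrArg (fun L : E (m + 1) →L[ℝ] ℝ => L u) h4).symm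

theorem compB_pos {e : OpenPartialHomeomorph M (E (m + 1))} (he : e ∈ atlas (E (m + 1)) M)
    {y : E (m + 1)} (hy : y ∈ e.target ∩ e.symm ⁻¹' s) (v : E (m + 1)) (hv : v ≠ 0) :
    0 < compB e g y v v := by
  have : IsManifold 𝓘(ℝ, E (m + 1)) 1 M := inferInstance
  refine h.metric.pos _ hy.2 _ fun h0 => hv ?_
  have h1 := congrArg (fun L : E (m + 1) →L[ℝ] E (m + 1) => L v) (dChart_comp_dChartSymm he hy.1)
  have h2 : dChart e (e.symm y) (dChartSymm e y v) = 0 :=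
    (congrArg (dChart e (e.symm y)) h0).trans (map_zero _)
  exact h1.symm.trans h2

/-- The second fundamental form in Gaussian coordinates. -/
theorem secondFundamentalForm_eq (x : S) (i j : Fin m) :
    D.secondFundamentalForm s g x (show E (m + 1) from C.dHalf J (x, 0) (0, 1)) i j
      = 1 / 2 * fderivWithin ℝ (C.halfComp g J (chartAt (E m) x)) (box (chartAt (E m) x) J)
        (slice m (chartAt (E m) x x)) (bv 0) (bv i.succ) (bv j.succ) := by
  have i3 : IsManifold 𝓘(ℝ, E (m + 1)) 3 M := inferInstance
  have i1 : IsManifold 𝓘(ℝ, E (m + 1)) 1 M := inferInstance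
  set c := chartAt (E m) x with hcdef
  set e := chartAt (E (m + 1)) (D.ι x) with hedef
  have hc : c ∈ atlas (E m) S := chart_mem_atlas _ _
  have he : e ∈ atlas (E (m + 1)) M := chart_mem_atlas _ _
  set z := c x with hz
  have hzt : z ∈ c.target := c.map_source (mem_chart_source _ _)
  have hzx : c.symm z = x := c.left_inv (mem_chart_source _ _)
  have hze : D.ι (c.symm z) ∈ e.source := by rw [hzx]; exact mem_chart_source _ _
  set y := slice m z with hy
  set A := C.halfDomain J c e with hA
  set Ψ := C.halfMap c e with hΨ
  have hyA : y ∈ A := h.slice_mem hzt hze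
  have hparam : param c y = (x, 0) := by rw [hy, param_slice, hzx]
  have hY : Ψ y = e (D.ι x) := by rw [hΨ, halfMap, hparam, C.zero]
  set T := e.target ∩ e.symm ⁻¹' s with hT
  have hmaps : MapsTo Ψ A T := fun w hw => by
    refine ⟨e.map_source hw.2, ?_⟩
    change e.symm (e (C.Φ (param c w))) ∈ s
    rw [show e.symm (e (C.Φ (param c w))) = C.Φ (param c w) from e.left_inv hw.2]
    exact h.mem _ _ hw.1.2
  have hYT : Ψ y ∈ T := hmaps hyA
  have hΨd := ((h.contDiffOn_halfMap hc he).differentiableOn (by norm_num) _ hyA).hasFDerivWithinAt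
  have hΨdd := (((h.contDiffOn_halfMap hc he).fderivWithin (m := 2)
    (h.uniqueDiffOn_halfDomain hc) (by norm_num)).differentiableOn (by norm_num) _
    hyA).hasFDerivWithinAt
  have hGd := ((contDiffOn_compB h.metric.contMDiffOn he).differentiableOn (by norm_num) _
    hYT).hasFDerivWithinAt
  have hGtd := (((h.contDiffOn_halfComp hc).differentiableOn (by norm_num) y
    hyA.1).hasFDerivWithinAt).mono (inter_subset_left (t := (C.Φ ∘ param c) ⁻¹' e.source))
  have hsymm : ∀ v w, compB e g (Ψ y) v w = compB e g (Ψ y) w v := fun v w =>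
    h.metric.symm _ hYT.2 _ _
  have hΨs := ((h.contDiffOn_halfMap hc he) y hyA).isSymmSndFDerivWithinAt (by simp; norm_num)
    (h.uniqueDiffOn_halfDomain hc) (h.mem_closure_interior_halfDomain hc hyA) hyA
  -- Koszul law for `∂ᵢ, ∂ⱼ, ∂ₜ`: in collar coordinates the expression is `-½ ∂ₜγᵢⱼ`, in the chart
  -- of `M` it becomes `g(∇ᵢ∂ⱼf, ν)`.
  have key := koszul_pullback hΨd hΨdd hGd hmaps hGtd (h.uniqueDiffOn_halfDomain hc y hyA) hyA
    (fun w hw => h.halfComp_eq_pullback hc he hw) hsymm (fun u v => hΨs u v)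
    (bv i.succ) (bv j.succ) (bv 0)
  set Ψ' := fderivWithin ℝ Ψ A with hΨ'
  -- A vector in the kernel would have length zero for the positive definite pull-back; in equal
  -- dimensions injectivity gives surjectivity.
  have hsurj : Function.Surjective (Ψ' y) := by
    refine LinearMap.surjective_of_injective (f := (Ψ' y : E (m + 1) →ₗ[ℝ] E (m + 1))) ?_
    rw [← LinearMap.ker_eq_bot, LinearMap.ker_eq_bot']
    intro v hv
    by_contra h0
    have h1 := h.halfComp_pos hc hyA.1 v h0
    rw [h.halfComp_eq_pullback hc he hyA, pullback_apply] at h1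
    have hv' : Ψ' y v = 0 := hv
    rw [hv'] at h1
    simp at h1
  -- The side of Σ in the chart of `M` inherits unique differentiability from the half collar, whose
  -- image it contains.
  have hTu : UniqueDiffWithinAt ℝ T (Ψ y) :=
    (hΨd.uniqueDiffWithinAt (h.uniqueDiffOn_halfDomain hc y hyA) hsurj.denseRange).mono
      (image_subset_iff.2 hmaps)
  have hdet := isUnit_gram (h.compB_pos he hYT)
  rw [← inner_christoffelMap hGd hTu hdet hsymm] at key
  have hν : Ψ' y (bv 0) = dChart e (D.ι x) (C.dHalf J (x, 0) (0, 1)) := by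
    rw [show Ψ' y = _ from h.fderivWithin_halfMap hc he hyA]
    simp only [ContinuousLinearMap.comp_apply]
    rw [dParam_bv_zero, hparam, C.zero]
    exact congrArg (fun v => dChart e (D.ι x) (C.dHalf J (x, 0) v)) coord_symm_bv_zero
  have hform : D.secondFundamentalForm s g x (show E (m + 1) from C.dHalf J (x, 0) (0, 1)) i j
      = - ∑ k, ∑ l, gram (compB e g (e (D.ι x))) k l
          * (dChart e (D.ι x) (C.dHalf J (x, 0) (0, 1))) k *
        (pderiv univ i (D.param₁ x j l) z
          + ∑ a, ∑ b, christoffel T (fun w => gram (compB e g w)) l a b (e (D.ι x))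
            * D.param₁ x i a z * D.param₁ x j b z) := rfl
  rw [hform, ← hY, ← hν]
  have hsum : ∀ l, pderiv univ i (D.param₁ x j l) z
      + ∑ a, ∑ b, christoffel T (fun w => gram (compB e g w)) l a b (Ψ y)
            * D.param₁ x i a z * D.param₁ x j b z
      = (fderivWithin ℝ Ψ' A y (bv i.succ) (bv j.succ)
        + christoffelMap T (compB e g) (Ψ y) (Ψ' y (bv i.succ)) (Ψ' y (bv j.succ))) l := fun l => by
    rw [PiLp.add_apply, christoffelMap_apply, h.pderiv_param₁_eq hzt hze]
    refine congrArg _ (Finset.sum_congr rfl fun a _ => Finset.sum_congr rfl fun b _ => ?_)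
    rw [h.param₁_eq hzt hze, h.param₁_eq hzt hze]
  have hsum' : ∀ k l, gram (compB e g (Ψ y)) k l * Ψ' y (bv 0) k *
        (pderiv univ i (D.param₁ x j l) z
          + ∑ a, ∑ b, christoffel T (fun w => gram (compB e g w)) l a b (Ψ y)
            * D.param₁ x i a z * D.param₁ x j b z) = _ := fun k l => by rw [hsum l]
  rw [Finset.sum_congr rfl fun k _ => Finset.sum_congr rfl fun l _ => hsum' k l]
  -- The derivatives of the entries `g(∂ⱼ, ∂ₜ)` vanish, so only the normal derivative of `γᵢⱼ` is
  -- left.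
  rw [← bilin_eq_sum, hsymm, map_add, add_apply, add_comm, ← key, koszul_apply,
    (h.halfComp_fderiv_normal hc hyA.1 _ _).2, (h.halfComp_fderiv_normal hc hyA.1 _ _).2]
  ring

/-- The induced metric is the tangential block of the collar components, and contraction sees only
this block because the normal derivative has no normal components. -/
theorem meanCurvature_eq (x : S) :
    D.meanCurvature s g x (show E (m + 1) from C.dHalf J (x, 0) (0, 1))
      = 1 / 2 * contr (gram (C.halfComp g J (chartAt (E m) x) (slice m (chartAt (E m) x x))))
        (gram (fderivWithin ℝ (C.halfComp g J (chartAt (E m) x)) (box (chartAt (E m) x) J)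
          (slice m (chartAt (E m) x x)) (bv 0))) := by
  set c := chartAt (E m) x with hcdef
  set e := chartAt (E (m + 1)) (D.ι x) with hedef
  have hc : c ∈ atlas (E m) S := chart_mem_atlas _ _
  have he : e ∈ atlas (E (m + 1)) M := chart_mem_atlas _ _
  set z := c x with hz
  have hzt : z ∈ c.target := c.map_source (mem_chart_source _ _)
  have hzx : c.symm z = x := c.left_inv (mem_chart_source _ _)
  have hze : D.ι (c.symm z) ∈ e.source := by rw [hzx]; exact mem_chart_source _ _
  have hyA : slice m z ∈ C.halfDomain J c e := h.slice_mem hzt hze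
  have hY : C.halfMap c e (slice m z) = e (D.ι x) := by
    rw [halfMap, param_slice, hzx, C.zero]
  have hind : D.inducedMetric g x = Matrix.of fun i j : Fin m =>
      C.halfComp g J c (slice m z) (bv i.succ) (bv j.succ) := by
    ext i j
    have h1 : D.inducedMetric g x i j = ∑ k, ∑ l, gram (compB e g (e (D.ι x))) k l
      * D.param₁ x i k z * D.param₁ x j l z := rfl
    rw [h1, ← hY]
    simp only [h.param₁_eq hzt hze]
    rw [← bilin_eq_sum, Matrix.of_apply, h.halfComp_eq_pullback hc he hyA, pullback_apply]
  have hmean : D.meanCurvature s g x (show E (m + 1) from C.dHalf J (x, 0) (0, 1))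
      = ∑ i, ∑ j, (D.inducedMetric g x)⁻¹ i j * D.secondFundamentalForm s g x
        (show E (m + 1) from C.dHalf J (x, 0) (0, 1)) i j := rfl
  rw [hmean, (h.halfComp_normal hyA.1).contr_eq (isUnit_gram (h.halfComp_pos hc hyA.1))
    (fun v => (h.halfComp_fderiv_normal hc hyA.1 _ _).1), hind,
    Finset.mul_sum]
  refine Finset.sum_congr rfl fun i _ => ?_
  rw [Finset.mul_sum]
  refine Finset.sum_congr rfl fun j _ => ?_
  rw [h.secondFundamentalForm_eq]
  ring

end IsHalf

end Collar

/-! ### Uniform bounds over the compact hypersurface -/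

theorem hasDerivWithinAt_pullback {n : ℕ} {f : ℝ → BL n} {f' : BL n} {J : Set ℝ} {t : ℝ}
    (hf : HasDerivWithinAt f f' J t) (L : E n →L[ℝ] E n) :
    HasDerivWithinAt (fun s => pullback (f s) L) (pullback f' L) J t :=
  (((ContinuousLinearMap.compL ℝ (E n) (E n →L[ℝ] ℝ) (E n →L[ℝ] ℝ) (L.precomp ℝ)) ∘L
    ((ContinuousLinearMap.compL ℝ (E n) (E n) (E n →L[ℝ] ℝ)).flip L)).hasFDerivAt
    ).comp_hasDerivWithinAt t hf

theorem LineBound.mono {m : ℕ} {F : Type*} [NormedAddCommGroup F] [NormedSpace ℝ F]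
    {G : E (m + 1) → F} {A : Set (E (m + 1))} {y : E (m + 1)} {I : Set ℝ} {B B' : ℝ}
    (h : LineBound G A y I B) (hB : B ≤ B') : LineBound G A y I B' :=
  ⟨h.convex, h.mem, fun s hs => (h.fderiv_le s hs).trans hB,
    fun s hs => (h.fderiv_fderiv_le s hs).trans hB⟩

theorem Coercive.mono {n : ℕ} {G : BL n} {lam lam' : ℝ} (h : Coercive lam G) (hl : lam' ≤ lam) :
    Coercive lam' G := fun v =>
  (mul_le_mul_of_nonneg_right hl (by positivity)).trans (h v)

namespace Collar

variable {m : ℕ} {M S : Type*} [TopologicalSpace M] [ChartedSpace (E (m + 1)) M]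
  [TopologicalSpace S] [ChartedSpace (E m) S] {D : Domain m M S} {C : Collar D}
  {g : BilinField (m + 1) M} {s : Set M} {J : Set ℝ}
  [IsManifold 𝓘(ℝ, E m) ∞ S] [IsManifold 𝓘(ℝ, E (m + 1)) ∞ M]

theorem exists_equiv_dParam {c : OpenPartialHomeomorph S (E m)} (hc : c ∈ atlas (E m) S)
    {y : E (m + 1)} (hy : ((coord m).symm y).1 ∈ c.target) :
    ∃ L : E (m + 1) ≃L[ℝ] E (m + 1), (L : E (m + 1) →L[ℝ] E (m + 1)) = dParam c y := by
  have hinj : Function.Injective (dParam c y : E (m + 1) →ₗ[ℝ] E (m + 1)) := by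
    rw [← LinearMap.ker_eq_bot, LinearMap.ker_eq_bot']
    exact fun v hv => dParam_injective hc hy hv
  refine ⟨(LinearEquiv.ofInjectiveEndo _ hinj).toContinuousLinearEquiv, ?_⟩
  ext1 v
  rfl

theorem line_coord (z : E m) (t s : ℝ) : line (coord m (z, t)) s = coord m (z, s) := by
  apply (coord m).symm.injective
  rw [coord_symm_line, ContinuousLinearEquiv.symm_apply_apply,
    ContinuousLinearEquiv.symm_apply_apply]

theorem coord_mem_box {c : OpenPartialHomeomorph S (E m)} {x : S} (hx : x ∈ c.source) {t : ℝ}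
    (ht : t ∈ J) : coord m (c x, t) ∈ box c J :=
  ⟨by rw [ContinuousLinearEquiv.symm_apply_apply]; exact c.map_source hx, ht⟩

theorem param_coord {c : OpenPartialHomeomorph S (E m)} {x : S} (hx : x ∈ c.source) (t : ℝ) :
    param c (coord m (c x, t)) = (x, t) := by
  rw [param, ContinuousLinearEquiv.symm_apply_apply, c.left_inv hx, coord_zero]

/-- `dParam` is constant along the normal line, so it passes through the normal derivative and drops
out of the contraction. The right-hand side mentions no chart, which makes the left-hand side
independent of `c`. -/
theorem IsHalf.contr_halfComp_eq (h : C.IsHalf g s J) {c : OpenPartialHomeomorph S (E m)}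
    (hc : c ∈ atlas (E m) S) {x : S} (hx : x ∈ c.source) :
    contr (gram (C.halfComp g J c (coord m (c x, 0))))
        (gram (fderivWithin ℝ (C.halfComp g J c) (box c J) (coord m (c x, 0)) (bv 0)))
      = contr (gram (C.halfForm g J (x, 0)))
        (gram (derivWithin (fun t => C.halfForm g J (x, t)) J 0)) := by
  set y := coord m (c x, 0) with hy
  have hyb : y ∈ box c J := coord_mem_box hx h.zero_mem
  obtain ⟨L, hL⟩ := exists_equiv_dParam hc hyb.1
  have hform : ∀ t, C.halfForm g J (x, t)
      = pullback (C.halfComp g J c (line y t)) (L.symm : E (m + 1) →L[ℝ] E (m + 1)) := fun t => by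
    rw [halfComp_line, hy, param_coord hx, ← hy, ← hL, pullback_comp]
    simp only [ContinuousLinearEquiv.coe_comp_coe_symm]
    rfl
  have h0 : line y 0 = y := by rw [hy, line_coord]
  have h1 := ((h.contDiffOn_halfComp hc).differentiableOn (by norm_num) (line y 0)
    (by rwa [h0])).hasFDerivWithinAt
  have h2 : HasDerivWithinAt (fun t => C.halfComp g J c (line y t))
      (fderivWithin ℝ (C.halfComp g J c) (box c J) (line y 0) (bv 0)) J 0 :=
    h1.comp_hasDerivWithinAt 0 (hasDerivAt_line y 0).hasDerivWithinAt
      (fun t ht => line_mem_box hyb ht)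
  have h3 := hasDerivWithinAt_pullback h2 (L.symm : E (m + 1) →L[ℝ] E (m + 1))
  simp only [← hform] at h3
  rw [h3.derivWithin (h.uniqueDiffOn 0 h.zero_mem), hform, h0]
  exact (contr_gram_pullback _ _ L.symm).symm

/-- The mean curvature is half the trace of the normal derivative of the metric. -/
theorem IsHalf.two_mul_meanCurvature_eq (h : C.IsHalf g s J) {c : OpenPartialHomeomorph S (E m)}
    (hc : c ∈ atlas (E m) S) {x : S} (hx : x ∈ c.source) :
    2 * D.meanCurvature s g x (show E (m + 1) from C.dHalf J (x, 0) (0, 1))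
      = contr (gram (C.halfComp g J c (coord m (c x, 0))))
        (gram (fderivWithin ℝ (C.halfComp g J c) (box c J) (coord m (c x, 0)) (bv 0))) := by
  rw [h.contr_halfComp_eq hc hx,
    ← h.contr_halfComp_eq (chart_mem_atlas _ _) (mem_chart_source (E m) x), h.meanCurvature_eq]
  simp only [slice_apply]
  ring

-- The components and their one-sided derivatives are continuous up to Σ, hence bounded over the
-- compact set `K × I`. The normal line through a point does not depend on its height, so `t` is
-- arbitrary in the first bound.
set_option synthInstance.maxHeartbeats 200000 in
theorem IsHalf.exists_lineBound (h : C.IsHalf g s J) {c : OpenPartialHomeomorph S (E m)}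
    (hc : c ∈ atlas (E m) S) {K : Set S} (hK : IsCompact K) (hKc : K ⊆ c.source) {I : Set ℝ}
    (hI : IsCompact I) (hIc : Convex ℝ I) (hIJ : I ⊆ J) :
    ∃ B lam : ℝ, 0 < lam ∧ ∀ x ∈ K, ∀ t,
      LineBound (C.halfComp g J c) (box c J) (coord m (c x, t)) I B ∧
      ∀ t ∈ I, Coercive lam (C.halfComp g J c (coord m (c x, t))) := by
  have hu := uniqueDiffOn_box c h.uniqueDiffOn
  set Q : Set (E (m + 1)) := (fun q : S × ℝ => coord m (c q.1, q.2)) '' (K ×ˢ I) with hQ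
  have hQc : IsCompact Q := by
    refine (hK.prod hI).image_of_continuousOn ((coord m).continuous.comp_continuousOn ?_)
    exact (c.continuousOn.comp continuousOn_fst fun q hq => hKc hq.1).prodMk continuousOn_snd
  have hQb : Q ⊆ box c J := by
    rintro _ ⟨q, hq, rfl⟩
    exact coord_mem_box (hKc hq.1) (hIJ hq.2)
  have hd := h.contDiffOn_halfComp hc
  have hd1 := hd.fderivWithin hu (m := 1) (by norm_num)
  have hd2 := hd1.fderivWithin hu (m := 0) (by norm_num)
  obtain ⟨B1, hB1⟩ := hQc.exists_bound_of_continuousOn (hd1.continuousOn.mono hQb)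
  obtain ⟨B2, hB2⟩ := hQc.exists_bound_of_continuousOn (hd2.continuousOn.mono hQb)
  obtain ⟨lam, hlam, hco⟩ := exists_coercive hQc (hd.continuousOn.mono hQb)
    (fun y hy => h.halfComp_pos hc (hQb hy))
  refine ⟨max B1 B2, lam, hlam, fun x hx t => ⟨⟨hIc, fun s hs => ?_, fun s hs => ?_,
    fun s hs => ?_⟩, fun t ht => hco _ ⟨(x, t), ⟨hx, ht⟩, rfl⟩⟩⟩
  · rw [line_coord]
    exact coord_mem_box (hKc hx) (hIJ hs)
  · rw [line_coord]
    exact (hB1 _ ⟨(x, s), ⟨hx, hs⟩, rfl⟩).trans (le_max_left _ _)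
  · rw [line_coord]
    exact (hB2 _ ⟨(x, s), ⟨hx, hs⟩, rfl⟩).trans (le_max_right _ _)

/-- Uniform bounds for the two metrics near `x`, in the coordinates of a chart `c`. -/
structure ChartBound (C : Collar D) (gm gp : BilinField (m + 1) M)
    (c : OpenPartialHomeomorph S (E m)) (x : S) (B lam : ℝ) : Prop where
  mem_atlas : c ∈ atlas (E m) S
  mem_source : x ∈ c.source
  minus : ∀ t, LineBound (C.halfComp gm C.heightsMinus c) (box c C.heightsMinus)
    (coord m (c x, t)) (Icc (-C.ε) 0) B
  plus : ∀ t, LineBound (C.halfComp gp C.heightsPlus c) (box c C.heightsPlus)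
    (coord m (c x, t)) (Icc 0 C.ε) B
  coercive_minus : ∀ t ∈ Icc (-C.ε) 0,
    Coercive lam (C.halfComp gm C.heightsMinus c (coord m (c x, t)))
  coercive_plus : ∀ t ∈ Icc 0 C.ε,
    Coercive lam (C.halfComp gp C.heightsPlus c (coord m (c x, t)))

theorem ChartBound.mono {gm gp : BilinField (m + 1) M} {c : OpenPartialHomeomorph S (E m)} {x : S}
    {B lam B' lam' : ℝ} (h : ChartBound C gm gp c x B lam) (hB : B ≤ B') (hl : lam' ≤ lam) :
    ChartBound C gm gp c x B' lam' :=
  ⟨h.mem_atlas, h.mem_source, fun t => (h.minus t).mono hB,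
    fun t => (h.plus t).mono hB,
    fun t ht => (h.coercive_minus t ht).mono hl,
    fun t ht => (h.coercive_plus t ht).mono hl⟩

/-- The chart may vary with `x` but the constants may not: compact neighbourhoods inside chart
domains give local constants, and compactness of Σ combines them. -/
theorem exists_chartBound (C : Collar D) {gm gp : BilinField (m + 1) M}
    (hg : IsCornerMetric D gm gp) (hC : C.IsGaussian gm gp) :
    ∃ B lam : ℝ, 0 < lam ∧ ∀ x : S, ∃ c, ChartBound C gm gp c x B lam := by
  have := D.compactSpace
  have := ChartedSpace.locallyCompactSpace (E m) S
  have main : ∃ B lam : ℝ, 0 < lam ∧ ∀ x ∈ (univ : Set S), ∃ c, ChartBound C gm gp c x B lam := by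
    refine isCompact_univ.induction_on
      (p := fun K => ∃ B lam : ℝ, 0 < lam ∧ ∀ x ∈ K, ∃ c, ChartBound C gm gp c x B lam)
      ⟨0, 1, one_pos, by simp⟩ ?_ ?_ ?_
    · rintro K K' hK ⟨B, lam, hlam, h⟩
      exact ⟨B, lam, hlam, fun x hx => h x (hK hx)⟩
    · rintro K K' ⟨B, lam, hlam, h⟩ ⟨B', lam', hlam', h'⟩
      refine ⟨max B B', min lam lam', lt_min hlam hlam', fun x hx => ?_⟩
      rcases hx with hx | hx
      · obtain ⟨c, hc⟩ := h x hx
        exact ⟨c, hc.mono (le_max_left _ _) (min_le_left _ _)⟩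
      · obtain ⟨c, hc⟩ := h' x hx
        exact ⟨c, hc.mono (le_max_right _ _) (min_le_right _ _)⟩
    · intro x _
      set c := chartAt (E m) x with hcdef
      have hc : c ∈ atlas (E m) S := chart_mem_atlas _ _
      obtain ⟨K, hKx, hKc, hK⟩ := LocallyCompactSpace.local_compact_nhds x c.source
        (c.open_source.mem_nhds (mem_chart_source _ x))
      have hε := C.ε_pos
      obtain ⟨B, lam, hlam, h⟩ := (C.isHalf_minus hg hC).exists_lineBound hc hK hKc
        (isCompact_Icc (a := -C.ε) (b := 0)) (convex_Icc _ _)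
        (fun t ht => ⟨by linarith [ht.1], ht.2⟩)
      obtain ⟨B', lam', hlam', h'⟩ := (C.isHalf_plus hg hC).exists_lineBound hc hK hKc
        (isCompact_Icc (a := 0) (b := C.ε)) (convex_Icc _ _)
        (fun t ht => ⟨ht.1, by linarith [ht.2]⟩)
      refine ⟨K, mem_nhdsWithin_of_mem_nhds hKx, max B B', min lam lam', lt_min hlam hlam',
        fun y hy => ⟨c, hc, hKc hy, fun t => (h y hy t).1.mono (le_max_left _ _),
          fun t => (h' y hy t).1.mono (le_max_right _ _), fun t ht =>
          ((h y hy 0).2 t ht).mono (min_le_left _ _), fun t ht =>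
          ((h' y hy 0).2 t ht).mono (min_le_right _ _)⟩⟩
  obtain ⟨B, lam, hlam, h⟩ := main
  exact ⟨B, lam, hlam, fun x => h x (mem_univ x)⟩

end Collar

/-! ### Closeness of the smoothed metric to the glued metric -/

theorem IsProfile.mem_Icc {K δ : ℝ} {φ h : ℝ → ℝ} (hh : IsProfile K φ δ h) (hδ : δ ∈ Ioc (0 : ℝ) 1)
    {t : ℝ} (ht : |t| ≤ δ / 2) : h t ∈ Icc 0 δ := by
  refine ⟨hh.nonneg t, ?_⟩
  have h1 := (abs_le.1 (hh.abs_sub_le t)).2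
  have h2 : max t 0 ≤ δ / 2 := max_le ((le_abs_self t).trans ht) (by linarith [hδ.1])
  nlinarith [hδ.1, hδ.2]

theorem IsProfile.mem_Ico {K δ r : ℝ} {φ h : ℝ → ℝ} (hh : IsProfile K φ δ h)
    (hδ : δ ∈ Ioc (0 : ℝ) 1) (hr : δ < r) {t : ℝ} (ht : t < r) : h t ∈ Ico 0 r := by
  have h0 := hδ.1
  rcases le_or_gt |t| (δ / 2) with h1 | h1
  · exact ⟨hh.nonneg t, (hh.mem_Icc hδ h1).2.trans_lt hr⟩
  · refine ⟨hh.nonneg t, ?_⟩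
    rcases lt_abs.1 h1 with h2 | h2
    · rwa [hh.eq_self t h2.le]
    · rw [hh.eq_zero t (by linarith)]
      linarith

namespace Collar

theorem isCutoff_of_isProfile {K δ ε : ℝ} {φ h hm : ℝ → ℝ} (hh : IsProfile K φ δ h)
    (hhm : IsProfile K (fun t => φ (-t)) δ hm) (hδ : δ ∈ Ioc (0 : ℝ) 1) (hε : δ < ε) :
    IsCutoff ε (δ / 2) (reflect hm) h where
  contDiff_left := (hhm.contDiff.comp contDiff_neg).neg
  contDiff_right := hh.contDiff
  lt := by linarith [hδ.1]
  left_mem t ht := by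
    have := hhm.mem_Ico hδ (r := 2 * ε) (by linarith [hδ.1]) (t := -t) (by linarith [ht.1])
    exact ⟨neg_lt_neg this.2, neg_nonpos.2 this.1⟩
  right_mem t ht := hh.mem_Ico hδ (by linarith [hδ.1]) ht.2
  left_eq t ht := by
    refine ⟨?_, hh.eq_zero t ht⟩
    rw [reflect, hhm.eq_self _ (by linarith), neg_neg]
  right_eq t ht := by
    refine ⟨?_, hh.eq_self t ht⟩
    rw [reflect, hhm.eq_zero _ (by linarith), neg_zero]

variable {m : ℕ} {M S : Type*} [TopologicalSpace M] [ChartedSpace (E (m + 1)) M]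
  [TopologicalSpace S] [ChartedSpace (E m) S] {D : Domain m M S} {C : Collar D}
  {gm gp : BilinField (m + 1) M}
  [IsManifold 𝓘(ℝ, E m) ∞ S] [IsManifold 𝓘(ℝ, E (m + 1)) ∞ M]

theorem halfComp_zero_eq (hg : IsCornerMetric D gm gp) (hC : C.IsGaussian gm gp)
    {c : OpenPartialHomeomorph S (E m)} {x : S} (hx : x ∈ c.source) :
    C.halfComp gp C.heightsPlus c (coord m (c x, 0))
      = C.halfComp gm C.heightsMinus c (coord m (c x, 0)) := by
  rw [halfComp, halfComp, param_coord hx, C.halfForm_zero_eq hg hC]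

/-- The components of the glued metric at height `t`. -/
def gluedComp (C : Collar D) (gm gp : BilinField (m + 1) M) (c : OpenPartialHomeomorph S (E m))
    (x : S) (t : ℝ) : BL (m + 1) :=
  pullback ((C.gluedMetric gm gp).form (C.pt x t)) (dParam c (coord m (c x, t)))

theorem gluedComp_of_nonpos (hg : IsCornerMetric D gm gp) (hC : C.IsGaussian gm gp)
    {c : OpenPartialHomeomorph S (E m)} {x : S} (hx : x ∈ c.source) {t : ℝ}
    (ht : t ∈ C.heightsMinus) :
    C.gluedComp gm gp c x t = C.halfComp gm C.heightsMinus c (coord m (c x, t)) := by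
  rw [gluedComp, gluedMetric_pt_of_nonpos hg hC x ht, halfComp, param_coord hx]

theorem gluedComp_of_nonneg (hg : IsCornerMetric D gm gp) (hC : C.IsGaussian gm gp)
    {c : OpenPartialHomeomorph S (E m)} {x : S} (hx : x ∈ c.source) {t : ℝ}
    (ht : t ∈ C.heightsPlus) :
    C.gluedComp gm gp c x t = C.halfComp gp C.heightsPlus c (coord m (c x, t)) := by
  rw [gluedComp, gluedMetric_pt_of_nonneg hg hC x ht, halfComp, param_coord hx]

namespace ChartBound

variable {c : OpenPartialHomeomorph S (E m)} {x : S} {B lam K δ t : ℝ} {φ h hm : ℝ → ℝ}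
  (hb : ChartBound C gm gp c x B lam) (hg : IsCornerMetric D gm gp) (hC : C.IsGaussian gm gp)
  (hh : IsProfile K φ δ h) (hhm : IsProfile K (fun t => φ (-t)) δ hm)
  (hδ : δ ∈ Ioc (0 : ℝ) 1) (hε : δ < C.ε) (ht : |t| ≤ δ / 2)
include hb hg hC

theorem nonneg : 0 ≤ B :=
  (norm_nonneg _).trans ((hb.minus 0).fderiv_le 0 ⟨by linarith [C.ε_pos], le_rfl⟩)

theorem coercive_gluedComp (ht : |t| ≤ C.ε) : Coercive lam (C.gluedComp gm gp c x t) := by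
  have hε := C.ε_pos
  rcases le_total t 0 with h0 | h0
  · rw [gluedComp_of_nonpos hg hC hb.mem_source ⟨by linarith [(abs_le.1 ht).1], h0⟩]
    exact hb.coercive_minus t ⟨(abs_le.1 ht).1, h0⟩
  · rw [gluedComp_of_nonneg hg hC hb.mem_source ⟨h0, by linarith [(abs_le.1 ht).2]⟩]
    exact hb.coercive_plus t ⟨h0, (abs_le.1 ht).2⟩

include hh hhm hδ hε ht

/-- For `t ≤ 0` group the terms as `γ₋(a) - γ₋(t)` and `γ₊(h) - γ₊(0)`, for `t ≥ 0` as `γ₋(a) -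
γ₋(0)` and `γ₊(h) - γ₊(t)`. Each is Lipschitz in the deviation of a profile from `min t 0` or `max t
0`. -/
theorem norm_smoothed_sub_le :
    ‖smoothed (C.halfComp gm C.heightsMinus c) (C.halfComp gp C.heightsPlus c) (reflect hm) h
      (coord m (c x, t)) - C.gluedComp gm gp c x t‖ ≤ B * δ ^ 2 := by
  have hB := hb.nonneg hg hC
  have hε0 := C.ε_pos
  have hδ0 := hδ.1
  have ht1 := abs_le.1 ht
  have hM := (C.isHalf_minus hg hC).contDiffOn_halfComp hb.mem_atlas
  have hP := (C.isHalf_plus hg hC).contDiffOn_halfComp hb.mem_atlas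
  have hhI := hh.mem_Icc hδ ht
  have hmI := hhm.mem_Icc hδ (t := -t) (by rwa [abs_neg])
  have hhI' : h t ∈ Icc 0 C.ε := ⟨hhI.1, by linarith [hhI.2]⟩
  have hmI' : reflect hm t ∈ Icc (-C.ε) 0 := by
    rw [reflect]
    exact ⟨by linarith [hmI.2], by linarith [hmI.1]⟩
  have hz1 : (0 : ℝ) ∈ Icc (-C.ε) 0 := ⟨by linarith, le_rfl⟩
  have hz2 : (0 : ℝ) ∈ Icc 0 C.ε := ⟨le_rfl, by linarith⟩
  have e1 := hh.abs_sub_le t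
  have e2 := hhm.abs_sub_le (-t)
  -- Two deviations of `3δ²/100` stay below `δ²`.
  have hsum : ∀ a b : ℝ, a ≤ 3 * (δ ^ 2 / 100) → b ≤ 3 * (δ ^ 2 / 100) →
      B * a + B * b ≤ B * δ ^ 2 := fun a b ha hb => by
    rw [← mul_add]
    exact mul_le_mul_of_nonneg_left (by nlinarith [sq_nonneg δ]) hB
  rw [smoothed, coord_zero, line_coord, line_coord, line_coord]
  rcases le_total t 0 with h0 | h0
  · rw [gluedComp_of_nonpos hg hC hb.mem_source ⟨by linarith, h0⟩]
    rw [max_eq_right h0] at e1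
    rw [max_eq_left (by linarith)] at e2
    have n1 := (hb.minus t).norm_sub_le hM hmI' (⟨by linarith, h0⟩ : t ∈ Icc (-C.ε) 0)
    have n2 := (hb.plus t).norm_sub_le hP hhI' hz2
    rw [line_coord, line_coord] at n1 n2
    rw [halfComp_zero_eq hg hC hb.mem_source] at n2
    have hre : |reflect hm t - t| = |hm (-t) - -t| := by
      rw [reflect, ← abs_neg]; congr 1; ring
    rw [show ∀ X Y Z W : BL (m + 1), X + Y - Z - W = (X - W) + (Y - Z) by intros; abel]
    exact (norm_add_le _ _).trans ((add_le_add n1 n2).trans (hsum _ _ (hre ▸ e2) e1))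
  · rw [gluedComp_of_nonneg hg hC hb.mem_source ⟨h0, by linarith⟩]
    rw [max_eq_left h0] at e1
    rw [max_eq_right (by linarith)] at e2
    have n1 := (hb.minus t).norm_sub_le hM hmI' hz1
    have n2 := (hb.plus t).norm_sub_le hP hhI' (⟨h0, by linarith⟩ : t ∈ Icc 0 C.ε)
    rw [line_coord, line_coord] at n1 n2
    have hre : |reflect hm t - 0| = |hm (-t) - 0| := by
      rw [reflect, sub_zero, abs_neg, sub_zero]
    rw [show ∀ X Y Z W : BL (m + 1), X + Y - Z - W = (X - Z) + (Y - W) by intros; abel]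
    exact (norm_add_le _ _).trans ((add_le_add n1 n2).trans (hsum _ _ (hre ▸ e2) e1))

/-- Coercivity of the glued metric turns the error in norm into a relative error. -/
theorem abs_smoothed_sub_le (hlam : 0 < lam) (w : E (m + 1)) :
    |smoothed (C.halfComp gm C.heightsMinus c) (C.halfComp gp C.heightsPlus c) (reflect hm) h
      (coord m (c x, t)) w w - C.gluedComp gm gp c x t w w|
      ≤ B / lam * δ ^ 2 * C.gluedComp gm gp c x t w w := by
  have hB := hb.nonneg hg hC
  have h1 := hb.norm_smoothed_sub_le hg hC hh hhm hδ hε ht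
  have h2 := hb.coercive_gluedComp hg hC (ht.trans (by linarith [hδ.1])) w
  rw [← sub_apply, ← sub_apply, ← Real.norm_eq_abs]
  refine (ContinuousLinearMap.le_opNorm₂ _ _ _).trans ?_
  calc _ ≤ B * δ ^ 2 * ‖w‖ * ‖w‖ := by gcongr
    _ = B / lam * δ ^ 2 * (lam * ‖w‖ ^ 2) := by field_simp
    _ ≤ _ := by gcongr

theorem abs_smoothMetric_sub_le (hlam : 0 < lam) (v : E (m + 1)) :
    |(C.smoothMetric gm gp (reflect hm) h).form (C.pt x t) v v
      - (C.gluedMetric gm gp).form (C.pt x t) v v|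
      ≤ B / lam * δ ^ 2 * (C.gluedMetric gm gp).form (C.pt x t) v v := by
  have ht1 := abs_le.1 ht
  have ht2 : t ∈ Ioo (-(2 * C.ε)) (2 * C.ε) := by
    constructor <;> linarith [hδ.1]
  obtain ⟨L, hL⟩ := exists_equiv_dParam hb.mem_atlas
    (coord_mem_box (J := univ) hb.mem_source (mem_univ t)).1
  obtain ⟨w, rfl⟩ := L.surjective v
  have h1 := hb.abs_smoothed_sub_le hg hC hh hhm hδ hε ht hlam w
  rw [smoothed_halfComp, param_coord hb.mem_source, coord_zero, gluedComp, ← hL, pullback_apply,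
    pullback_apply] at h1
  rw [smoothMetric_pt x ht2]
  exact h1

end ChartBound

end Collar

/-! ### Assembling the construction -/

/-- Locality of the scalar curvature, read off from its invariance under the identity change of
coordinates. -/
theorem scalarLocal_congr {n : ℕ} {G Gt : E n → BL n} {y : E n} (h : Gt =ᶠ[𝓝 y] G)
    (hG : ContDiffAt ℝ 2 G y) (hsymm : ∀ᶠ z in 𝓝 y, ∀ v w, G z v w = G z w v)
    (hpos : ∀ᶠ z in 𝓝 y, ∀ v, v ≠ 0 → 0 < G z v v) :
    scalarLocal (fun z => gram (Gt z)) y = scalarLocal (fun z => gram (G z)) y := by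
  refine scalarLocal_pullback (Ψ := id) (ContinuousLinearEquiv.refl ℝ (E n)) contDiffAt_id
    fderiv_id hG hsymm hpos ?_
  filter_upwards [h] with z hz
  rw [hz, fderiv_id]
  rfl

namespace Collar

variable {m : ℕ} {M S : Type*} [TopologicalSpace M] [ChartedSpace (E (m + 1)) M]
  [TopologicalSpace S] [ChartedSpace (E m) S] {D : Domain m M S} {C : Collar D}
  {gm gp : BilinField (m + 1) M}
  [IsManifold 𝓘(ℝ, E m) ∞ S] [IsManifold 𝓘(ℝ, E (m + 1)) ∞ M]

theorem gluedChart_source (c : OpenPartialHomeomorph S (E m)) {x : S} (hx : x ∈ c.source) {t : ℝ}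
    (ht : t ∈ Ioo (-(2 * C.ε)) (2 * C.ε)) : C.pt x t ∈ (C.gluedChart c).source := by
  have h1 := C.mem_source x ht
  change C.Φ (x, t) ∈ (C.collarChart c).source
  simp [collarChart, C.Φ.left_inv h1, C.Φ.map_source h1, hx]

/-- The scalar curvature of the smoothed metric in the coordinates of a chart of `Σ`. -/
theorem scalarCurvature_smoothMetric {a h : ℝ → ℝ} {r : ℝ} (ha : IsCutoff C.ε r a h)
    (hg : IsCornerMetric D gm gp) (hC : C.IsGaussian gm gp)
    (hpos : ∀ (p : C.Glued) (v : E (m + 1)), v ≠ 0 → 0 < (C.smoothMetric gm gp a h).form p v v)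
    {c : OpenPartialHomeomorph S (E m)} (hc : c ∈ atlas (E m) S) {x : S} (hx : x ∈ c.source)
    {t : ℝ} (ht : t ∈ Ioo (-(2 * C.ε)) (2 * C.ε)) :
    scalarCurvature (C.smoothMetric gm gp a h) (C.pt x t)
      = scalarLocal (fun y => gram (smoothed (C.halfComp gm C.heightsMinus c)
          (C.halfComp gp C.heightsPlus c) a h y)) (coord m (c x, t)) := by
  have hy : coord m (c x, t) ∈ box c (Ioo (-(2 * C.ε)) (2 * C.ε)) := coord_mem_box hx ht
  have hbox := (isOpen_box c (isOpen_Ioo (a := -(2 * C.ε)) (b := 2 * C.ε))).mem_nhds hy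
  have hpt := C.gluedChart_pt c x ht
  -- The preferred chart is exchanged for the chart over `c`, where the uniform bounds hold.
  have h1 := scalarLocal_components_eq (g := C.smoothMetric gm gp a h) (ha.smoothMetric_symm hg hC) hpos
    (chart_mem_atlas (E (m + 1)) (C.pt x t)) (C.gluedChart_mem_atlas hc)
    (mem_chart_source (E (m + 1)) (C.pt x t)) (gluedChart_source c hx ht)
    (by rw [hpt]; exact contDiffAt_compB_smoothMetric ha hg hC hc hy)
  rw [scalarCurvature, h1, hpt, components_eq_gram]
  refine scalarLocal_congr (eventually_of_mem hbox fun z hz => compB_smoothMetric hc hz)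
    (contDiffAt_smoothed ha hg hC hc hy) ?_ ?_
  · filter_upwards [hbox] with z hz v w
    rw [smoothed_halfComp, pullback_apply, pullback_apply, ← smoothMetric_pt _ hz.2]
    exact ha.smoothMetric_symm hg hC _ _ _
  · filter_upwards [hbox] with z hz v hv
    rw [smoothed_halfComp, pullback_apply, ← smoothMetric_pt _ hz.2]
    exact hpos _ _ fun h0 => hv (dParam_injective hc hz.1 h0)

/-- The construction for a single `δ`, with a quantitative form of the uniform closeness. -/
theorem exists_metric [T2Space M] (C : Collar D) (hg : IsCornerMetric D gm gp)
    (hC : C.IsGaussian gm gp) :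
    ∃ δ₀ > 0, δ₀ ≤ 1 ∧ δ₀ < C.ε ∧ ∃ Q : ℝ, 0 ≤ Q ∧ ∃ B : ℝ, ∀ φ : ℝ → ℝ, IsMollifier φ →
      ∀ δ ∈ Ioc 0 δ₀, ∃ G : Bundle.ContMDiffRiemannianMetric 𝓘(ℝ, E (m + 1)) 2 (E (m + 1))
          (fun p : C.Glued => TangentSpace 𝓘(ℝ, E (m + 1)) p),
        (∀ (p : C.Glued) (v : TangentSpace 𝓘(ℝ, E (m + 1)) p),
          |G.inner p v v - C.gluedMetric gm gp p v v| ≤ Q * δ ^ 2 * C.gluedMetric gm gp p v v) ∧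
        (∀ p ∉ C.strip (δ / 2), G.inner p = C.gluedMetric gm gp p) ∧
        ∀ (x : S) (t : ℝ), |t| ≤ δ / 2 →
          |scalarCurvature G.inner (C.pt x t)
            - 2 * (C.Hminus gm x - C.Hplus gp x) * scaled φ δ t| ≤ B := by
  obtain ⟨B₀, lam, hlam, hcb₀⟩ := C.exists_chartBound hg hC
  -- If Σ is empty the bounds say nothing about the sign of `B₀`.
  set B := max B₀ 0 with hBdef
  have hB : 0 ≤ B := le_max_right _ _
  have hcb : ∀ x : S, ∃ c, ChartBound C gm gp c x B lam := fun x => by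
    obtain ⟨c, hc⟩ := hcb₀ x
    exact ⟨c, hc.mono (le_max_left _ _) le_rfl⟩
  obtain ⟨K, hK, hprof⟩ := exists_isProfile
  -- Half of `lam` is used because smoothing costs up to half of the coercivity.
  obtain ⟨R, hR⟩ := exists_abs_scalarLocal_smoothed_le m K B (lam / 2) hK (by positivity)
  have hε := C.ε_pos
  have hB1 : 0 < lam / (2 * (B + 1)) := by positivity
  -- The last entry forces the relative error `B δ²/lam` to be at most `1/2`, which keeps the
  -- smoothed metric positive definite.
  refine ⟨min (min 1 (C.ε / 2)) (lam / (2 * (B + 1))), by positivity,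
    (min_le_left _ _).trans (min_le_left _ _),
    ((min_le_left _ _).trans (min_le_right _ _)).trans_lt (by linarith), B / lam, by positivity, R,
    fun φ hφ δ hδ => ?_⟩
  have hδ1 : δ ∈ Ioc (0 : ℝ) 1 :=
    ⟨hδ.1, hδ.2.trans ((min_le_left _ _).trans (min_le_left _ _))⟩
  have hδε : δ < C.ε :=
    (hδ.2.trans ((min_le_left _ _).trans (min_le_right _ _))).trans_lt (by linarith)
  have hsmall : B / lam * δ ^ 2 ≤ 1 / 2 := by
    have h1 : δ ≤ lam / (2 * (B + 1)) := hδ.2.trans (min_le_right _ _)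
    have h2 : δ ^ 2 ≤ δ := by nlinarith [hδ1.1, hδ1.2]
    calc B / lam * δ ^ 2 ≤ (B + 1) / lam * (lam / (2 * (B + 1))) := by
          gcongr
          · linarith
          · exact h2.trans h1
      _ = 1 / 2 := by field_simp
  obtain ⟨h, hh⟩ := hprof φ hφ δ hδ1
  obtain ⟨hm, hhm⟩ := hprof (fun t => φ (-t)) hφ.reflect δ hδ1
  have hδ2 : 0 < δ / 2 := by linarith [hδ1.1]
  have ha := isCutoff_of_isProfile hh hhm hδ1 hδε
  have hclose : ∀ (p : C.Glued) (v : E (m + 1)),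
      |(C.smoothMetric gm gp (reflect hm) h).form p v v - (C.gluedMetric gm gp).form p v v|
        ≤ B / lam * δ ^ 2 * (C.gluedMetric gm gp).form p v v := fun p v => by
    by_cases hp : p ∈ C.strip (δ / 2)
    · obtain ⟨x, t, ht, rfl⟩ := hp
      obtain ⟨c, hc⟩ := hcb x
      exact hc.abs_smoothMetric_sub_le hg hC hh hhm hδ1 hδε ht.le hlam v
    · rw [ha.smoothMetric_eq hδ2 hg hC hp, sub_self, abs_zero]
      by_cases hv : v = 0
      · simp [hv]
      · have := gluedMetric_pos hg hC p v hv
        positivity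
  have hpos : ∀ (p : C.Glued) (v : E (m + 1)), v ≠ 0 →
      0 < (C.smoothMetric gm gp (reflect hm) h).form p v v := fun p v hv => by
    have h1 := gluedMetric_pos hg hC p v hv
    have h2 := (abs_le.1 (hclose p v)).1
    nlinarith
  refine ⟨ha.riemannianMetric hδ2 hg hC hpos, hclose,
    fun p hp => ha.smoothMetric_eq hδ2 hg hC hp, fun x t ht => ?_⟩
  have ht1 := abs_le.1 ht
  have ht2 : t ∈ Ioo (-(2 * C.ε)) (2 * C.ε) := by
    constructor <;> linarith [hδ1.1]
  obtain ⟨c, hc⟩ := hcb x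
  have e1 := C.isHalf_minus hg hC
  have e2 := C.isHalf_plus hg hC
  set y := coord m (c x, t) with hy
  have hy0 : y 0 = t := rfl
  have hl0 : line y 0 = coord m (c x, 0) := line_coord _ _ _
  have hscal := scalarCurvature_smoothMetric ha hg hC hpos hc.mem_atlas hc.mem_source ht2
  rw [← hy] at hscal
  have hhI := hh.mem_Icc hδ1 ht
  have hmI := hhm.mem_Icc hδ1 (t := -t) (by rwa [abs_neg])
  have hmain := hR (C.halfComp gm C.heightsMinus c) (C.halfComp gp C.heightsPlus c)
    (box c C.heightsMinus) (box c C.heightsPlus) (box c (Ioo (-(2 * C.ε)) (2 * C.ε)))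
    h hm φ δ y (Icc (-C.ε) 0) (Icc 0 C.ε) hφ hδ1.1 hh hhm (isOpen_box c isOpen_Ioo)
    (coord_mem_box hc.mem_source ht2)
    { uniqueDiffOn := uniqueDiffOn_box c e1.uniqueDiffOn
      contDiffOn := e1.contDiffOn_halfComp hc.mem_atlas
      maps := fun z hz => line_mem_box hz (ha.left_mem _ hz.2)
      bound := hc.minus t
      mem := by
        rw [hy0, reflect]
        exact ⟨by linarith [hmI.2], by linarith [hmI.1]⟩
      zero_mem := ⟨by linarith, le_rfl⟩
      normal := fun z hz => e1.halfComp_normal hz }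
    { uniqueDiffOn := uniqueDiffOn_box c e2.uniqueDiffOn
      contDiffOn := e2.contDiffOn_halfComp hc.mem_atlas
      maps := fun z hz => line_mem_box hz (ha.right_mem _ hz.2)
      bound := hc.plus t
      mem := by
        rw [hy0]
        exact ⟨hhI.1, by linarith [hhI.2]⟩
      zero_mem := ⟨le_rfl, by linarith⟩
      normal := fun z hz => e2.halfComp_normal hz }
    (fun z hz => line_mem_box hz e1.zero_mem)
    (by rw [hl0]; exact halfComp_zero_eq hg hC hc.mem_source)
    (fun w => by
      have h1 := (abs_le.1 (hc.abs_smoothed_sub_le hg hC hh hhm hδ1 hδε ht hlam w)).1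
      have h2 := hc.coercive_gluedComp hg hC (t := t) (ht.trans (by linarith)) w
      have h3 : 0 ≤ lam * ‖w‖ ^ 2 := by positivity
      nlinarith)
    (by
      rw [hl0]
      exact (hc.coercive_minus 0 ⟨by linarith, le_rfl⟩).mono (by linarith))
  -- The contraction of the jump of normal derivatives becomes `2 (H₊ - H₋)`; both traces are taken
  -- with the common metric on Σ.
  have hm1 := e1.two_mul_meanCurvature_eq hc.mem_atlas hc.mem_source
  have hm2 := e2.two_mul_meanCurvature_eq hc.mem_atlas hc.mem_source
  rw [halfComp_zero_eq hg hC hc.mem_source] at hm2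
  have hgs : ∀ X Y : BL (m + 1), gram (X - Y) = gram X - gram Y := fun X Y => rfl
  rw [← hscal, hl0, hy0, hgs, contr_sub, ← hm1, ← hm2] at hmain
  have hH1 : C.Hminus gm x = D.meanCurvature (closure D.Ω) gm x
    (show E (m + 1) from C.dHalf C.heightsMinus (x, 0) (0, 1)) := rfl
  have hH2 : C.Hplus gp x = D.meanCurvature D.Ωᶜ gp x
    (show E (m + 1) from C.dHalf C.heightsPlus (x, 0) (0, 1)) := rfl
  rw [hH1, hH2]
  refine le_trans (le_of_eq (congrArg _ ?_)) hmain
  change scalarCurvature (C.smoothMetric gm gp (reflect hm) h) (C.pt x t) - _ = _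
  ring

end Collar

end Corner
end

/-! ### Choice of the family of metrics -/

theorem mainTheorem3 {m : ℕ} (hm : 3 ≤ m + 1)
    {M : Type*} [TopologicalSpace M] [T2Space M] [SecondCountableTopology M]
    [ChartedSpace (Corner.E (m + 1)) M] [IsManifold 𝓘(ℝ, Corner.E (m + 1)) ∞ M]
    {S : Type*} [TopologicalSpace S] [ChartedSpace (Corner.E m) S]
    [IsManifold 𝓘(ℝ, Corner.E m) ∞ S]
    (D : Corner.Domain m M S) (gm gp : Corner.BilinField (m + 1) M)
    (hg : Corner.IsCornerMetric D gm gp)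
    (C : Corner.Collar D) (hC : C.IsGaussian gm gp) :
    ∃ δ₀ > 0, δ₀ < C.ε ∧ ∃ B : ℝ, ∀ φ : ℝ → ℝ, Corner.IsMollifier φ →
      ∃ gδ : ℝ → Bundle.ContMDiffRiemannianMetric 𝓘(ℝ, Corner.E (m + 1)) 2 (Corner.E (m + 1))
          (fun p : C.Glued => TangentSpace 𝓘(ℝ, Corner.E (m + 1)) p),
        (∀ η > 0, ∃ δ₁ > 0, ∀ δ ∈ Ioc 0 (min δ₀ δ₁), ∀ (p : C.Glued)
          (v : TangentSpace 𝓘(ℝ, Corner.E (m + 1)) p),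
          |(gδ δ).inner p v v - C.gluedMetric gm gp p v v| ≤ η * C.gluedMetric gm gp p v v) ∧
        ∀ δ ∈ Ioc 0 δ₀,
          (∀ p ∉ C.strip (δ / 2), (gδ δ).inner p = C.gluedMetric gm gp p) ∧
          (∀ (x : S) (t : ℝ), δ ^ 2 / 100 < |t| → |t| ≤ δ / 2 →
            |Corner.scalarCurvature (gδ δ).inner (C.pt x t)| ≤ B) ∧
          (∀ (x : S) (t : ℝ), |t| ≤ δ ^ 2 / 100 →
            |Corner.scalarCurvature (gδ δ).inner (C.pt x t)
              - 2 * (C.Hminus gm x - C.Hplus gp x) * (100 / δ ^ 2 * φ (100 * t / δ ^ 2))| ≤ B) := by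
  obtain ⟨δ₀, hδ₀, hδ₀1, hδ₀ε, Q, hQ, B, hB⟩ := C.exists_metric hg hC
  refine ⟨δ₀, hδ₀, hδ₀ε, B, fun φ hφ => ?_⟩
  -- A default metric: the family is indexed by all reals, and values outside `(0, δ₀]` do not
  -- matter.
  obtain ⟨G₀, -⟩ := hB φ hφ δ₀ ⟨hδ₀, le_rfl⟩
  have hex : ∀ δ : ℝ, ∃ G : Bundle.ContMDiffRiemannianMetric 𝓘(ℝ, Corner.E (m + 1)) 2
      (Corner.E (m + 1)) (fun p : C.Glued => TangentSpace 𝓘(ℝ, Corner.E (m + 1)) p),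
      δ ∈ Ioc 0 δ₀ → _ := fun δ => by
    by_cases hδ : δ ∈ Ioc 0 δ₀
    · obtain ⟨G, hG⟩ := hB φ hφ δ hδ
      exact ⟨G, fun _ => hG⟩
    · exact ⟨G₀, fun h => absurd h hδ⟩
  choose gδ hgδ using hex
  -- With `δ² ≤ δ`, this choice makes `Q δ² ≤ η`; the added one covers `Q = 0`.
  refine ⟨gδ, fun η hη => ⟨η / (Q + 1), by positivity, fun δ hδ p v => ?_⟩, fun δ hδ => ?_⟩
  · have hδ' : δ ∈ Ioc 0 δ₀ := ⟨hδ.1, hδ.2.trans (min_le_left _ _)⟩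
    refine ((hgδ δ hδ').1 p v).trans (mul_le_mul_of_nonneg_right ?_ ?_)
    · have h1 : δ ≤ η / (Q + 1) := hδ.2.trans (min_le_right _ _)
      have h2 : δ ^ 2 ≤ δ := by nlinarith [hδ'.1, hδ'.2]
      calc Q * δ ^ 2 ≤ (Q + 1) * (η / (Q + 1)) :=
            mul_le_mul (by linarith) (h2.trans h1) (by positivity) (by positivity)
        _ = η := by field_simp
    · by_cases hv : v = 0
      · simp [hv]
      · exact (Corner.Collar.gluedMetric_pos hg hC p v hv).le
  · obtain ⟨-, h2, h3⟩ := hgδ δ hδ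
    refine ⟨h2, fun x t ht ht' => ?_, fun x t ht => h3 x t (ht.trans ?_)⟩
    -- Outside the layer the mollifier vanishes, so the general estimate is already a bound on the
    -- scalar curvature.
    · have h4 := h3 x t ht'
      rwa [hφ.scaled_eq_zero hδ.1 ht.le, mul_zero, sub_zero] at h4
    -- The layer lies in the strip: `δ²/100 ≤ δ/2` because `δ ≤ 1`.
    · nlinarith [hδ.1, hδ.2]
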